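/- An event is a tuple of a unique identifier, a thread identifier, an operation (read or write), a memory location and a value (the value read or written); identifiers, threads, locations and values are natural numbers. An abstract execution $\overline{X}=\langle E,\mathsf{po}\rangle$ consists of a finite set $E$ of events with pairwise distinct identifiers and a program order $\mathsf{po}$ which is a strict total order on the events of each thread and relates no events of different threads. An execution $\langle E,\mathsf{po},\mathsf{rf},\mathsf{mo}\rangle$ extends it by - a reads-from relation $\mathsf{rf}$ from writes to reads of $E$, relating only events with the same location and the same value, such that every read of $E$ reads from exactly one write, and - a modification order $\mathsf{mo}$, relating only writes of $E$ to the same location, which is a strict total order on the writes to each location. The execution is consistent in the model $\mathsf{Relaxed}$ if for every location $x$ the relations $$\mathsf{mo}_x;\mathsf{po}\qquad\text{and}\qquad \mathsf{rf}^{-1};\mathsf{mo}_x;\mathsf{rf}^{?};\mathsf{po}$$ are irreflexive, where $\mathsf{mo}_x$ is the restriction of $\mathsf{mo}$ to the events accessing $x$, $\mathsf{rf}^{?}$ is the reflexive closure of $\mathsf{rf}$, and $;$ is composition of relations from left to right. (Acyclicity of $\mathsf{po}\cup\mathsf{rf}$ is not required.) An abstract execution $\langle E,\mathsf{po}\rangle$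 is consistent in $\mathsf{Relaxed}$ if there are $\mathsf{rf}$ and $\mathsf{mo}$ such that $\langle E,\mathsf{po},\mathsf{rf},\mathsf{mo}\rangle$ is an execution that is consistent in $\mathsf{Relaxed}$. **Corollary.** For every fixed $k\in\mathbb{N}$, the following problem is decidable in (deterministic) polynomial time: given an abstract execution $\overline{X}$ whose events belong to at most $k$ threads, decide whether $\overline{X}$ is consistent in $\mathsf{Relaxed}$. That is, for every $k$ there are a deterministic multi-stack (equivalently, multi-tape) Turing machine and a polynomial $p$ such that, on every such $\overline{X}$, given as a string $s$ that lists its events, each exactly once and those of each thread in program order, with all numbers written in binary, the machine halts within $p(|s|)$ steps with the correct answer. The numbers of events, locations and values are not bounded. -/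

import Mathlib

namespace WeakMemory

/-- The kind of a memory operation. -/
inductive Op where
  | read
  | write
  deriving DecidableEq

/-- An event: a unique identifier, a thread identifier, and a label consisting of an operation,
a memory location and the value read or written. All accesses have relaxed memory order, so the
order is not recorded. -/
structure Event where
  id : ℕ
  tid : ℕ
  op : Op
  loc : ℕ
  val : ℕ
  deriving DecidableEq

/-- An abstract execution `⟨E, po⟩`: a finite set of events with unique identifiers, and a program
order that is a strict total order on the events of each thread and relates no events of
different threads. -/
structure AbstractExecution where
  E : Finset Event
  id_unique : ∀ a ∈ E, ∀ b ∈ E, a.id = b.id → a = b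
  po : Event → Event → Prop
  po_mem : ∀ a b, po a b → a ∈ E ∧ b ∈ E
  po_tid : ∀ a b, po a b → a.tid = b.tid
  po_irrefl : ∀ a, ¬ po a a
  po_trans : ∀ a b c, po a b → po b c → po a c
  po_total : ∀ a ∈ E, ∀ b ∈ E, a.tid = b.tid → a ≠ b → po a b ∨ po b a

/-- A (concrete) execution `⟨E, po, rf, mo⟩`. -/
structure Execution extends AbstractExecution where
  rf : Event → Event → Prop
  mo : Event → Event → Prop
  rf_mem : ∀ w r, rf w r → w ∈ E ∧ r ∈ E
  rf_op : ∀ w r, rf w r → w.op = Op.write ∧ r.op = Op.read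
  rf_loc : ∀ w r, rf w r → w.loc = r.loc
  rf_val : ∀ w r, rf w r → w.val = r.val
  rf_existsUnique : ∀ r ∈ E, r.op = Op.read → ∃! w, rf w r
  mo_mem : ∀ a b, mo a b → a ∈ E ∧ b ∈ E
  mo_op : ∀ a b, mo a b → a.op = Op.write ∧ b.op = Op.write
  mo_loc : ∀ a b, mo a b → a.loc = b.loc
  mo_irrefl : ∀ a, ¬ mo a a
  mo_trans : ∀ a b c, mo a b → mo b c → mo a c
  mo_total : ∀ a ∈ E, ∀ b ∈ E, a.op = Op.write → b.op = Op.write → a.loc = b.loc → a ≠ b →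
    mo a b ∨ mo b a

/-- The restriction `B_x` of a relation to the events that access location `x`. -/
def atLoc (x : ℕ) (B : Event → Event → Prop) (a b : Event) : Prop :=
  B a b ∧ a.loc = x ∧ b.loc = x

/-- `irr(B)`. -/
def Irr (B : Event → Event → Prop) : Prop := ∀ e, ¬ B e e

/-- `irr(mo_x ; po)` for every location `x`. -/
def RelaxedWriteCoherence (X : Execution) : Prop :=
  ∀ x, Irr (Relation.Comp (atLoc x X.mo) X.po)

/-- `irr(rf⁻¹ ; mo_x ; rf? ; po)` for every location `x`. -/
def RelaxedReadCoherence (X : Execution) : Prop :=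
  ∀ x, Irr (Relation.Comp (flip X.rf)
    (Relation.Comp (atLoc x X.mo) (Relation.Comp (Relation.ReflGen X.rf) X.po)))

/-- The Relaxed memory model (without acyclicity of `po ∪ rf`). -/
def Relaxed (X : Execution) : Prop :=
  RelaxedWriteCoherence X ∧ RelaxedReadCoherence X

/-- An abstract execution is consistent in a memory model if some extension of it by relations
`rf` and `mo` is an execution that satisfies the axioms of the model. -/
def AbstractExecution.Consistent (A : AbstractExecution) (M : Execution → Prop) : Prop :=
  ∃ X : Execution, X.toAbstractExecution = A ∧ M X

/-- The number of threads of an abstract execution. -/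
def AbstractExecution.numThreads (A : AbstractExecution) : ℕ :=
  (A.E.image Event.tid).card

/-- `L` presents `A` as a sequence: it lists every event of `A` exactly once, and the events of
each thread appear in program order. The order of events of different threads is arbitrary. -/
structure IsListing (A : AbstractExecution) (L : List Event) : Prop where
  nodup : L.Nodup
  mem_iff : ∀ e, e ∈ L ↔ e ∈ A.E
  po_iff : ∀ a b, A.po a b ↔ a.tid = b.tid ∧ [a, b].Sublist L

/-- The inputs of consistency testing with at most `k` threads: an abstract execution, presented
by an arbitrary listing. -/
structure Input (k : ℕ) where
  exec : AbstractExecution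
  listing : List Event
  isListing : IsListing exec listing
  threads_le : exec.numThreads ≤ k

open Computability in
/-- A natural number in binary. -/
def encodeNum (n : ℕ) : List Γ' := (encodeNat n).map Γ'.bit

open Computability in
/-- An event `(id,tid,op,loc,val)` as a string; the operation is one bit, 1 for a write. -/
def encodeEvent (e : Event) : List Γ' :=
  Γ'.bra :: (encodeNum e.id ++ Γ'.comma :: (encodeNum e.tid ++ Γ'.comma ::
    Γ'.bit (decide (e.op = Op.write)) :: Γ'.comma ::
      (encodeNum e.loc ++ Γ'.comma :: (encodeNum e.val ++ [Γ'.ket]))))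

/-- A sequence of events as a string. -/
def encodeList (L : List Event) : List Computability.Γ' := L.flatMap encodeEvent

/-- The string that a machine receives for an input. -/
def Input.encode {k : ℕ} (I : Input k) : List Computability.Γ' := encodeList I.listing

open Classical in
/-- A decision problem on a type of inputs with a given string encoding is in polynomial time:
a multi-stack Turing machine computes its characteristic function in a number of steps that is
polynomial in the length of the encoded input. -/
def InPolyTime {α Γ : Type} (encode : α → List Γ) (p : α → Prop) : Prop :=
  Nonempty (Turing.TM2ComputableInPolyTime encode Computability.encodeBool
    (fun a => decide (p a)))

/-- Every abstract execution has a listing. -/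
theorem AbstractExecution.exists_listing (A : AbstractExecution) : ∃ L, IsListing A L := by
  classical
  have hpo : IsPartialOrder Event (fun a b => a = b ∨ A.po a b) :=
    { refl := fun a => Or.inl rfl
      trans := by
        rintro a b c (rfl | h) (rfl | h')
        · exact Or.inl rfl
        · exact Or.inr h'
        · exact Or.inr h
        · exact Or.inr (A.po_trans _ _ _ h h')
      antisymm := by
        rintro a b (rfl | h) (h' | h')
        · rfl
        · rfl
        · exact h'.symm
        · exact absurd (A.po_trans _ _ _ h h') (A.po_irrefl _) }
  obtain ⟨s, hs, hle⟩ := extend_partialOrder (fun a b => a = b ∨ A.po a b)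
  have hn : (A.E.sort s).Nodup := Finset.sort_nodup A.E s
  have hp : (A.E.sort s).Pairwise s := Finset.pairwise_sort A.E s
  have key : ∀ (L : List Event) (a b : Event), a ∈ L → b ∈ L → a ≠ b →
      [a, b].Sublist L ∨ [b, a].Sublist L := by
    intro L
    induction L with
    | nil => intro a b ha; simp at ha
    | cons c L ih =>
      intro a b ha hb hab
      rcases List.mem_cons.1 ha with rfl | ha₁
      · rcases List.mem_cons.1 hb with rfl | hb₁
        · exact absurd rfl hab
        · exact Or.inl ((List.singleton_sublist.2 hb₁).cons_cons _)
      · rcases List.mem_cons.1 hb with rfl | hb₁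
        · exact Or.inr ((List.singleton_sublist.2 ha₁).cons_cons _)
        · exact (ih a b ha₁ hb₁ hab).imp (fun h => h.cons _) (fun h => h.cons _)
  have hsub : ∀ a b, [a, b].Sublist (A.E.sort s) → s a b ∧ a ≠ b ∧ a ∈ A.E ∧ b ∈ A.E := by
    intro a b h
    refine ⟨List.pairwise_iff_forall_sublist.1 hp h, ?_, ?_, ?_⟩
    · exact List.pairwise_iff_forall_sublist.1 hn h
    · exact (Finset.mem_sort s).1 (h.subset (by simp))
    · exact (Finset.mem_sort s).1 (h.subset (by simp))
  refine ⟨A.E.sort s, hn, fun e => Finset.mem_sort s, fun a b => ⟨fun h => ?_, ?_⟩⟩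
  · have hne : a ≠ b := fun hab => A.po_irrefl a (by simpa [hab] using h)
    obtain ⟨ha, hb⟩ := A.po_mem _ _ h
    refine ⟨A.po_tid _ _ h, ?_⟩
    rcases key _ a b ((Finset.mem_sort s).2 ha) ((Finset.mem_sort s).2 hb) hne with h' | h'
    · exact h'
    · exact absurd (antisymm (r := s) (hle _ _ (Or.inr h)) (hsub _ _ h').1) hne
  · rintro ⟨ht, h⟩
    obtain ⟨hab, hne, ha, hb⟩ := hsub _ _ h
    rcases A.po_total a ha b hb ht hne with h' | h'
    · exact h'
    · exact absurd (antisymm (r := s) hab (hle _ _ (Or.inr h'))) hne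

/-- A listing determines the abstract execution it presents. -/
theorem IsListing.unique {A B : AbstractExecution} {L : List Event} (hA : IsListing A L)
    (hB : IsListing B L) : A = B := by
  have hE : A.E = B.E := by ext e; rw [← hA.mem_iff, hB.mem_iff]
  have hpo : A.po = B.po := by
    funext a b; exact propext ((hA.po_iff a b).trans (hB.po_iff a b).symm)
  cases A; cases B; cases hE; cases hpo; rfl

/-- The string determines the sequence of events. -/
theorem encodeList_injective : Function.Injective encodeList := by
  have split : ∀ (m n : ℕ) (a b : Computability.Γ') (s t : List Computability.Γ'),
      (∀ c, a ≠ .bit c) → (∀ c, b ≠ .bit c) →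
      encodeNum m ++ a :: s = encodeNum n ++ b :: t → m = n ∧ s = t := by
    have aux : ∀ (l l' : List Bool) (a b : Computability.Γ') (s t : List Computability.Γ'),
        (∀ c, a ≠ .bit c) → (∀ c, b ≠ .bit c) →
        l.map Computability.Γ'.bit ++ a :: s = l'.map Computability.Γ'.bit ++ b :: t →
        l = l' ∧ s = t := by
      intro l
      induction l with
      | nil =>
        intro l' a b s t ha hb h
        cases l' with
        | nil => simp at h; exact ⟨rfl, h.2⟩
        | cons c l' => simp at h; exact absurd h.1 (ha c)
      | cons c l ih =>
        intro l' a b s t ha hb h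
        cases l' with
        | nil => simp at h; exact absurd h.1.symm (hb c)
        | cons d l' =>
          simp at h
          obtain ⟨h1, h2⟩ := ih l' a b s t ha hb (by simpa using h.2)
          exact ⟨by rw [h.1, h1], h2⟩
    intro m n a b s t ha hb h
    obtain ⟨h1, h2⟩ := aux _ _ a b s t ha hb h
    refine ⟨?_, h2⟩
    have := congrArg Computability.decodeNat h1
    simpa using this
  intro L
  induction L with
  | nil =>
    intro L' h
    cases L' with
    | nil => rfl
    | cons e L' => simp [encodeList, encodeEvent] at h
  | cons e L ih =>
    intro L' h
    cases L' with
    | nil => simp [encodeList, encodeEvent] at h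
    | cons e' L' =>
      simp only [encodeList, List.flatMap_cons, encodeEvent, List.cons_append, List.append_assoc,
        List.cons.injEq, true_and, List.nil_append] at h
      obtain ⟨h1, h⟩ := split _ _ _ _ _ _ (by simp) (by simp) h
      obtain ⟨h2, h⟩ := split _ _ _ _ _ _ (by simp) (by simp) h
      simp only [List.cons.injEq, true_and, Computability.Γ'.bit.injEq] at h
      obtain ⟨h3, h⟩ := h
      obtain ⟨h4, h⟩ := split _ _ _ _ _ _ (by simp) (by simp) h
      obtain ⟨h5, h⟩ := split _ _ _ _ _ _ (by simp) (by simp) h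
      have hop : e.op = e'.op := by
        cases ho : e.op <;> cases ho' : e'.op <;> simp [ho, ho'] at h3 ⊢
      rw [ih h]
      cases e; cases e'; simp_all

end WeakMemory

/-! Both axioms of `Relaxed` constrain only events at one location, so the locations are
independent. Along program order at one location they compare the sources of two events, the source
being the write that an event performs or reads from: the source of the later event must not precede
that of the earlier one in modification order, unless the earlier event is a read and the later one
a write. Sorting the events by source, each write in front of its readers, gives a linear order of
the events at the location. In it every read takes its value from the latest preceding write, and
program order is respected except that a write may overtake earlier reads of its own thread.
Conversely such orders define `rf` and `mo`. They are the `Timing`s, and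
`consistent_iff_exists_timing` is the equivalence.

An order of this kind is built greedily from left to right. As writes may overtake reads, each
thread needs two pointers, one for the writes already placed and one for the reads already served;
besides these only the last placed write matters. Threads are named by positions of representative
events, and locations are examined one after another, each given by the position of an event. A
state thus consists of `3 * k + 2` positions in the list of `n` events, which for fixed `k` is a
polynomial number of states. Successful runs and timings correspond by `Reach.exists_timing` and
`Timing.reach`. Every step lowers `rank`, so runs are shorter than `(n + 1) ^ (2 * k + 1)`
(`Reach.rank`, `rank_lt`).

The machine computes the states from which the goal is reachable by saturating a table. It passes
through all states `(n + 1) ^ (2 * k + 1)` times and records a state whenever one step leads from it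
to the goal or into the table; `saturate_iff` shows that this suffices. A state is stored as the
input string with some letters marked, so identifiers, locations and values of unbounded size are
only ever compared letter by letter. Each test is a formula decided in time linear in the store
(`Fml.computes`), the loops over states move marks (`runs_nestP`), and `inPolyTime_of_saturate`
bounds the total time. -/

namespace WeakMemory

open Turing Computability

/-! ### Structured programs on stacks -/

section Programs

variable {K : Type} {Γ : K → Type} {σ : Type}

/-- A statement without jumps of its own, ending in a jump to `e`. -/
def retarget {Λ : Type} (e : Λ) : TM2.Stmt Γ Unit σ → TM2.Stmt Γ Λ σ
  | .push k f q => .push k f (retarget e q)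
  | .peek k f q => .peek k f (retarget e q)
  | .pop k f q => .pop k f (retarget e q)
  | .load f q => .load f (retarget e q)
  | .branch b q₁ q₂ => .branch b (retarget e q₁) (retarget e q₂)
  | .goto _ => .goto fun _ => e
  | .halt => .goto fun _ => e

/-- Structured programs whose atomic actions are single steps of a stack machine. -/
inductive Prog (Γ : K → Type) (σ : Type) where
  | act (s : TM2.Stmt Γ Unit σ)
  | seq (p q : Prog Γ σ)
  | ite (b : σ → Bool) (p q : Prog Γ σ)
  | loop (b : σ → Bool) (p : Prog Γ σ)

namespace Prog

/-- The labels of the machine code of a program. -/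
def Label : Prog Γ σ → Type
  | act _ => Unit
  | seq p q => p.Label ⊕ q.Label
  | ite _ p q => Option (p.Label ⊕ q.Label)
  | loop _ p => Option p.Label

instance fintypeLabel : ∀ p : Prog Γ σ, Fintype p.Label
  | act _ => inferInstanceAs (Fintype Unit)
  | seq p q =>
    haveI := fintypeLabel p
    haveI := fintypeLabel q
    inferInstanceAs (Fintype (p.Label ⊕ q.Label))
  | ite _ p q =>
    haveI := fintypeLabel p
    haveI := fintypeLabel q
    inferInstanceAs (Fintype (Option (p.Label ⊕ q.Label)))
  | loop _ p =>
    haveI := fintypeLabel p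
    inferInstanceAs (Fintype (Option p.Label))

/-- The label at which the code of a program is entered. -/
def entry : ∀ p : Prog Γ σ, p.Label
  | act _ => ()
  | seq p _ => Sum.inl p.entry
  | ite _ _ _ => none
  | loop _ _ => none

/-- Machine code of a program whose labels are embedded by `emb` and that leaves to `exit`. -/
def code {Λ : Type} : ∀ p : Prog Γ σ, (p.Label → Λ) → Λ → p.Label → TM2.Stmt Γ Λ σ
  | act s, _, exit, _ => retarget exit s
  | seq p q, emb, exit, l =>
    match l with
    | Sum.inl l => p.code (fun l => emb (Sum.inl l)) (emb (Sum.inr q.entry)) l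
    | Sum.inr l => q.code (fun l => emb (Sum.inr l)) exit l
  | ite b p q, emb, exit, l =>
    match l with
    | none => .branch b (.goto fun _ => emb (some (Sum.inl p.entry)))
        (.goto fun _ => emb (some (Sum.inr q.entry)))
    | some (Sum.inl l) => p.code (fun l => emb (some (Sum.inl l))) exit l
    | some (Sum.inr l) => q.code (fun l => emb (some (Sum.inr l))) exit l
  | loop b p, emb, exit, l =>
    match l with
    | none => .branch b (.goto fun _ => emb (some p.entry)) (.goto fun _ => exit)
    | some l => p.code (fun l => emb (some l)) (emb none) l

variable [DecidableEq K]

/-- `Runs p v S v' S' t`: started with registers `v` and stacks `S`, the program `p` ends with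
registers `v'` and stacks `S'` after `t` machine steps. -/
inductive Runs : Prog Γ σ → σ → (∀ k, List (Γ k)) → σ → (∀ k, List (Γ k)) → ℕ → Prop where
  | act (s v S) : Runs (act s) v S (TM2.stepAux s v S).var (TM2.stepAux s v S).stk 1
  | seq {p q v S v₁ S₁ v₂ S₂ t₁ t₂} : Runs p v S v₁ S₁ t₁ → Runs q v₁ S₁ v₂ S₂ t₂ →
      Runs (seq p q) v S v₂ S₂ (t₁ + t₂)
  | iteTrue {b p q v S v₁ S₁ t} : b v = true → Runs p v S v₁ S₁ t →
      Runs (ite b p q) v S v₁ S₁ (1 + t)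
  | iteFalse {b p q v S v₁ S₁ t} : b v = false → Runs q v S v₁ S₁ t →
      Runs (ite b p q) v S v₁ S₁ (1 + t)
  | loopTrue {b p v S v₁ S₁ v₂ S₂ t₁ t₂} : b v = true → Runs p v S v₁ S₁ t₁ →
      Runs (loop b p) v₁ S₁ v₂ S₂ t₂ → Runs (loop b p) v S v₂ S₂ (1 + t₁ + t₂)
  | loopFalse {b p v S} : b v = false → Runs (loop b p) v S v S 1

theorem stepAux_retarget {Λ : Type} (e : Λ) (s : TM2.Stmt Γ Unit σ) (v : σ)
    (S : ∀ k, List (Γ k)) :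
    TM2.stepAux (retarget e s) v S =
      ⟨some e, (TM2.stepAux s v S).var, (TM2.stepAux s v S).stk⟩ := by
  induction s generalizing v S with
  | branch b q₁ q₂ h₁ h₂ =>
    simp only [retarget, TM2.stepAux]
    cases b v <;> simp [h₁, h₂]
  | _ => simp_all [retarget]

/-- The embedding and the exit are arbitrary because the code of a subprogram occurs inside that of
a larger one. The exit of one piece is the entry of the next, so the iterates compose. -/
theorem Runs.steps {Λ : Type} (M : Λ → TM2.Stmt Γ Λ σ) {p : Prog Γ σ} {v v' : σ}
    {S S' : ∀ k, List (Γ k)} {t : ℕ} (h : Runs p v S v' S' t) :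
    ∀ (emb : p.Label → Λ) (exit : Λ), (∀ l, M (emb l) = p.code emb exit l) →
      (flip bind (TM2.step M))^[t] (some ⟨some (emb p.entry), v, S⟩) =
        some ⟨some exit, v', S'⟩ := by
  induction h with
  | act s v S =>
    intro emb exit hM
    have := hM ()
    simp only [code] at this
    simp [flip, entry, this, stepAux_retarget]
  | seq _ _ ih₁ ih₂ =>
    intro emb exit hM
    rw [Nat.add_comm, Function.iterate_add_apply]
    have h₁ := ih₁ (fun l => emb (Sum.inl l)) _ (fun l => hM (Sum.inl l))
    have h₂ := ih₂ (fun l => emb (Sum.inr l)) _ (fun l => hM (Sum.inr l))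
    rw [← h₂, ← h₁]; rfl
  | iteTrue hb _ ih =>
    intro emb exit hM
    rw [Nat.add_comm, Function.iterate_add_apply, ← ih _ _ (fun l => hM (some (Sum.inl l)))]
    have := hM none
    simp only [code] at this
    simp [flip, entry, this, hb]
  | iteFalse hb _ ih =>
    intro emb exit hM
    rw [Nat.add_comm, Function.iterate_add_apply, ← ih _ _ (fun l => hM (some (Sum.inr l)))]
    have := hM none
    simp only [code] at this
    simp [flip, entry, this, hb]
  | loopTrue hb _ _ ih₁ ih₂ =>
    intro emb exit hM
    rw [Nat.add_comm, Function.iterate_add_apply, Nat.add_comm 1, Function.iterate_add_apply,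
      ← ih₂ emb exit hM]
    have := hM none
    simp only [code] at this
    have h₁ := ih₁ _ _ (fun l => hM (some l))
    congr 1
    rw [entry, ← h₁]
    simp [flip, this, hb]
  | loopFalse hb =>
    intro emb exit hM
    have := hM none
    simp only [code] at this
    simp [flip, entry, this, hb]

/-- `RunsIn p v S v' S' t`: as `Runs`, in at most `t` steps. -/
def RunsIn (p : Prog Γ σ) (v : σ) (S : ∀ k, List (Γ k)) (v' : σ) (S' : ∀ k, List (Γ k)) (t : ℕ) :
    Prop :=
  ∃ t' ≤ t, Runs p v S v' S' t'

theorem RunsIn.mono {p : Prog Γ σ} {v v' S S'} {t t' : ℕ} (h : RunsIn p v S v' S' t)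
    (ht : t ≤ t') : RunsIn p v S v' S' t' :=
  let ⟨s, hs, h⟩ := h; ⟨s, hs.trans ht, h⟩

theorem RunsIn.of_act {s : TM2.Stmt Γ Unit σ} {v v' S S'}
    (hv : (TM2.stepAux s v S).var = v') (hS : (TM2.stepAux s v S).stk = S') :
    RunsIn (act s) v S v' S' 1 :=
  ⟨1, le_rfl, hv ▸ hS ▸ Runs.act s v S⟩

theorem RunsIn.seq {p q : Prog Γ σ} {v v₁ v₂ S S₁ S₂} {t₁ t₂ : ℕ}
    (h₁ : RunsIn p v S v₁ S₁ t₁) (h₂ : RunsIn q v₁ S₁ v₂ S₂ t₂) :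
    RunsIn (seq p q) v S v₂ S₂ (t₁ + t₂) :=
  let ⟨_, l₁, r₁⟩ := h₁; let ⟨_, l₂, r₂⟩ := h₂; ⟨_, add_le_add l₁ l₂, r₁.seq r₂⟩

theorem RunsIn.iteTrue {b : σ → Bool} {p q : Prog Γ σ} {v v' S S'} {t : ℕ} (hb : b v = true)
    (h : RunsIn p v S v' S' t) : RunsIn (ite b p q) v S v' S' (1 + t) :=
  let ⟨_, l, r⟩ := h; ⟨_, Nat.add_le_add_left l 1, r.iteTrue hb⟩

theorem RunsIn.iteFalse {b : σ → Bool} {p q : Prog Γ σ} {v v' S S'} {t : ℕ} (hb : b v = false)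
    (h : RunsIn q v S v' S' t) : RunsIn (ite b p q) v S v' S' (1 + t) :=
  let ⟨_, l, r⟩ := h; ⟨_, Nat.add_le_add_left l 1, r.iteFalse hb⟩

theorem RunsIn.loopTrue {b : σ → Bool} {p : Prog Γ σ} {v v₁ v₂ S S₁ S₂} {t₁ t₂ : ℕ}
    (hb : b v = true) (h₁ : RunsIn p v S v₁ S₁ t₁) (h₂ : RunsIn (loop b p) v₁ S₁ v₂ S₂ t₂) :
    RunsIn (loop b p) v S v₂ S₂ (1 + t₁ + t₂) :=
  let ⟨_, l₁, r₁⟩ := h₁; let ⟨_, l₂, r₂⟩ := h₂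
  ⟨_, add_le_add (Nat.add_le_add_left l₁ 1) l₂, r₁.loopTrue hb r₂⟩

theorem RunsIn.loopFalse {b : σ → Bool} {p : Prog Γ σ} {v S} (hb : b v = false) :
    RunsIn (loop b p) v S v S 1 :=
  ⟨1, le_rfl, Runs.loopFalse hb⟩

/-- A loop that consumes the list `l` element by element: the configuration after consuming a
part of the list and before consuming `l` is `(reg m l, stk m l)`. -/
theorem RunsIn.loopList {α M : Type} {b : σ → Bool} {p : Prog Γ σ} (f : M → α → M)
    (reg : M → List α → σ) (stk : M → List α → ∀ k, List (Γ k)) (t : ℕ)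
    (hcons : ∀ m a l, b (reg m (a :: l)) = true)
    (hnil : ∀ m, b (reg m []) = false)
    (hstep : ∀ m a l, RunsIn p (reg m (a :: l)) (stk m (a :: l)) (reg (f m a) l) (stk (f m a) l) t)
    (m : M) (l : List α) :
    RunsIn (loop b p) (reg m l) (stk m l) (reg (l.foldl f m) []) (stk (l.foldl f m) [])
      ((t + 1) * l.length + 1) := by
  induction l generalizing m with
  | nil => exact (RunsIn.loopFalse (hnil m)).mono (by simp)
  | cons a l ih =>
    refine (RunsIn.loopTrue (hcons m a l) (hstep m a l) (ih (f m a))).mono ?_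
    simp only [List.length_cons]
    ring_nf
    omega

end Prog

end Programs

/-! ### Words with marked positions -/

section Words

variable {V : Type}

/-- A letter of a word in which finitely many positions, named by `V`, are marked. -/
abbrev Cell (V : Type) : Type := Γ' × (V → Bool)

/-- A letter without marks. -/
def plain (c : Γ') : Cell V := (c, fun _ => false)

/-- The variables whose value is `d`. -/
def marks (z : V → ℕ) (d : ℕ) : V → Bool := fun v => decide (z v = d)

/-- The string of an event without its opening bracket. -/
def eventTail (e : Event) : List Γ' :=
  encodeNum e.id ++ Γ'.comma :: (encodeNum e.tid ++ Γ'.comma ::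
    Γ'.bit (decide (e.op = Op.write)) :: Γ'.comma ::
      (encodeNum e.loc ++ Γ'.comma :: (encodeNum e.val ++ [Γ'.ket])))

/-- The string of a sequence of events, followed by a blank, in which the values `z` of the
variables are marked: the value `d + i` is marked at the start of the `i`-th event, and the value
`d + L.length` at the blank. -/
def word (z : V → ℕ) : ℕ → List Event → List (Cell V)
  | d, [] => [(Γ'.blank, marks z d)]
  | d, e :: L => (Γ'.bra, marks z d) :: ((eventTail e).map plain ++ word z (d + 1) L)

/-- The length of the words that represent assignments. -/
def wordLength (L : List Event) : ℕ := (encodeList L).length + 1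

/-- Marks occupy no letters of their own, so the words of two assignments over the same events are
aligned letter by letter. The comparison in `lockstep` depends on this. -/
theorem length_word (z : V → ℕ) (d : ℕ) (L : List Event) :
    (word z d L).length = wordLength L := by
  induction L generalizing d with
  | nil => rfl
  | cons e L ih =>
    have : encodeEvent e = Γ'.bra :: eventTail e := rfl
    simp only [word, List.length_cons, List.length_append, List.length_map, ih, wordLength,
      encodeList, List.flatMap_cons, this]
    omega

/-- The letters that start an event or end the word. -/
def isAnchor : Γ' → Bool
  | .bra => true
  | .blank => true
  | _ => false

theorem isAnchor_of_mem_eventTail {e : Event} {c : Γ'} (h : c ∈ eventTail e) :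
    isAnchor c = false := by
  simp only [eventTail, encodeNum, List.mem_append, List.mem_map, List.mem_cons,
    List.not_mem_nil, or_false] at h
  rcases h with ⟨b, _, rfl⟩ | rfl | ⟨b, _, rfl⟩ | rfl | rfl | rfl | ⟨b, _, rfl⟩ | rfl |
    ⟨b, _, rfl⟩ | rfl <;> rfl

end Words

/-! ### Stacks and registers -/

/-- The stacks of the machine. -/
inductive Stack where
  | inp | out | A | B | T | U | X | Y
  deriving DecidableEq

instance : Fintype Stack where
  elems := {.inp, .out, .A, .B, .T, .U, .X, .Y}
  complete k := by cases k <;> decide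

/-- The alphabets of the stacks. -/
@[reducible] def Alph (V : Type) : Stack → Type
  | .inp => Γ'
  | .out => Bool
  | .A => Cell V
  | .B => Cell V
  | .T => Cell V
  | .U => Cell V
  | .X => Cell V
  | .Y => Cell V

/-- The contents of the stacks. -/
def mem {V : Type} (i : List Γ') (o : List Bool) (a b t u x y : List (Cell V)) :
    ∀ k, List (Alph V k)
  | .inp => i
  | .out => o
  | .A => a
  | .B => b
  | .T => t
  | .U => u
  | .X => x
  | .Y => y

/-- The registers of the machine. -/
structure Reg (V : Type) where
  cur : Option (Cell V)
  cur₂ : Option (Cell V)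
  cnt : Fin 8
  cnt₂ : Fin 8
  prev : V → Bool
  fst : Bool
  res : Bool
  found : Bool
  acc : Bool

section Registers

variable {V : Type}

noncomputable instance [Fintype V] [DecidableEq V] : Fintype (Reg V) :=
  Fintype.ofInjective
    (fun r => (r.cur, r.cur₂, r.cnt, r.cnt₂, r.prev, r.fst, r.res, r.found, r.acc))
    (by
      rintro ⟨⟩ ⟨⟩ h
      simp only [Prod.mk.injEq] at h
      obtain ⟨rfl, rfl, rfl, rfl, rfl, rfl, rfl, rfl, rfl⟩ := h
      rfl)

/-- The initial registers. -/
def Reg.start : Reg V := ⟨none, none, 0, 0, fun _ => false, false, false, false, false⟩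

/-- The letter held in the first letter register. -/
def Reg.cell (r : Reg V) : Cell V := r.cur.getD (plain .blank)

/-- The letter held in the second letter register. -/
def Reg.cell₂ (r : Reg V) : Cell V := r.cur₂.getD (plain .blank)

section Updates
variable (i i' : List Γ') (o o' : List Bool) (a b t u x y s : List (Cell V))

@[simp] theorem update_inp :
    Function.update (mem i o a b t u x y) .inp i' = mem i' o a b t u x y := by
  funext k; cases k <;> simp [Function.update, mem]
@[simp] theorem update_out :
    Function.update (mem i o a b t u x y) .out o' = mem i o' a b t u x y := by
  funext k; cases k <;> simp [Function.update, mem]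
@[simp] theorem update_A :
    Function.update (mem i o a b t u x y) .A s = mem i o s b t u x y := by
  funext k; cases k <;> simp [Function.update, mem]
@[simp] theorem update_B :
    Function.update (mem i o a b t u x y) .B s = mem i o a s t u x y := by
  funext k; cases k <;> simp [Function.update, mem]
@[simp] theorem update_T :
    Function.update (mem i o a b t u x y) .T s = mem i o a b s u x y := by
  funext k; cases k <;> simp [Function.update, mem]
@[simp] theorem update_U :
    Function.update (mem i o a b t u x y) .U s = mem i o a b t s x y := by
  funext k; cases k <;> simp [Function.update, mem]
@[simp] theorem update_X :
    Function.update (mem i o a b t u x y) .X s = mem i o a b t u s y := by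
  funext k; cases k <;> simp [Function.update, mem]
@[simp] theorem update_Y :
    Function.update (mem i o a b t u x y) .Y s = mem i o a b t u x s := by
  funext k; cases k <;> simp [Function.update, mem]
@[simp] theorem mem_inp : mem i o a b t u x y .inp = i := rfl
@[simp] theorem mem_out : mem i o a b t u x y .out = o := rfl
@[simp] theorem mem_A : mem i o a b t u x y .A = a := rfl
@[simp] theorem mem_B : mem i o a b t u x y .B = b := rfl
@[simp] theorem mem_T : mem i o a b t u x y .T = t := rfl
@[simp] theorem mem_U : mem i o a b t u x y .U = u := rfl
@[simp] theorem mem_X : mem i o a b t u x y .X = x := rfl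
@[simp] theorem mem_Y : mem i o a b t u x y .Y = y := rfl

end Updates

/-- Programs of the machine. -/
abbrev Pr (V : Type) : Type := Prog (Alph V) (Reg V)

/-- Straight-line code of the machine. -/
abbrev Code (V : Type) : Type := TM2.Stmt (Alph V) Unit (Reg V)

/-- The end of straight-line code. -/
abbrev done : Code V := .halt

/-- Change the registers. -/
def setReg (f : Reg V → Reg V) : Pr V := .act (.load f done)

theorem runs_setReg (f : Reg V → Reg V) (v : Reg V) (S) :
    (setReg f).RunsIn v S (f v) S 1 :=
  .of_act rfl rfl

/-! ### Moving a word between stacks -/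

/-- Pop the stack `B` onto the stack `A`. -/
def restore : Pr V :=
  .seq (.act (.pop .B (fun v o => { v with cur := o }) done))
    (.loop (fun v => v.cur.isSome)
      (.act (.push .A Reg.cell (.pop .B (fun v o => { v with cur := o }) done))))

theorem runs_restore (v : Reg V) (i o a b t u x y) :
    restore.RunsIn v (mem i o a b t u x y) { v with cur := none }
      (mem i o (b.reverse ++ a) [] t u x y) (2 * b.length + 2) := by
  have h := Prog.RunsIn.loopList (Γ := Alph V) (σ := Reg V) (b := fun v => v.cur.isSome)
    (p := .act (.push .A Reg.cell (.pop .B (fun v o => { v with cur := o }) done)))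
    (fun (m : List (Cell V)) c => c :: m)
    (fun _ l => { v with cur := l.head? })
    (fun m l => mem i o m l.tail t u x y) 1
    (by simp) (by simp)
    (fun m c l => .of_act (by simp) (by simp [Reg.cell])) a b
  simp only [List.foldl_flip_cons_eq_append', List.head?_nil, List.tail_nil] at h
  refine (Prog.RunsIn.seq (.of_act ?_ ?_) h).mono (by omega)
  · simp
  · simp

/-- Pop the stack `U` onto the stack `T`. -/
def restoreTable : Pr V :=
  .seq (.act (.pop .U (fun v o => { v with cur := o }) done))
    (.loop (fun v => v.cur.isSome)
      (.act (.push .T Reg.cell (.pop .U (fun v o => { v with cur := o }) done))))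

theorem runs_restoreTable (v : Reg V) (i o a b t u x y) :
    restoreTable.RunsIn v (mem i o a b t u x y) { v with cur := none }
      (mem i o a b (u.reverse ++ t) [] x y) (2 * u.length + 2) := by
  have h := Prog.RunsIn.loopList (Γ := Alph V) (σ := Reg V) (b := fun v => v.cur.isSome)
    (p := .act (.push .T Reg.cell (.pop .U (fun v o => { v with cur := o }) done)))
    (fun (m : List (Cell V)) c => c :: m)
    (fun _ l => { v with cur := l.head? })
    (fun m l => mem i o a b m l.tail x y) 1
    (by simp) (by simp)
    (fun m c l => .of_act (by simp) (by simp [Reg.cell])) t u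
  simp only [List.foldl_flip_cons_eq_append', List.head?_nil, List.tail_nil] at h
  refine (Prog.RunsIn.seq (.of_act ?_ ?_) h).mono (by omega)
  · simp
  · simp

/-- Pop the stack `B` onto the stacks `A` and `T`. -/
def restoreBoth : Pr V :=
  .seq (.act (.pop .B (fun v o => { v with cur := o }) done))
    (.loop (fun v => v.cur.isSome)
      (.act (.push .A Reg.cell (.push .T Reg.cell
        (.pop .B (fun v o => { v with cur := o }) done)))))

theorem runs_restoreBoth (v : Reg V) (i o a b t u x y) :
    restoreBoth.RunsIn v (mem i o a b t u x y) { v with cur := none }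
      (mem i o (b.reverse ++ a) [] (b.reverse ++ t) u x y) (2 * b.length + 2) := by
  have h := Prog.RunsIn.loopList (Γ := Alph V) (σ := Reg V) (b := fun v => v.cur.isSome)
    (p := .act (.push .A Reg.cell (.push .T Reg.cell
        (.pop .B (fun v o => { v with cur := o }) done))))
    (fun (m : List (Cell V) × List (Cell V)) c => (c :: m.1, c :: m.2))
    (fun _ l => { v with cur := l.head? })
    (fun m l => mem i o m.1 l.tail m.2 u x y) 1
    (by simp) (by simp)
    (fun m c l => .of_act (by simp) (by simp [Reg.cell])) (a, t) b
  have hf : ∀ (l : List (Cell V)) (m : List (Cell V) × List (Cell V)),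
      l.foldl (fun m c => (c :: m.1, c :: m.2)) m = (l.reverse ++ m.1, l.reverse ++ m.2) := by
    intro l
    induction l with
    | nil => simp
    | cons c l ih => intro m; simp [ih]
  rw [hf] at h
  simp only [List.head?_nil, List.tail_nil] at h
  refine (Prog.RunsIn.seq (.of_act ?_ ?_) h).mono (by omega)
  · simp
  · simp

/-! ### Sweeps: a transducer reads the word on `A` -/

/-- The effect of a sweep on registers and the stacks `B`, `X`, `Y`, letter by letter. -/
def sweepStep (step : Reg V → Reg V) (oX oY : Reg V → Bool)
    (m : Reg V × List (Cell V) × List (Cell V) × List (Cell V)) (c : Cell V) :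
    Reg V × List (Cell V) × List (Cell V) × List (Cell V) :=
  let v := step { m.1 with cur := some c }
  (v, v.cell :: m.2.1, if oX v then v.cell :: m.2.2.1 else m.2.2.1,
    if oY v then v.cell :: m.2.2.2 else m.2.2.2)

/-- Move the word on `A` to `B`, transforming each letter by `step` and copying it to `X` and `Y`
when `oX` or `oY` holds. -/
def scan (step : Reg V → Reg V) (oX oY : Reg V → Bool) : Pr V :=
  let last : Code V := .push .B Reg.cell (.pop .A (fun v o => { v with cur := o }) done)
  let second : Code V := .branch oY (.push .Y Reg.cell last) last
  .seq (.act (.pop .A (fun v o => { v with cur := o }) done))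
    (.loop (fun v => v.cur.isSome)
      (.act (.load step (.branch oX (.push .X Reg.cell second) second))))

theorem runs_scan (step : Reg V → Reg V) (oX oY : Reg V → Bool) (v : Reg V) (i o a b t u x y) :
    let m := a.foldl (sweepStep step oX oY) (v, b, x, y)
    (scan step oX oY).RunsIn v (mem i o a b t u x y) { m.1 with cur := none }
      (mem i o [] m.2.1 t u m.2.2.1 m.2.2.2) (2 * a.length + 2) := by
  have h := Prog.RunsIn.loopList (Γ := Alph V) (σ := Reg V) (b := fun v => v.cur.isSome)
    (p := .act (.load step (.branch oX (.push .X Reg.cell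
      (.branch oY (.push .Y Reg.cell
        (.push .B Reg.cell (.pop .A (fun v o => { v with cur := o }) done)))
        (.push .B Reg.cell (.pop .A (fun v o => { v with cur := o }) done))))
      (.branch oY (.push .Y Reg.cell
        (.push .B Reg.cell (.pop .A (fun v o => { v with cur := o }) done)))
        (.push .B Reg.cell (.pop .A (fun v o => { v with cur := o }) done))))))
    (sweepStep step oX oY)
    (fun m l => { m.1 with cur := l.head? })
    (fun m l => mem i o l.tail m.2.1 t u m.2.2.1 m.2.2.2) 1
    (by simp) (by simp)
    (fun m c l => by
      refine .of_act ?_ ?_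
      · simp only [List.head?_cons, TM2.stepAux, sweepStep]
        cases oX (step { m.1 with cur := some c }) <;>
          cases oY (step { m.1 with cur := some c }) <;> simp
      · simp only [List.head?_cons, TM2.stepAux, sweepStep]
        cases oX (step { m.1 with cur := some c }) <;>
          cases oY (step { m.1 with cur := some c }) <;> simp)
    (v, b, x, y) a
  simp only [List.head?_nil, List.tail_nil] at h
  refine (Prog.RunsIn.seq (.of_act ?_ ?_) h).mono (by omega)
  · simp
  · simp

/-- A scan followed by the restoration of the word on `A`. -/
def sweep (ini step : Reg V → Reg V) (oX oY : Reg V → Bool) : Pr V :=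
  .seq (setReg ini) (.seq (scan step oX oY) restore)

theorem length_sweepStep (step : Reg V → Reg V) (oX oY : Reg V → Bool) (a : List (Cell V)) (m) :
    (a.foldl (sweepStep step oX oY) m).2.1.length = a.length + m.2.1.length := by
  induction a generalizing m with
  | nil => simp
  | cons c a ih => simp [ih, sweepStep]; omega

theorem runs_sweep (ini step : Reg V → Reg V) (oX oY : Reg V → Bool) (v : Reg V)
    (i o a t u x y) :
    let m := a.foldl (sweepStep step oX oY) (ini v, [], x, y)
    (sweep ini step oX oY).RunsIn v (mem i o a [] t u x y) { m.1 with cur := none }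
      (mem i o m.2.1.reverse [] t u m.2.2.1 m.2.2.2) (4 * a.length + 5) := by
  intro m
  have h₁ := runs_scan step oX oY (ini v) i o a [] t u x y
  have h₂ := runs_restore { m.1 with cur := none } i o [] m.2.1 t u m.2.2.1 m.2.2.2
  rw [List.append_nil] at h₂
  refine ((runs_setReg ini v _).seq (h₁.seq h₂)).mono ?_
  have := length_sweepStep step oX oY a (ini v, [], x, y)
  simp only [List.length_nil, add_zero] at this
  simp only [m, this]
  omega

/-- A sweep that leaves the word unchanged and has no output. -/
theorem runs_sweep_pure (ini step : Reg V → Reg V) (hstep : ∀ v, (step v).cur = v.cur)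
    (v : Reg V) (i o a t u x y) :
    (sweep ini step (fun _ => false) (fun _ => false)).RunsIn v (mem i o a [] t u x y)
      { a.foldl (fun r c => step { r with cur := some c }) (ini v) with cur := none }
      (mem i o a [] t u x y) (4 * a.length + 5) := by
  have h := runs_sweep ini step (fun _ => false) (fun _ => false) v i o a t u x y
  have hf : ∀ (l : List (Cell V)) (r : Reg V) (b : List (Cell V)),
      l.foldl (sweepStep step (fun _ => false) (fun _ => false)) (r, b, x, y) =
        (l.foldl (fun r c => step { r with cur := some c }) r, l.reverse ++ b, x, y) := by
    intro l
    induction l with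
    | nil => simp
    | cons c l ih => intro r b; simp [sweepStep, ih, Reg.cell, hstep]
  simp only [hf] at h
  simpa using h

end Registers

section Tests

variable {V : Type}

/-! ### Comparing assignments -/

/-- How the value of a variable in one assignment is determined by another assignment. -/
inductive Src (V : Type) where
  | any
  | keep
  | copy (w : V)
  | shift
  | zero
  | top

/-- The value that is determined for the variable `v` by the assignment `z`, if `n` is the largest
value. -/
def Src.val (z : V → ℕ) (n : ℕ) (v : V) : Src V → ℕ
  | any => 0
  | keep => z v
  | copy w => z w
  | shift => z v + 1
  | zero => 0
  | top => n

/-- `u` is determined by `z` as described by `src`. -/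
def Fits (src : V → Src V) (z u : V → ℕ) (n : ℕ) : Prop :=
  ∀ v, src v ≠ .any → u v = (src v).val z n v

/-- The mark of `v` that is expected at the current position. -/
def Src.expect (r : Reg V) (c : Cell V) (v : V) : Src V → Bool
  | any => true
  | keep => c.2 v
  | copy w => c.2 w
  | shift => r.prev v
  | zero => r.fst
  | top => decide (c.1 = Γ'.blank)

open Classical in
/-- One step of the comparison of two words. -/
noncomputable def matchReg (src : V → Src V) (c d : Cell V) (r : Reg V) : Reg V :=
  if isAnchor c.1 then
    { r with
      res := r.res && decide (∀ v, src v ≠ .any → d.2 v = (src v).expect r c v)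
      prev := c.2
      fst := false }
  else r

/-- The registers before the comparison of two words. -/
def matchInit (r : Reg V) : Reg V := { r with prev := fun _ => false, fst := true, res := true }

/-- One step of the comparison of two words, with the letters in the registers. -/
noncomputable def matchStep (src : V → Src V) (r : Reg V) (p : Cell V × Cell V) : Reg V :=
  matchReg src p.1 p.2 { r with cur := some p.1, cur₂ := some p.2 }

theorem foldl_matchStep_acc (src : V → Src V) (l : List (Cell V × Cell V)) (r : Reg V) :
    (l.foldl (matchStep src) r).acc = r.acc ∧ (l.foldl (matchStep src) r).found = r.found := by
  induction l generalizing r with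
  | nil => exact ⟨rfl, rfl⟩
  | cons p l ih =>
    rw [List.foldl_cons, (ih _).1, (ih _).2]
    unfold matchStep matchReg
    split <;> exact ⟨rfl, rfl⟩

/-- Positions are marked only at anchors, and the interior of an event contains none. -/
theorem foldl_matchStep_tail (src : V → Src V) (e : Event) (r : Reg V) :
    let r' := (((eventTail e).map plain).zip ((eventTail e).map plain)).foldl (matchStep src) r
    r'.res = r.res ∧ r'.prev = r.prev ∧ r'.fst = r.fst := by
  have : ∀ (l : List Γ') (r : Reg V), (∀ c ∈ l, isAnchor c = false) →
      let r' := ((l.map plain).zip (l.map plain)).foldl (matchStep src) r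
      r'.res = r.res ∧ r'.prev = r.prev ∧ r'.fst = r.fst := by
    intro l
    induction l with
    | nil => intro r _; exact ⟨rfl, rfl, rfl⟩
    | cons c l ih =>
      intro r h
      have h' := ih (matchStep src r (plain c, plain c)) fun c' h' => h c' (by simp [h'])
      have hc : isAnchor c = false := h c (by simp)
      simpa [matchStep, matchReg, plain, hc] using h'
  exact this _ _ fun c => isAnchor_of_mem_eventTail

/-- `prev` and `fst` supply what the current letter does not show: the marks at the preceding
anchor, needed for `shift`, and whether this is the first anchor, needed for `zero`. The end is
recognised by its blank. -/
theorem Src.marks_eq_expect {s : Src V} (hs : s ≠ .any) {z u : V → ℕ} {d n : ℕ} {r : Reg V} {c : Γ'}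
    (hprev : ∀ v, r.prev v = decide (z v + 1 = d)) (hfst : r.fst = decide (d = 0))
    (hn : c = .blank ↔ n = d) (v : V) :
    marks u d v = s.expect r (c, marks z d) v ↔ (u v = d ↔ s.val z n v = d) := by
  cases s with
  | any => exact absurd rfl hs
  | keep => simp [marks, Src.expect, Src.val]
  | copy w => simp [marks, Src.expect, Src.val]
  | shift => simp [marks, Src.expect, Src.val, hprev]
  | zero => simp [marks, Src.expect, Src.val, hfst, eq_comm]
  | top => simp [marks, Src.expect, Src.val, hn]

/-- Stated for a suffix that begins at position `d`, so that the induction goes through; such a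
suffix shows only the marks at positions `d` to `d + L.length`. -/
theorem foldl_matchStep_word (src : V → Src V) (z u : V → ℕ) (L : List Event) (d : ℕ) (r : Reg V)
    (hprev : ∀ v, r.prev v = decide (z v + 1 = d)) (hfst : r.fst = decide (d = 0)) :
    (((word z d L).zip (word u d L)).foldl (matchStep src) r).res = true ↔
      r.res = true ∧ ∀ v, src v ≠ .any → ∀ i, d ≤ i → i ≤ d + L.length →
        (u v = i ↔ (src v).val z (d + L.length) v = i) := by
  induction L generalizing d r with
  | nil =>
    simp only [word, List.zip_cons_cons, List.zip_nil_right, List.foldl_cons, List.foldl_nil,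
      matchStep, matchReg, isAnchor, if_true, Bool.and_eq_true, decide_eq_true_eq,
      List.length_nil, add_zero]
    refine and_congr_right fun _ => forall_congr' fun v => forall_congr' fun hv => ?_
    refine (Src.marks_eq_expect (c := .blank) (n := d) hv hprev hfst (by simp) v).trans ?_
    constructor
    · intro h i h₁ h₂
      obtain rfl : i = d := by omega
      exact h
    · intro h
      exact h d le_rfl le_rfl
  | cons e L ih =>
    simp only [word, List.zip_cons_cons, List.foldl_cons]
    rw [List.zip_append rfl, List.foldl_append]
    obtain ⟨h₁, h₂, h₃⟩ := foldl_matchStep_tail src e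
      (matchStep src r ((Γ'.bra, marks z d), (Γ'.bra, marks u d)))
    have hp : ∀ v, (matchStep src r ((Γ'.bra, marks z d), (Γ'.bra, marks u d))).prev v =
        decide (z v + 1 = d + 1) := by
      intro v; simp [matchStep, matchReg, isAnchor, marks]
    have hf : (matchStep src r ((Γ'.bra, marks z d), (Γ'.bra, marks u d))).fst =
        decide (d + 1 = 0) := by
      simp [matchStep, matchReg, isAnchor]
    rw [ih (d + 1) _ (fun v => by rw [h₂, hp]) (by rw [h₃, hf])]
    rw [h₁]
    have hr : (matchStep src r ((Γ'.bra, marks z d), (Γ'.bra, marks u d))).res = true ↔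
        r.res = true ∧ ∀ v, src v ≠ .any →
          (u v = d ↔ (src v).val z (d + (L.length + 1)) v = d) := by
      simp only [matchStep, matchReg, isAnchor, if_true, Bool.and_eq_true, decide_eq_true_eq]
      refine and_congr_right fun _ => forall_congr' fun v => forall_congr' fun hv =>
        Src.marks_eq_expect hv hprev hfst (by simp) v
    rw [hr, and_assoc]
    refine and_congr_right fun _ => ?_
    rw [← forall_and]
    refine forall_congr' fun v => ?_
    rw [← forall_and]
    refine forall_congr' fun hv => ?_
    have hn : d + 1 + L.length = d + (L.length + 1) := by omega
    rw [hn, List.length_cons]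
    constructor
    · rintro ⟨ha, hb⟩ i h₁ h₂
      rcases h₁.eq_or_lt with rfl | h₁
      · exact ha
      · exact hb i h₁ h₂
    · intro h
      exact ⟨h d le_rfl (by omega), fun i h₁ h₂ => h i (by omega) h₂⟩

/-- A value beyond the word would be invisible, hence the bound on `u`: agreement of the marks at
the position `u v` already forces equality. In particular nothing matches a `shift` past the end. -/
theorem matchStep_word_iff (src : V → Src V) (z u : V → ℕ) (L : List Event) (r : Reg V)
    (hu : ∀ v, u v ≤ L.length) :
    (((word z 0 L).zip (word u 0 L)).foldl (matchStep src) (matchInit r)).res = true ↔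
      Fits src z u L.length := by
  rw [foldl_matchStep_word src z u L 0 (matchInit r) (fun v => by simp [matchInit])
    (by simp [matchInit])]
  simp only [matchInit, true_and, Nat.zero_le, zero_add, forall_true_left]
  refine forall_congr' fun v => forall_congr' fun hv => ⟨fun h => ?_, fun h i _ => by rw [h]⟩
  exact ((h (u v) (hu v)).1 rfl).symm

/-! ### Programs that decide -/

/-- The table that represents a list of assignments. -/
def table (G : List (V → ℕ)) (L : List Event) : List (Cell V) := G.flatMap fun u => word u 0 L

theorem length_table (G : List (V → ℕ)) (L : List Event) :
    (table G L).length = G.length * wordLength L := by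
  induction G with
  | nil => simp [table]
  | cons u G ih =>
    simp only [table, List.flatMap_cons, List.length_append, length_word, List.length_cons] at ih ⊢
    rw [ih]; ring

/-- The stacks when the assignment `z` and the table of the assignments `G` are stored. -/
def store (L : List Event) (z : V → ℕ) (G : List (V → ℕ)) : ∀ k, List (Alph V k) :=
  mem [] [] (word z 0 L) [] (table G L) [] [] []

/-- The program `p` computes the truth value of `φ` in time linear in the size of the store. -/
def Computes (p : Pr V) (φ : List Event → (V → ℕ) → List (V → ℕ) → Prop) : Prop :=
  ∃ C, ∀ (L : List Event) (z : V → ℕ) (G : List (V → ℕ)), (∀ v, z v ≤ L.length) →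
    (∀ u ∈ G, ∀ v, u v ≤ L.length) → ∀ r : Reg V, ∃ r' : Reg V, r'.acc = r.acc ∧
      (r'.res = true ↔ φ L z G) ∧
      p.RunsIn r (store L z G) r' (store L z G) (C * (wordLength L + 1) * (G.length + 1))

/-- Brings the cost of tests that do not read the table into the form required by `Computes`. -/
theorem le_linear {a b w g : ℕ} : a * w + b ≤ (a + b) * (w + 1) * (g + 1) := by
  nlinarith [Nat.zero_le (a * w * g), Nat.zero_le (a * g), Nat.zero_le (b * w * g),
    Nat.zero_le (b * g), Nat.zero_le (b * w), Nat.zero_le a]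

/-- The test whether the current assignment satisfies `src`. -/
noncomputable def chkP (src : V → Src V) : Pr V :=
  sweep matchInit (fun r => matchReg src r.cell r.cell { r with cur₂ := r.cur })
    (fun _ => false) (fun _ => false)

theorem computes_chkP (src : V → Src V) :
    Computes (chkP src) fun L z _ => Fits src z z L.length := by
  refine ⟨4 + 5, fun L z G hz _ r => ?_⟩
  have hs : ∀ r : Reg V, (matchReg src r.cell r.cell { r with cur₂ := r.cur }).cur = r.cur := by
    intro r; unfold matchReg; split <;> rfl
  have h := runs_sweep_pure matchInit
    (fun r => matchReg src r.cell r.cell { r with cur₂ := r.cur }) hs r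
    [] [] (word z 0 L) (table G L) [] [] []
  have hf : ∀ (l : List (Cell V)) (r : Reg V), l.foldl (fun r c =>
      (fun r => matchReg src r.cell r.cell { r with cur₂ := r.cur })
        { r with cur := some c }) r = (l.zip l).foldl (matchStep src) r := by
    intro l
    induction l with
    | nil => simp
    | cons c l ih =>
      intro r
      rw [List.foldl_cons, ih]
      rfl
  rw [hf, length_word] at h
  refine ⟨_, ?_, ?_, h.mono le_linear⟩
  · exact (foldl_matchStep_acc src _ _).1
  · exact matchStep_word_iff src z z L r hz

/-- Compare the word on `A` with the first word on `T`, moving them to `B` and `U`. -/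
noncomputable def lockstep (src : V → Src V) : Pr V :=
  .seq (.act (.pop .A (fun v o => { v with cur := o }) done))
    (.loop (fun v => v.cur.isSome)
      (.act (.pop .T (fun v o => { v with cur₂ := o })
        (.load (fun v => matchReg src v.cell v.cell₂ v)
          (.push .B Reg.cell (.push .U Reg.cell₂
            (.pop .A (fun v o => { v with cur := o }) done)))))))

theorem runs_lockstep (src : V → Src V) (l : List (Cell V × Cell V)) (r : Reg V) (i o b t u x y) :
    (lockstep src).RunsIn r (mem i o (l.map Prod.fst) b (l.map Prod.snd ++ t) u x y)
      { l.foldl (matchStep src) r with cur := none }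
      (mem i o [] ((l.map Prod.fst).reverse ++ b) t ((l.map Prod.snd).reverse ++ u) x y)
      (2 * l.length + 2) := by
  have hc : ∀ (c d : Cell V) (r : Reg V), (matchReg src c d r).cur = r.cur ∧
      (matchReg src c d r).cur₂ = r.cur₂ := by
    intro c d r; unfold matchReg; split <;> exact ⟨rfl, rfl⟩
  have h := Prog.RunsIn.loopList (Γ := Alph V) (σ := Reg V) (b := fun v => v.cur.isSome)
    (p := .act (.pop .T (fun v o => { v with cur₂ := o })
        (.load (fun v => matchReg src v.cell v.cell₂ v)
          (.push .B Reg.cell (.push .U Reg.cell₂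
            (.pop .A (fun v o => { v with cur := o }) done))))))
    (fun (m : Reg V × List (Cell V) × List (Cell V)) (p : Cell V × Cell V) =>
      (matchStep src m.1 p, p.1 :: m.2.1, p.2 :: m.2.2))
    (fun m l => { m.1 with cur := l.head?.map Prod.fst })
    (fun m l => mem i o (l.map Prod.fst).tail m.2.1 (l.map Prod.snd ++ t) m.2.2 x y) 1
    (by simp) (by simp)
    (fun m p l => by
      refine .of_act ?_ ?_
      · simp [matchStep, Reg.cell, Reg.cell₂]
      · simp [Reg.cell, Reg.cell₂, hc])
    (r, b, u) l
  have hf : ∀ (l : List (Cell V × Cell V)) (m : Reg V × List (Cell V) × List (Cell V)),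
      l.foldl (fun m p => (matchStep src m.1 p, p.1 :: m.2.1, p.2 :: m.2.2)) m =
        (l.foldl (matchStep src) m.1, (l.map Prod.fst).reverse ++ m.2.1,
          (l.map Prod.snd).reverse ++ m.2.2) := by
    intro l
    induction l with
    | nil => simp
    | cons c l ih => intro m; simp [ih]
  rw [hf] at h
  simp only [List.head?_nil, List.tail_nil, List.map_nil, Option.map_none, List.nil_append] at h
  refine (Prog.RunsIn.seq (.of_act ?_ ?_) h).mono (by omega)
  · simp
  · simp

/-- Compare the word on `A` with the first word on `T`, which is moved to `U`, and record a
success. -/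
noncomputable def lookOnce (src : V → Src V) : Pr V :=
  .seq (setReg matchInit) (.seq (lockstep src) (.seq restore
    (.act (.peek .T (fun v o => { v with cur₂ := o, found := v.found || v.res }) done))))

/-- The registers after one comparison. -/
noncomputable def lookReg (src : V → Src V) (L : List Event) (z : V → ℕ) (r : Reg V)
    (u : V → ℕ) : Reg V :=
  let r' := ((word z 0 L).zip (word u 0 L)).foldl (matchStep src) (matchInit r)
  { r' with cur := none, found := r'.found || r'.res }

theorem runs_lookOnce (src : V → Src V) (L : List Event) (z u : V → ℕ) (G : List (V → ℕ))
    (r : Reg V) (s) :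
    (lookOnce src).RunsIn r (mem [] [] (word z 0 L) [] (table (u :: G) L) s [] [])
      { lookReg src L z r u with cur₂ := (table G L).head? }
      (mem [] [] (word z 0 L) [] (table G L) ((word u 0 L).reverse ++ s) [] [])
      (4 * wordLength L + 6) := by
  have hl : (word z 0 L).length = (word u 0 L).length := by rw [length_word, length_word]
  have h := runs_lockstep src ((word z 0 L).zip (word u 0 L)) (matchInit r) [] [] [] (table G L) s
    [] []
  rw [List.map_fst_zip hl.le, List.map_snd_zip hl.ge, List.append_nil] at h
  refine (Prog.RunsIn.seq (runs_setReg matchInit r _) (h.seq ((runs_restore _ _ _ _ _ _ _ _ _).seq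
    (.of_act ?_ ?_)))).mono ?_
  · simp [lookReg]
  · simp
  · simp only [List.length_zip, length_word, List.length_reverse, min_self]
    omega

/-- The test whether the table contains an assignment that is determined by the current one as
described by `src`. -/
noncomputable def lookP (src : V → Src V) : Pr V :=
  .seq (.act (.peek .T (fun v o => { v with cur₂ := o, found := false }) done))
    (.seq (.loop (fun v => v.cur₂.isSome) (lookOnce src))
      (.seq restoreTable (setReg fun v => { v with res := v.found })))

/-- The verdicts on the table entries are collected by disjunction in `found`. The entries pass to
`U` in reverse and are moved back at the end, so a letter of the table costs about four steps for
its comparison and two for its return. -/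
theorem computes_lookP (src : V → Src V) :
    Computes (lookP src) fun L z G => ∃ u ∈ G, Fits src z u L.length := by
  refine ⟨6 + 13, fun L z G _ hG r => ?_⟩
  have hhead : ∀ (u : V → ℕ) (G : List (V → ℕ)), (table (u :: G) L).head?.isSome = true := by
    intro u G; cases L <;> simp [table, word]
  have h := Prog.RunsIn.loopList (Γ := Alph V) (σ := Reg V) (b := fun v => v.cur₂.isSome)
    (p := lookOnce src)
    (fun (m : Reg V × List (Cell V)) (u : V → ℕ) =>
      (lookReg src L z m.1 u, (word u 0 L).reverse ++ m.2))
    (fun m G => { m.1 with cur₂ := (table G L).head? })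
    (fun m G => mem [] [] (word z 0 L) [] (table G L) m.2 [] []) (4 * wordLength L + 6)
    (fun m u G => hhead u G) (by simp [table])
    (fun m u G => by
      have := runs_lookOnce src L z u G { m.1 with cur₂ := (table (u :: G) L).head? } m.2
      -- The words are nonempty, so their first letters overwrite `cur₂` and the peeked letter has
      -- no influence.
      have e : lookReg src L z { m.1 with cur₂ := (table (u :: G) L).head? } u =
          lookReg src L z m.1 u := by
        cases L <;> simp [lookReg, matchInit, word, matchStep]
      rw [e] at this
      exact this)
    ({ r with found := false }, []) G
  have hf : ∀ (G : List (V → ℕ)) (m : Reg V × List (Cell V)), (∀ u ∈ G, ∀ v, u v ≤ L.length) →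
      (G.foldl (fun (m : Reg V × List (Cell V)) (u : V → ℕ) =>
        (lookReg src L z m.1 u, (word u 0 L).reverse ++ m.2)) m).2 =
        (table G L).reverse ++ m.2 ∧
      (G.foldl (fun (m : Reg V × List (Cell V)) (u : V → ℕ) =>
        (lookReg src L z m.1 u, (word u 0 L).reverse ++ m.2)) m).1.acc = m.1.acc ∧
      ((G.foldl (fun (m : Reg V × List (Cell V)) (u : V → ℕ) =>
        (lookReg src L z m.1 u, (word u 0 L).reverse ++ m.2)) m).1.found = true ↔
        m.1.found = true ∨ ∃ u ∈ G, Fits src z u L.length) := by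
    intro G
    induction G with
    | nil => intro m _; simp [table]
    | cons u G ih =>
      intro m hG
      rw [List.foldl_cons]
      obtain ⟨h₁, h₂, h₃⟩ := ih (lookReg src L z m.1 u, (word u 0 L).reverse ++ m.2)
        fun u hu => hG u (by simp [hu])
      refine ⟨?_, ?_, ?_⟩
      · rw [h₁]; simp [table]
      · rw [h₂]
        exact (foldl_matchStep_acc src _ _).1
      · rw [h₃]
        have h₄ := matchStep_word_iff src z u L m.1 (hG u (by simp))
        have h₅ := (foldl_matchStep_acc src ((word z 0 L).zip (word u 0 L)) (matchInit m.1)).2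
        simp only [lookReg, Bool.or_eq_true, h₅, h₄, List.exists_mem_cons_iff]
        simp only [matchInit, or_assoc]
  obtain ⟨h₁, h₂, h₃⟩ := hf G ({ r with found := false }, []) hG
  set m := G.foldl (fun (m : Reg V × List (Cell V)) (u : V → ℕ) =>
        (lookReg src L z m.1 u, (word u 0 L).reverse ++ m.2)) ({ r with found := false }, [])
  rw [List.append_nil] at h₁
  rw [h₁] at h
  have h' := runs_restoreTable { m.1 with cur₂ := (table (V := V) [] L).head? } [] []
    (word z 0 L) [] (table [] L) (table G L).reverse [] []
  rw [List.reverse_reverse, show table (V := V) [] L = [] from rfl, List.append_nil] at h'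
  refine ⟨_, ?_, ?_, (Prog.RunsIn.seq (.of_act ?_ ?_) (h.seq (h'.seq
    (runs_setReg _ _ _)))).mono ?_⟩
  · exact h₂
  · simpa using h₃
  · simp [store]
  · simp [store]
  · rw [List.length_reverse, length_table]
    nlinarith [Nat.zero_le (wordLength L * G.length), Nat.zero_le (wordLength L),
      Nat.zero_le (G.length)]

end Tests

section Tests

variable {V : Type}

/-! ### Comparing positions -/

/-- The test whether the value of `x` is at most the value of `y`. -/
def leP (x y : V) : Pr V :=
  sweep (fun r => { r with res := false, fst := true })
    (fun r => { r with
      res := if r.cell.2 x then r.fst else r.res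
      fst := r.fst && !r.cell.2 y })
    (fun _ => false) (fun _ => false)

/-- Here `fst` records that the mark of `y` has not been passed. Its value on meeting the mark of
`x` is the answer; it is read before being updated, so equal positions count as `≤`. -/
theorem computes_leP (x y : V) : Computes (leP x y) fun _ z _ => z x ≤ z y := by
  refine ⟨4 + 5, fun L z G hz _ r => ?_⟩
  have h := runs_sweep_pure (fun r => { r with res := false, fst := true })
    (fun r => { r with
      res := if r.cell.2 x then r.fst else r.res
      fst := r.fst && !r.cell.2 y }) (fun _ => rfl) r
    [] [] (word z 0 L) (table G L) [] [] []
  rw [length_word] at h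
  refine ⟨_, ?_, ?_, h.mono le_linear⟩
  · have : ∀ (l : List (Cell V)) (r : Reg V), (l.foldl (fun r c =>
        (fun r : Reg V => { r with
          res := if r.cell.2 x then r.fst else r.res
          fst := r.fst && !r.cell.2 y }) { r with cur := some c }) r).acc = r.acc := by
      intro l
      induction l with
      | nil => intro r; rfl
      | cons c l ih => intro r; rw [List.foldl_cons, ih]
    exact this _ _
  · have ht : ∀ (l : List Γ') (r : Reg V),
        let r' := (l.map plain).foldl (fun r c =>
          (fun r : Reg V => { r with
            res := if r.cell.2 x then r.fst else r.res
            fst := r.fst && !r.cell.2 y }) { r with cur := some c }) r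
        r'.res = r.res ∧ r'.fst = r.fst := by
      intro l
      induction l with
      | nil => intro r; exact ⟨rfl, rfl⟩
      | cons c l ih =>
        intro r
        rw [List.map_cons, List.foldl_cons]
        refine ⟨(ih _).1.trans ?_, (ih _).2.trans ?_⟩ <;> simp [Reg.cell, plain]
    -- On the suffix from `d`, the answer is still open if `d ≤ z x` and is already stored in `res`
    -- otherwise.
    have hw : ∀ (L : List Event) (d : ℕ) (r : Reg V), r.fst = decide (d ≤ z y) →
        z x ≤ d + L.length →
        (((word z d L).foldl (fun r c =>
          (fun r : Reg V => { r with
            res := if r.cell.2 x then r.fst else r.res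
            fst := r.fst && !r.cell.2 y }) { r with cur := some c }) r).res = true ↔
          if d ≤ z x then z x ≤ z y else r.res = true) := by
      intro L
      induction L with
      | nil =>
        intro d r hr hx
        simp only [word, List.foldl_cons, List.foldl_nil, Reg.cell, Option.getD_some, marks, hr]
        simp only [List.length_nil, add_zero] at hx
        by_cases h : z x = d
        · simp [h]
        · have : ¬ d ≤ z x := by omega
          simp [h, this]
      | cons e L ih =>
        intro d r hr hx
        simp only [List.length_cons] at hx
        rw [word, List.foldl_cons, List.foldl_append, ih (d + 1) _ _ (by omega)]
        · rw [(ht _ _).1]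
          simp only [Reg.cell, Option.getD_some, marks, hr]
          by_cases h : z x = d
          · simp [h]
          · by_cases h' : d ≤ z x
            · have h'' : d + 1 ≤ z x := by omega
              simp [h', h'']
            · have h'' : ¬ d + 1 ≤ z x := by omega
              simp [h, h', h'']
        · rw [(ht _ _).2]
          simp only [Reg.cell, Option.getD_some, marks, hr]
          rw [Bool.eq_iff_iff]
          simp only [Bool.and_eq_true, decide_eq_true_eq, Bool.not_eq_true', decide_eq_false_iff_not]
          omega
    simpa using hw L 0 { r with res := false, fst := true } (by simp) (by simpa using hz x)

/-! ### Fields of events -/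

/-- The fields of an event that are examined. -/
inductive Fld where
  | tid | op | loc | val

/-- The number of the field in the string, counted from 1. -/
def Fld.pos : Fld → Fin 8
  | tid => 2
  | op => 3
  | loc => 4
  | val => 5

/-- The string of a field. -/
def Fld.bits : Fld → Event → List Γ'
  | tid, e => encodeNum e.tid
  | op, e => [Γ'.bit (decide (e.op = Op.write))]
  | loc, e => encodeNum e.loc
  | val, e => encodeNum e.val

/-- The number of the field that the letter `c` belongs to, if `n` is that of the letter before
it; fields are counted in events that start with a mark. -/
def fieldStep (m : Bool) (c : Γ') (n : Fin 8) : Fin 8 :=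
  match c with
  | .bra => if m then 1 else 0
  | .blank => if m then 1 else 0
  | .comma => if n = 0 then 0 else n + 1
  | _ => n

/-- Is the letter a bit? -/
def isBit : Γ' → Bool
  | .bit _ => true
  | _ => false

/-- Collect the letters of the field `p` of the events marked by `x`. -/
def extract (x : V) (p : Fin 8) (s : Fin 8 × List (Cell V)) (c : Cell V) :
    Fin 8 × List (Cell V) :=
  let n := fieldStep (c.2 x) c.1 s.1
  (n, if decide (n = p) && isBit c.1 then c :: s.2 else s.2)

theorem foldl_extract_num (x : V) (p n : Fin 8) (l : List (Cell V)) (j : ℕ) :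
    ((encodeNum j).map plain).foldl (extract x p) (n, l) =
      (n, if n = p then ((encodeNum j).map plain).reverse ++ l else l) := by
  unfold encodeNum
  induction encodeNat j generalizing l with
  | nil => simp
  | cons b bs ih =>
    simp only [List.map_cons, List.foldl_cons]
    have : extract x p (n, l) (plain (Γ'.bit b)) =
        (n, if n = p then plain (Γ'.bit b) :: l else l) := by
      by_cases h : n = p <;> simp [extract, fieldStep, plain, isBit, h]
    rw [this, ih]
    split <;> simp

/-- The opening bracket resets the counter, to 1 in a marked event and to 0 otherwise. Commas do not
change 0, and no examined field has number 0, so unmarked events contribute nothing. -/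
theorem foldl_extract_event (x : V) (f : Fld) (e : Event) (n : Fin 8) (l : List (Cell V))
    (m : V → Bool) :
    (((Γ'.bra, m) :: (eventTail e).map plain).foldl (extract x f.pos) (n, l)).2 =
      if m x then ((f.bits e).map plain).reverse ++ l else l := by
  have hc : ∀ (n : Fin 8) (l : List (Cell V)), extract x f.pos (n, l) (plain Γ'.comma) =
      (if n = 0 then 0 else n + 1, l) := by
    intro n l; simp [extract, fieldStep, plain, isBit]
  have hk : ∀ (n : Fin 8) (l : List (Cell V)), extract x f.pos (n, l) (plain Γ'.ket) =
      (n, l) := by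
    intro n l; simp [extract, fieldStep, plain, isBit]
  have hb : ∀ (n : Fin 8) (l : List (Cell V)) (b : Bool),
      extract x f.pos (n, l) (plain (Γ'.bit b)) =
        (n, if n = f.pos then plain (Γ'.bit b) :: l else l) := by
    intro n l b; by_cases h : n = f.pos <;> simp [extract, fieldStep, plain, isBit, h]
  have h0 : extract x f.pos (n, l) (Γ'.bra, m) = (if m x then 1 else 0, l) := by
    simp [extract, fieldStep, isBit]
  simp only [eventTail, List.foldl_cons, h0, List.map_append, List.map_cons, List.foldl_append,
    foldl_extract_num, hc, hk, hb, List.map_nil, List.foldl_nil]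
  cases m x <;> cases f <;> simp [Fld.pos, Fld.bits]

/-- The default `[]` covers the position of the final blank, which has no fields. -/
theorem foldl_extract_word (x : V) (f : Fld) (z : V → ℕ) (L : List Event) (d : ℕ) (n : Fin 8)
    (l : List (Cell V)) :
    ((word z d L).foldl (extract x f.pos) (n, l)).2 =
      if d ≤ z x then
        (L[z x - d]?.elim [] fun e => ((f.bits e).map plain).reverse) ++ l
      else l := by
  induction L generalizing d n l with
  | nil => simp [word, extract, isBit]
  | cons e L ih =>
    rw [word, ← List.cons_append, List.foldl_append, ih, foldl_extract_event]
    simp only [marks, decide_eq_true_eq]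
    by_cases h : z x = d
    · have : ¬ d + 1 ≤ z x := by omega
      simp [h]
    · by_cases h' : d ≤ z x
      · have h'' : d + 1 ≤ z x := by omega
        obtain ⟨j, hj⟩ : ∃ j, z x = d + 1 + j := ⟨z x - (d + 1), by omega⟩
        have h₁ : d + 1 + j - d = j + 1 := by omega
        have h₂ : d + 1 + j ≠ d := by omega
        have h₃ : d ≤ d + 1 + j := by omega
        simp [hj, h₁, h₂, h₃]
      · have h'' : ¬ d + 1 ≤ z x := by omega
        simp [h, h', h'']

/-- The registers during the extraction of a field. -/
def extractReg (x y : V) (r : Reg V) : Reg V :=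
  { r with
    cnt := fieldStep (r.cell.2 x) r.cell.1 r.cnt
    cnt₂ := fieldStep (r.cell.2 y) r.cell.1 r.cnt₂ }

/-- Copy the field `f` of the event at `x` to `X` and that of the event at `y` to `Y`. -/
def extractP (f : Fld) (x y : V) : Pr V :=
  sweep (fun r => { r with cnt := 0, cnt₂ := 0 }) (extractReg x y)
    (fun r => decide (r.cnt = f.pos) && isBit r.cell.1)
    (fun r => decide (r.cnt₂ = f.pos) && isBit r.cell.1)

/-- The field of the `i`-th event as it is stored on a stack. -/
def fieldCells (L : List Event) (f : Fld) (i : ℕ) : List (Cell V) :=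
  L[i]?.elim [] fun e => ((f.bits e).map plain).reverse

theorem runs_extractP (f : Fld) (x y : V) (L : List Event) (z : V → ℕ) (G : List (V → ℕ))
    (r : Reg V) :
    ∃ r' : Reg V, r'.acc = r.acc ∧ (extractP f x y).RunsIn r (store L z G) r'
      (mem [] [] (word z 0 L) [] (table G L) [] (fieldCells L f (z x)) (fieldCells L f (z y)))
      (4 * wordLength L + 5) := by
  have h := runs_sweep (fun r => { r with cnt := 0, cnt₂ := 0 }) (extractReg x y)
    (fun r => decide (r.cnt = f.pos) && isBit r.cell.1)
    (fun r => decide (r.cnt₂ = f.pos) && isBit r.cell.1) r [] [] (word z 0 L) (table G L) [] [] []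
  have hf : ∀ (l : List (Cell V)) (r : Reg V) (b u v : List (Cell V)),
      let m := l.foldl (sweepStep (extractReg x y)
        (fun r => decide (r.cnt = f.pos) && isBit r.cell.1)
        (fun r => decide (r.cnt₂ = f.pos) && isBit r.cell.1)) (r, b, u, v)
      m.1.acc = r.acc ∧ m.2.1 = l.reverse ++ b ∧
      m.2.2.1 = (l.foldl (extract x f.pos) (r.cnt, u)).2 ∧
      m.2.2.2 = (l.foldl (extract y f.pos) (r.cnt₂, v)).2 := by
    intro l
    induction l with
    | nil => intro r b u v; simp
    | cons c l ih =>
      intro r b u v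
      simp only [List.foldl_cons]
      obtain ⟨h₁, h₂, h₃, h₄⟩ := ih (extractReg x y { r with cur := some c }) (c :: b)
        (extract x f.pos (r.cnt, u) c).2 (extract y f.pos (r.cnt₂, v) c).2
      refine ⟨?_, ?_, ?_, ?_⟩
      · exact h₁
      · rw [List.reverse_cons, List.append_assoc]; exact h₂
      · exact h₃
      · exact h₄
  obtain ⟨h₁, h₂, h₃, h₄⟩ := hf (word z 0 L) { r with cnt := 0, cnt₂ := 0 } [] [] []
  rw [length_word] at h
  simp only [h₂, h₃, h₄, foldl_extract_word] at h
  simp only [zero_le, if_true, Nat.sub_zero, List.append_nil, List.reverse_reverse] at h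
  exact ⟨_, by exact h₁, h⟩

/-- Compare and clear the stacks `X` and `Y`. -/
noncomputable def equalP : Pr V :=
  open Classical in
  .seq (.act (.pop .X (fun v o => { v with cur := o, res := true })
      (.pop .Y (fun v o => { v with cur₂ := o }) done)))
    (.loop (fun v => v.cur.isSome || v.cur₂.isSome)
      (.act (.load (fun v => { v with res := v.res && decide (v.cur = v.cur₂) })
        (.pop .X (fun v o => { v with cur := o })
          (.pop .Y (fun v o => { v with cur₂ := o }) done)))))

/-- The loop continues until both stacks are exhausted, comparing the rest of the longer one with
`none`. Hence different lengths are detected and both stacks end up empty. -/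
theorem runs_equalP (r : Reg V) (i o a b t u x y) :
    ∃ r' : Reg V, r'.acc = r.acc ∧ (r'.res = true ↔ x = y) ∧
      equalP.RunsIn r (mem i o a b t u x y) r' (mem i o a b t u [] [])
        (2 * (x.length + y.length) + 2) := by
  classical
  have h : ∀ (x y : List (Cell V)) (r : Reg V), r.cur = x.head? → r.cur₂ = y.head? →
      ∃ r' : Reg V, r'.acc = r.acc ∧ (r'.res = true ↔ r.res = true ∧ x = y) ∧
      (Prog.loop (fun v => v.cur.isSome || v.cur₂.isSome)
      (.act (.load (fun v => { v with res := v.res && decide (v.cur = v.cur₂) })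
        (.pop .X (fun v o => { v with cur := o })
          (.pop .Y (fun v o => { v with cur₂ := o }) done))))).RunsIn r
          (mem i o a b t u x.tail y.tail) r' (mem i o a b t u [] [])
        (2 * (x.length + y.length) + 1) := by
    have hact : ∀ (x y : List (Cell V)) (r : Reg V),
        Prog.RunsIn (.act (.load (fun v => { v with res := v.res && decide (v.cur = v.cur₂) })
        (.pop .X (fun v o => { v with cur := o })
          (.pop .Y (fun v o => { v with cur₂ := o }) done)))) r (mem i o a b t u x y)
          { r with cur := x.head?, cur₂ := y.head?, res := r.res && decide (r.cur = r.cur₂) }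
          (mem i o a b t u x.tail y.tail) 1 := by
      intro x y r
      exact .of_act (by simp) (by simp)
    intro x
    induction x with
    | nil =>
      intro y
      induction y with
      | nil =>
        intro r h₁ h₂
        exact ⟨r, rfl, by simp, (Prog.RunsIn.loopFalse (by simp [h₁, h₂])).mono (by simp)⟩
      | cons d y ih =>
        intro r h₁ h₂
        obtain ⟨r', ha, hr, hR⟩ := ih { r with cur := none, cur₂ := y.head?, res := r.res && decide (r.cur = r.cur₂) } rfl rfl
        refine ⟨r', ha, ?_, (Prog.RunsIn.loopTrue (by simp [h₂]) (hact _ _ _) hR).mono ?_⟩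
        · rw [hr]; simp [h₁, h₂]
        · simp; omega
    | cons c x ih =>
      intro y r h₁ h₂
      obtain ⟨r', ha, hr, hR⟩ := ih y.tail
        { r with cur := x.head?, cur₂ := y.tail.head?, res := r.res && decide (r.cur = r.cur₂) } rfl rfl
      refine ⟨r', ha, ?_, (Prog.RunsIn.loopTrue (by simp [h₁]) (hact _ _ _) hR).mono ?_⟩
      · rw [hr]
        cases y with
        | nil => simp [h₁, h₂]
        | cons d y => simp [h₁, h₂, and_assoc]
      · simp; omega
  obtain ⟨r', ha, hr, hR⟩ := h x y { r with cur := x.head?, cur₂ := y.head?, res := true } rfl rfl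
  refine ⟨r', ha, by simpa using hr, (Prog.RunsIn.seq (.of_act ?_ ?_) hR).mono (by omega)⟩
  · simp
  · simp

theorem length_fieldCells (L : List Event) (f : Fld) (i : ℕ) :
    (fieldCells (V := V) L f i).length ≤ wordLength L := by
  unfold fieldCells
  cases h : L[i]? with
  | none => simp
  | some e =>
    have hm : e ∈ L := List.mem_of_getElem? h
    have h₁ : (f.bits e).length ≤ (encodeEvent e).length := by
      cases f <;> simp [Fld.bits, encodeEvent] <;> omega
    have h₂ : (encodeEvent e).length ≤ (encodeList L).length := by
      unfold encodeList
      rw [List.length_flatMap]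
      exact List.single_le_sum (by simp) _ (List.mem_map_of_mem hm)
    simp only [Option.elim_some, List.length_reverse, List.length_map, wordLength]
    omega

/-- The test whether two stored fields are equal. -/
noncomputable def sameRaw (f : Fld) (x y : V) : Pr V := .seq (extractP f x y) equalP

/-- This is not yet equality of fields of events: the end position yields the empty string, which is
also the code of the number 0. -/
theorem computes_sameRaw (f : Fld) (x y : V) : Computes (sameRaw f x y) fun L z _ =>
    fieldCells (V := V) L f (z x) = fieldCells L f (z y) := by
  refine ⟨8 + 7, fun L z G _ _ r => ?_⟩
  obtain ⟨r₁, ha₁, h₁⟩ := runs_extractP f x y L z G r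
  obtain ⟨r₂, ha₂, hr, h₂⟩ := runs_equalP r₁ [] [] (word z 0 L) [] (table G L) []
    (fieldCells L f (z x)) (fieldCells L f (z y))
  refine ⟨r₂, ha₂.trans ha₁, hr, (h₁.seq h₂).mono (le_trans ?_ le_linear)⟩
  have := length_fieldCells (V := V) L f (z x)
  have := length_fieldCells (V := V) L f (z y)
  omega

/-- The test whether the event at `x` is a write. -/
noncomputable def wrP (x : V) : Pr V :=
  open Classical in
  .seq (extractP .op x x) (.act (.pop .X (fun v o => { v with
    res := decide (∃ c ∈ o, c.1 = Γ'.bit true) }) (.pop .Y (fun v _ => v) done)))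

theorem computes_wrP (x : V) : Computes (wrP x) fun L z _ =>
    ∃ e, L[z x]? = some e ∧ e.op = Op.write := by
  classical
  refine ⟨4 + 6, fun L z G _ _ r => ?_⟩
  obtain ⟨r₁, ha₁, h₁⟩ := runs_extractP .op x x L z G r
  refine ⟨_, ?_, ?_, (h₁.seq (.of_act rfl ?_)).mono (le_trans ?_ le_linear)⟩
  · simpa using ha₁
  · cases h : L[z x]? with
    | none => simp [fieldCells, h]
    | some e => simp [fieldCells, h, Fld.bits, plain]
  · cases h : L[z x]? with
    | none => simp [fieldCells, h, store]
    | some e => simp [fieldCells, h, Fld.bits, store]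
  · omega

/-! ### Boolean combinations -/

/-- Negation. -/
def notP (p : Pr V) : Pr V := .seq p (setReg fun r => { r with res := !r.res })

/-- Conjunction. -/
def andP (p q : Pr V) : Pr V := .seq p (.ite Reg.res q (setReg id))

/-- Disjunction. -/
def orP (p q : Pr V) : Pr V := .seq p (.ite Reg.res (setReg id) q)

theorem computes_notP {p : Pr V} {φ} (hp : Computes p φ) :
    Computes (notP p) fun L z G => ¬ φ L z G := by
  obtain ⟨C, hC⟩ := hp
  refine ⟨C + 1, fun L z G hz hG r => ?_⟩
  obtain ⟨r₁, ha, hr, h⟩ := hC L z G hz hG r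
  refine ⟨_, ?_, ?_, (h.seq (runs_setReg _ _ _)).mono ?_⟩
  · exact ha
  · simp [← hr]
  · nlinarith [Nat.zero_le (wordLength L * G.length), Nat.zero_le (wordLength L)]

theorem computes_andP {p q : Pr V} {φ ψ} (hp : Computes p φ) (hq : Computes q ψ) :
    Computes (andP p q) fun L z G => φ L z G ∧ ψ L z G := by
  obtain ⟨C, hC⟩ := hp
  obtain ⟨D, hD⟩ := hq
  refine ⟨C + D + 2, fun L z G hz hG r => ?_⟩
  obtain ⟨r₁, ha, hr, h⟩ := hC L z G hz hG r
  obtain ⟨r₂, ha₂, hr₂, h₂⟩ := hD L z G hz hG r₁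
  have hle : 1 ≤ (wordLength L + 1) * (G.length + 1) := Nat.mul_pos (by omega) (by omega)
  cases hb : r₁.res
  · refine ⟨r₁, ha, ?_, (h.seq (.iteFalse hb (runs_setReg id _ _))).mono ?_⟩
    · simp [← hr, hb]
    · nlinarith [Nat.zero_le (D * (wordLength L + 1) * (G.length + 1))]
  · refine ⟨r₂, ha₂.trans ha, ?_, (h.seq (.iteTrue hb h₂)).mono ?_⟩
    · simp [← hr, ← hr₂, hb]
    · nlinarith

theorem computes_orP {p q : Pr V} {φ ψ} (hp : Computes p φ) (hq : Computes q ψ) :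
    Computes (orP p q) fun L z G => φ L z G ∨ ψ L z G := by
  obtain ⟨C, hC⟩ := hp
  obtain ⟨D, hD⟩ := hq
  refine ⟨C + D + 2, fun L z G hz hG r => ?_⟩
  obtain ⟨r₁, ha, hr, h⟩ := hC L z G hz hG r
  obtain ⟨r₂, ha₂, hr₂, h₂⟩ := hD L z G hz hG r₁
  have hle : 1 ≤ (wordLength L + 1) * (G.length + 1) := Nat.mul_pos (by omega) (by omega)
  cases hb : r₁.res
  · refine ⟨r₂, ha₂.trans ha, ?_, (h.seq (.iteFalse hb h₂)).mono ?_⟩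
    · simp [← hr, ← hr₂, hb]
    · nlinarith
  · refine ⟨r₁, ha, ?_, (h.seq (.iteTrue hb (runs_setReg id _ _))).mono ?_⟩
    · simp [← hr, hb]
    · nlinarith [Nat.zero_le (D * (wordLength L + 1) * (G.length + 1))]

theorem Computes.congr {p : Pr V} {φ ψ} (hp : Computes p φ)
    (h : ∀ L z G, (∀ v, z v ≤ L.length) → (φ L z G ↔ ψ L z G)) : Computes p ψ := by
  obtain ⟨C, hC⟩ := hp
  refine ⟨C, fun L z G hz hG r => ?_⟩
  obtain ⟨r₁, ha, hr, hR⟩ := hC L z G hz hG r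
  exact ⟨r₁, ha, hr.trans (h L z G hz), hR⟩

end Tests

/-! ### Quantifier-free formulas about an assignment and a table of assignments -/

/-- Formulas that are decided by sweeps. -/
inductive Fml (V : Type) where
  | chk (src : V → Src V)
  | look (src : V → Src V)
  | wr (x : V)
  | le (x y : V)
  | same (f : Fld) (x y : V)
  | not (a : Fml V)
  | and (a b : Fml V)
  | or (a b : Fml V)

section Formulas

variable {V : Type}

/-- The meaning of a formula for a sequence of events, an assignment of positions in it and a
table. -/
def Fml.Holds (L : List Event) (z : V → ℕ) (G : List (V → ℕ)) : Fml V → Prop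
  | chk src => Fits src z z L.length
  | look src => ∃ u ∈ G, Fits src z u L.length
  | wr x => ∃ e, L[z x]? = some e ∧ e.op = Op.write
  | le x y => z x ≤ z y
  | same f x y => ∃ a b, L[z x]? = some a ∧ L[z y]? = some b ∧ f.bits a = f.bits b
  | not a => ¬ a.Holds L z G
  | and a b => a.Holds L z G ∧ b.Holds L z G
  | or a b => a.Holds L z G ∨ b.Holds L z G

variable [DecidableEq V]

/-- The variable `x` is described by `s`, all others are arbitrary. -/
def only (x : V) (s : Src V) (v : V) : Src V := if v = x then s else .any

theorem fits_only {x : V} {s : Src V} (hs : s ≠ .any) {z u : V → ℕ} {n : ℕ} :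
    Fits (only x s) z u n ↔ u x = s.val z n x := by
  constructor
  · intro h
    simpa [only] using h x (by simpa [only] using hs)
  · intro h v hv
    by_cases hx : v = x
    · subst hx; simpa [only] using h
    · simp [only, hx] at hv

/-- The program that decides a formula. -/
noncomputable def Fml.prog : Fml V → Pr V
  | chk src => chkP src
  | look src => lookP src
  | wr x => wrP x
  | le x y => leP x y
  | same f x y => andP (notP (chkP (only x .top)))
      (andP (notP (chkP (only y .top))) (sameRaw f x y))
  | not a => notP a.prog
  | and a b => andP a.prog b.prog
  | or a b => orP a.prog b.prog

theorem Fml.computes (a : Fml V) : Computes a.prog fun L z G => a.Holds L z G := by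
  induction a with
  | chk src => exact computes_chkP src
  | look src => exact computes_lookP src
  | wr x => exact computes_wrP x
  | le x y => exact computes_leP x y
  | same f x y =>
    -- Once the end position is excluded for both variables, the extracted strings are fields of
    -- actual events.
    refine (computes_andP (computes_notP (computes_chkP (only x .top)))
      (computes_andP (computes_notP (computes_chkP (only y .top)))
        (computes_sameRaw f x y))).congr fun L z G hz => ?_
    rw [fits_only (by simp), fits_only (by simp)]
    simp only [Src.val, Holds]
    constructor
    · rintro ⟨hx, hy, h⟩
      have hx' : z x < L.length := lt_of_le_of_ne (hz x) hx
      have hy' : z y < L.length := lt_of_le_of_ne (hz y) hy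
      refine ⟨L[z x], L[z y], by simp, by simp, ?_⟩
      have hp : Function.Injective (plain : Γ' → Cell V) := fun a b h => congrArg Prod.fst h
      simpa [fieldCells, hx', hy', (List.map_injective_iff.2 hp).eq_iff] using h
    · rintro ⟨a, b, ha, hb, h⟩
      obtain ⟨hx, -⟩ := List.getElem?_eq_some_iff.1 ha
      obtain ⟨hy, -⟩ := List.getElem?_eq_some_iff.1 hb
      exact ⟨hx.ne, hy.ne, by simp [fieldCells, ha, hb, h]⟩
  | not a ih => exact computes_notP ih
  | and a b iha ihb => exact computes_andP iha ihb
  | or a b iha ihb => exact computes_orP iha ihb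

/-! ### Loops over positions -/

/-- Move the mark of `x` to the next position; with `c`, a missing mark is set at the first
position. -/
def advanceP (x : V) (c : Bool) : Pr V :=
  sweep (fun r => { r with prev := fun _ => c })
    (fun r => if isAnchor r.cell.1 then { r with
      cur := some (r.cell.1, Function.update r.cell.2 x (r.prev x))
      prev := r.cell.2 } else r)
    (fun _ => false) (fun _ => false)

/-- The new value `y` is given by conditions that fit three situations: a missing mark enters at 0,
a mark moves one position on, and a mark at the blank drops off. After the sweep `prev` holds the
old marks at the blank, which tells the loop in `forP` that the mark has dropped off. -/
theorem runs_advanceP (x : V) (c : Bool) (L : List Event) (z : V → ℕ) (G : List (V → ℕ)) (y : ℕ)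
    (hc : c = true ↔ y = 0) (hy : ∀ i < L.length, y = i + 1 ↔ z x = i) (r : Reg V) :
    ∃ r' : Reg V, r'.acc = r.acc ∧ r'.prev x = decide (z x = L.length) ∧
      (advanceP x c).RunsIn r (store L z G) r' (store L (Function.update z x y) G)
        (4 * wordLength L + 5) := by
  set step : Reg V → Reg V := fun r => if isAnchor r.cell.1 then { r with
      cur := some (r.cell.1, Function.update r.cell.2 x (r.prev x))
      prev := r.cell.2 } else r with hstep
  have h := runs_sweep (fun r => { r with prev := fun _ => c }) step
    (fun _ => false) (fun _ => false) r [] [] (word z 0 L) (table G L) [] [] []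
  have ht : ∀ (l : List Γ') (r : Reg V) (b : List (Cell V)), (∀ c ∈ l, isAnchor c = false) →
      let m := (l.map plain).foldl (sweepStep step (fun _ => false) (fun _ => false))
        (r, b, [], [])
      m.1.acc = r.acc ∧ m.1.prev = r.prev ∧ m.2.1 = (l.map plain).reverse ++ b ∧
        m.2.2 = ([], []) := by
    intro l
    induction l with
    | nil => intro r b _; simp
    | cons c l ih =>
      intro r b hl
      have hc : isAnchor c = false := hl c (by simp)
      obtain ⟨h₁, h₂, h₃, h₄⟩ := ih { r with cur := some (plain c) } (plain c :: b)
        fun c' h' => hl c' (by simp [h'])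
      have e : sweepStep step (fun _ => false) (fun _ => false) (r, b, [], []) (plain c) =
          ({ r with cur := some (plain c) }, plain c :: b, [], []) := by
        have : isAnchor (plain (V := V) c).1 = false := hc
        simp [sweepStep, hstep, Reg.cell, this]
      rw [List.map_cons, List.foldl_cons, e]
      exact ⟨h₁, h₂, by rw [h₃]; simp, h₄⟩
  -- Each anchor takes over the mark of `x` that the preceding anchor carried.
  have hanchor : ∀ (c : Γ') (d : ℕ) (r : Reg V) (b : List (Cell V)), isAnchor c = true →
      r.prev x = decide (y = d) →
      let m := sweepStep step (fun _ => false) (fun _ => false) (r, b, [], []) (c, marks z d)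
      m.1.acc = r.acc ∧ m.1.prev = marks z d ∧
        m.2 = ((c, marks (Function.update z x y) d) :: b, [], []) := by
    intro c d r b hc hr
    have e : Function.update (marks z d) x (decide (y = d)) = marks (Function.update z x y) d := by
      funext v
      by_cases hv : v = x
      · subst hv; simp [marks]
      · simp [marks, hv]
    simp [sweepStep, hstep, Reg.cell, hc, hr, e]
  have hw : ∀ (L : List Event) (d : ℕ) (r : Reg V) (b : List (Cell V)),
      r.prev x = decide (y = d) → (∀ i, d ≤ i → i < d + L.length → (y = i + 1 ↔ z x = i)) →
      let m := (word z d L).foldl (sweepStep step (fun _ => false) (fun _ => false))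
        (r, b, [], [])
      m.1.acc = r.acc ∧ m.1.prev x = decide (z x = d + L.length) ∧
        m.2.1 = (word (Function.update z x y) d L).reverse ++ b ∧ m.2.2 = ([], []) := by
    intro L
    induction L with
    | nil =>
      intro d r b hr _
      obtain ⟨h₁, h₂, h₃⟩ := hanchor .blank d r b rfl hr
      simp only [word, List.foldl_cons, List.foldl_nil, h₁, h₂, h₃]
      simp [marks]
    | cons e L ih =>
      intro d r b hr hi
      simp only [word, List.foldl_cons, List.foldl_append]
      obtain ⟨h₁, h₂, h₃⟩ := hanchor .bra d r b rfl hr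
      obtain ⟨r₁, m₁, hm⟩ : ∃ r₁ m₁, sweepStep step (fun _ => false) (fun _ => false)
        (r, b, [], []) (Γ'.bra, marks z d) = (r₁, m₁) := ⟨_, _, rfl⟩
      rw [hm] at h₁ h₂ h₃ ⊢
      simp only at h₁ h₂ h₃
      subst h₃
      obtain ⟨k₁, k₂, k₃, k₄⟩ := ht (eventTail e) r₁
        ((Γ'.bra, marks (Function.update z x y) d) :: b) fun c => isAnchor_of_mem_eventTail
      obtain ⟨r₂, b₂, m₂, hm₂⟩ : ∃ r₂ b₂ m₂, ((eventTail e).map plain).foldl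
        (sweepStep step (fun _ => false) (fun _ => false))
        (r₁, (Γ'.bra, marks (Function.update z x y) d) :: b, [], []) = (r₂, b₂, m₂) :=
        ⟨_, _, _, rfl⟩
      rw [hm₂] at k₁ k₂ k₃ k₄ ⊢
      simp only at k₁ k₂ k₃ k₄
      subst k₄ k₃
      have := ih (d + 1) r₂ (((eventTail e).map plain).reverse ++
        (Γ'.bra, marks (Function.update z x y) d) :: b) (by
          rw [k₂, h₂, marks, decide_eq_decide]
          exact (hi d le_rfl (by simp)).symm)
        (fun i h₁ h₂ => hi i (by omega) (by simp only [List.length_cons]; omega))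
      obtain ⟨l₁, l₂, l₃, l₄⟩ := this
      refine ⟨l₁.trans (k₁.trans h₁), ?_, ?_, l₄⟩
      · rw [l₂, decide_eq_decide, List.length_cons]
        omega
      · rw [l₃]; simp
  obtain ⟨h₁, h₂, h₃, h₄⟩ := hw L 0 { r with prev := fun _ => c } []
    (by rw [Bool.eq_iff_iff, hc]; simp) (fun i _ h => hy i (by simpa using h))
  rw [length_word] at h
  simp only [h₃, h₄, List.append_nil, List.reverse_reverse] at h
  exact ⟨_, by exact h₁, by simpa using h₂, h⟩

/-- Run `p` for all positions of `x`. -/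
def forP (x : V) (p : Pr V) : Pr V :=
  .seq (advanceP x true) (.loop (fun r => !r.prev x) (.seq p (advanceP x false)))

/-- Run `p` for all positions of the given variables. -/
def nestP (p : Pr V) : List V → Pr V
  | [] => p
  | x :: vs => forP x (nestP p vs)

/-- All assignments that differ from `z` on the given variables and are bounded by `n` there. -/
def assignments (n : ℕ) : List V → (V → ℕ) → List (V → ℕ)
  | [], z => [z]
  | x :: vs, z => (List.range (n + 1)).flatMap fun d => assignments n vs (Function.update z x d)

theorem length_assignments (n : ℕ) (vs : List V) (z : V → ℕ) :
    (assignments n vs z).length = (n + 1) ^ vs.length := by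
  induction vs generalizing z with
  | nil => rfl
  | cons x vs ih => simp [assignments, List.length_flatMap, ih, pow_succ, mul_comm]

/-- `p` performs the update `F` of the accumulated answer and the table. -/
def Performs (p : Pr V)
    (F : List Event → Bool × List (V → ℕ) → (V → ℕ) → Bool × List (V → ℕ)) (C : ℕ) : Prop :=
  ∀ (L : List Event) (z : V → ℕ) (G : List (V → ℕ)), (∀ v, z v ≤ L.length) →
    (∀ u ∈ G, ∀ v, u v ≤ L.length) → ∀ r : Reg V, ∃ r' : Reg V,
      r'.acc = (F L (r.acc, G) z).1 ∧
      (F L (r.acc, G) z).2.length ≤ G.length + 1 ∧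
      (∀ u ∈ (F L (r.acc, G) z).2, ∀ v, u v ≤ L.length) ∧
      p.RunsIn r (store L z G) r' (store L z (F L (r.acc, G) z).2)
        (C * (wordLength L + 1) * (G.length + 1))

/-- Each run of the body adds at most one table entry, so `B` bounds the size of the table
throughout and each run costs at most `C * (wordLength L + 1) * (B + 1)`; the 20 per loop variable
pays for moving its mark. On loop variables `z` has the value `L.length + 1`, that is, no mark,
before and after the loops. -/
theorem runs_nestP {p : Pr V} {F} {C : ℕ} (hp : Performs p F C) (L : List Event) (B : ℕ)
    (vs : List V) (hvs : vs.Nodup) (z : V → ℕ) (hz : ∀ v ∈ vs, z v = L.length + 1)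
    (hz' : ∀ v, v ∉ vs → z v ≤ L.length) (G : List (V → ℕ)) (hG : ∀ u ∈ G, ∀ v, u v ≤ L.length)
    (hB : G.length + (L.length + 1) ^ vs.length ≤ B) (r : Reg V) :
    ∃ r' : Reg V,
      r'.acc = ((assignments L.length vs z).foldl (F L) (r.acc, G)).1 ∧
      ((assignments L.length vs z).foldl (F L) (r.acc, G)).2.length ≤
        G.length + (L.length + 1) ^ vs.length ∧
      (∀ u ∈ ((assignments L.length vs z).foldl (F L) (r.acc, G)).2, ∀ v, u v ≤ L.length) ∧
      (nestP p vs).RunsIn r (store L z G) r'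
        (store L z ((assignments L.length vs z).foldl (F L) (r.acc, G)).2)
        ((L.length + 1) ^ vs.length * ((C + 20 * vs.length) * ((wordLength L + 1) * (B + 1)))) := by
  induction vs generalizing z G r with
  | nil =>
    obtain ⟨r', h₁, h₂, h₃, h₄⟩ := hp L z G (fun v => hz' v (by simp)) hG r
    refine ⟨r', h₁, by simpa [assignments] using h₂, h₃, h₄.mono ?_⟩
    simp only [List.length_nil, pow_zero, one_mul, mul_zero, add_zero] at hB ⊢
    rw [mul_assoc]
    gcongr
    omega
  | cons x vs ih =>
    rw [List.nodup_cons] at hvs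
    set n := L.length with hn
    set W := (wordLength L + 1) * (B + 1) with hW
    set N := (n + 1) ^ vs.length with hN
    have hN1 : 1 ≤ N := Nat.one_le_pow _ _ (by omega)
    have hWle : wordLength L + 1 ≤ W := by rw [hW]; nlinarith
    -- The loop with `j + 1` values left, starting at `d`; each of them may still add `N` entries to
    -- the table.
    have hloop : ∀ (j d : ℕ) (G : List (V → ℕ)) (r : Reg V), d + j = n →
        (∀ u ∈ G, ∀ v, u v ≤ n) → G.length + (j + 1) * N ≤ B → r.prev x = false →
        ∃ r' : Reg V, r'.acc = (((List.range' d (j + 1)).flatMap fun d =>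
            assignments n vs (Function.update z x d)).foldl (F L) (r.acc, G)).1 ∧
          (((List.range' d (j + 1)).flatMap fun d =>
            assignments n vs (Function.update z x d)).foldl (F L) (r.acc, G)).2.length ≤
              G.length + (j + 1) * N ∧
          (∀ u ∈ (((List.range' d (j + 1)).flatMap fun d =>
            assignments n vs (Function.update z x d)).foldl (F L) (r.acc, G)).2,
              ∀ v, u v ≤ n) ∧
          (Prog.loop (fun r => !r.prev x) (.seq (nestP p vs) (advanceP x false))).RunsIn r
            (store L (Function.update z x d) G) r'
            (store L z (((List.range' d (j + 1)).flatMap fun d =>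
              assignments n vs (Function.update z x d)).foldl (F L) (r.acc, G)).2)
            ((j + 1) * (N * ((C + 20 * vs.length) * W) + (4 * wordLength L + 6)) + 1) := by
      intro j
      induction j with
      | zero =>
        intro d G r hd hG hB hr
        have hd : d = n := by omega
        obtain ⟨r₁, a₁, b₁, c₁, R₁⟩ := ih hvs.2 (Function.update z x d)
          (fun v hv => by
            rw [Function.update_of_ne (by rintro rfl; exact hvs.1 hv)]
            exact hz v (by simp [hv]))
          (fun v hv => by
            by_cases hx : v = x
            · subst hx; simp; omega
            · rw [Function.update_of_ne hx]; exact hz' v (by simp [hx, hv]))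
          G hG (by omega) r
        obtain ⟨r₂, a₂, b₂, R₂⟩ := runs_advanceP x false L (Function.update z x d)
          ((assignments n vs (Function.update z x d)).foldl (F L) (r.acc, G)).2 (n + 1)
          (by simp) (fun i hi => by simp; omega) r₁
        -- The last move pushes the mark off the word, which restores the value `n + 1` that `z` has
        -- at `x`.
        have e : Function.update (Function.update z x d) x (n + 1) = z := by
          rw [Function.update_idem, Function.update_eq_self_iff, hz x (by simp)]
        rw [e] at R₂
        have e' : ((List.range' d (0 + 1)).flatMap fun d =>
            assignments n vs (Function.update z x d)) =
              assignments n vs (Function.update z x d) := by simp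
        rw [e']
        refine ⟨r₂, a₂.trans a₁, by simpa using b₁, c₁,
          (Prog.RunsIn.loopTrue (by simp [hr]) (R₁.seq R₂) (Prog.RunsIn.loopFalse ?_)).mono ?_⟩
        · simp [b₂, hd, hn]
        · rw [zero_add, one_mul]; omega
      | succ j ihj =>
        intro d G r hd hG hB hr
        have hB' : G.length + ((j + 1) * N + N) ≤ B := by
          calc _ = G.length + (j + 1 + 1) * N := by ring
            _ ≤ B := hB
        obtain ⟨r₁, a₁, b₁, c₁, R₁⟩ := ih hvs.2 (Function.update z x d)
          (fun v hv => by
            rw [Function.update_of_ne (by rintro rfl; exact hvs.1 hv)]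
            exact hz v (by simp [hv]))
          (fun v hv => by
            by_cases hx : v = x
            · subst hx; simp; omega
            · rw [Function.update_of_ne hx]; exact hz' v (by simp [hx, hv]))
          G hG (by omega) r
        obtain ⟨r₂, a₂, b₂, R₂⟩ := runs_advanceP x false L (Function.update z x d)
          ((assignments n vs (Function.update z x d)).foldl (F L) (r.acc, G)).2 (d + 1)
          (by simp) (fun i hi => by simp) r₁
        rw [Function.update_idem] at R₂
        obtain ⟨r₃, a₃, b₃, c₃, R₃⟩ := ihj (d + 1)
          ((assignments n vs (Function.update z x d)).foldl (F L) (r.acc, G)).2 r₂ (by omega)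
          c₁ (by omega) (by rw [b₂]; simp; omega)
        have hacc : (r₂.acc, ((assignments n vs (Function.update z x d)).foldl (F L)
            (r.acc, G)).2) = (assignments n vs (Function.update z x d)).foldl (F L) (r.acc, G) :=
          Prod.ext (a₂.trans a₁) rfl
        rw [hacc] at a₃ b₃ c₃ R₃
        rw [show j + 1 + 1 = (j + 1) + 1 from rfl, List.range'_succ, List.flatMap_cons,
          List.foldl_append]
        refine ⟨r₃, a₃, ?_, c₃, (Prog.RunsIn.loopTrue (by simp [hr]) (R₁.seq R₂) R₃).mono ?_⟩
        · calc _ ≤ _ := b₃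
            _ ≤ G.length + N + (j + 1) * N := by omega
            _ = _ := by ring
        · apply le_of_eq; ring
    obtain ⟨r₁, a₁, b₁, R₁⟩ := runs_advanceP x true L z G 0 (by simp)
      (fun i hi => by rw [hz x (by simp)]; omega) r
    obtain ⟨r₂, a₂, b₂, c₂, R₂⟩ := hloop n 0 G r₁ (by omega) hG
      (by rw [List.length_cons, pow_succ] at hB; rw [mul_comm]; exact hB)
      (by rw [b₁, hz x (by simp)]; simp [hn])
    rw [a₁] at a₂ b₂ c₂ R₂
    have hpow : (n + 1) ^ (x :: vs).length = (n + 1) * N := by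
      rw [List.length_cons, pow_succ, mul_comm]
    rw [assignments, List.range_eq_range', hpow]
    refine ⟨r₂, a₂, b₂, c₂, (R₁.seq R₂).mono ?_⟩
    -- The moves of the mark of `x` inside the loop, charged to the runs of the body. Together with
    -- the initial move they cost at most twice `6 * W` per run, within the allowance of `20 * W`.
    have e₁ : (n + 1) * (4 * wordLength L + 6) ≤ (n + 1) * N * (6 * W) := by
      rw [mul_assoc]
      gcongr
      nlinarith
    have e₂ : 4 * wordLength L + 6 ≤ (n + 1) * N * (6 * W) := by
      refine le_trans ?_ e₁
      nlinarith
    rw [List.length_cons]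
    calc _ = (n + 1) * N * ((C + 20 * vs.length) * W) + (n + 1) * (4 * wordLength L + 6)
          + (4 * wordLength L + 6) := by ring
      _ ≤ (n + 1) * N * ((C + 20 * vs.length) * W) + (n + 1) * N * (6 * W)
          + (n + 1) * N * (6 * W) := by omega
      _ ≤ (n + 1) * N * ((C + 20 * vs.length) * W) + (n + 1) * N * (20 * W) := by
        nlinarith [Nat.zero_le ((n + 1) * N * W)]
      _ = _ := by ring

end Formulas

/-! ### Saturating a table of assignments, and the complete machine -/

section Saturation

variable {V : Type}

open Classical in
/-- Add the assignment `z` to the table if it satisfies `a`, and accept if it satisfies `ini`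
too. -/
noncomputable def saturate (a : Fml V) (ini : V → Src V) (L : List Event)
    (s : Bool × List (V → ℕ)) (z : V → ℕ) : Bool × List (V → ℕ) :=
  if a.Holds L z s.2 then (s.1 || decide (Fits ini z z L.length), z :: s.2) else s

/-- Put a copy of the current word on the table. -/
def recordP : Pr V := .seq (scan id (fun _ => false) (fun _ => false)) restoreBoth

theorem runs_recordP (r : Reg V) (L : List Event) (z : V → ℕ) (G : List (V → ℕ)) :
    ∃ r' : Reg V, r'.acc = r.acc ∧ recordP.RunsIn r (store L z G) r' (store L z (z :: G))
      (4 * wordLength L + 4) := by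
  have h := runs_scan id (fun _ => false) (fun _ => false) r [] [] (word z 0 L) [] (table G L) []
    [] []
  have hf : ∀ (l : List (Cell V)) (r : Reg V) (b : List (Cell V)),
      let m := l.foldl (sweepStep id (fun _ => false) (fun _ => false)) (r, b, [], [])
      m.1.acc = r.acc ∧ m.2 = (l.reverse ++ b, [], []) := by
    intro l
    induction l with
    | nil => intro r b; simp
    | cons c l ih =>
      intro r b
      obtain ⟨h₁, h₂⟩ := ih { r with cur := some c } (c :: b)
      rw [List.foldl_cons, List.reverse_cons, List.append_assoc]
      exact ⟨h₁, h₂⟩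
  obtain ⟨h₁, h₂⟩ := hf (word z 0 L) r []
  simp only [h₂] at h
  rw [List.append_nil, length_word] at h
  have h' := runs_restoreBoth
    { (List.foldl (sweepStep id (fun _ => false) (fun _ => false)) (r, [], [], [])
      (word z 0 L)).1 with cur := none } [] [] [] (word z 0 L).reverse (table G L) [] [] []
  rw [List.length_reverse, length_word, List.reverse_reverse, List.append_nil] at h'
  exact ⟨_, by exact h₁, (h.seq h').mono (by omega)⟩

/-- Prepare the word without marks from the input. -/
def loadP : Pr V :=
  .seq (.act (.push .A (fun _ => plain .blank)
      (.pop .inp (fun v o => { v with cur := o.map plain }) done)))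
    (.seq (.loop (fun v => v.cur.isSome)
      (.act (.push .B Reg.cell (.pop .inp (fun v o => { v with cur := o.map plain }) done))))
      restore)

/-- Values beyond the word leave no mark, so the bare input followed by a blank is the word of the
constant assignment `L.length + 1` with which the nested loops begin. -/
theorem word_unmarked (z : V → ℕ) (d : ℕ) (L : List Event) (hz : ∀ v, d + L.length < z v) :
    word z d L = (encodeList L).map plain ++ [plain .blank] := by
  have hm : ∀ i ≤ d + L.length, marks z i = fun _ => false := by
    intro i hi
    funext v
    have := hz v
    simp only [marks, decide_eq_false_iff_not]
    omega
  induction L generalizing d with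
  | nil => simp [word, encodeList, hm d (by simp), plain]
  | cons e L ih =>
    have hl : (e :: L).length = L.length + 1 := rfl
    rw [word, ih (d + 1) (fun v => by have := hz v; omega) (fun i hi => hm i (by omega)),
      hm d (by omega)]
    have : encodeEvent e = Γ'.bra :: eventTail e := rfl
    simp [encodeList, this, plain]

theorem runs_loadP (L : List Event) :
    (loadP (V := V)).RunsIn Reg.start (mem (encodeList L) [] [] [] [] [] [] []) Reg.start
      (store L (fun _ => L.length + 1) []) (4 * wordLength L + 4) := by
  have h := Prog.RunsIn.loopList (Γ := Alph V) (σ := Reg V) (b := fun v => v.cur.isSome)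
    (p := .act (.push .B Reg.cell (.pop .inp (fun v o => { v with cur := o.map plain }) done)))
    (fun (m : List (Cell V)) c => plain c :: m)
    (fun _ l => { (Reg.start : Reg V) with cur := l.head?.map plain })
    (fun m l => mem l.tail [] [plain .blank] m [] [] [] []) 1
    (by simp) (by simp)
    (fun m c l => .of_act (by simp) (by simp [Reg.cell])) [] (encodeList L)
  simp only [List.foldl_flip_cons_eq_append, List.head?_nil, List.tail_nil, Option.map_none,
    List.append_nil] at h
  have h' := runs_restore (V := V) Reg.start [] [] [plain .blank]
    ((encodeList L).map plain).reverse [] [] [] []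
  rw [List.reverse_reverse, List.length_reverse, List.length_map] at h'
  rw [store, word_unmarked _ _ _ (by simp)]
  refine (Prog.RunsIn.seq (.of_act ?_ ?_) (h.seq h')).mono ?_
  · simp [Reg.start]
  · simp
  · simp only [wordLength]; omega

/-- Clear the stacks and output the answer. -/
def finishP : Pr V :=
  .seq (.act (.pop .A (fun v o => { v with cur := o }) done))
    (.seq (.loop (fun v => v.cur.isSome) (.act (.pop .A (fun v o => { v with cur := o }) done)))
      (.seq (.act (.pop .T (fun v o => { v with cur := o }) done))
        (.seq
          (.loop (fun v => v.cur.isSome) (.act (.pop .T (fun v o => { v with cur := o }) done)))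
          (.act (.push .out Reg.acc (.load (fun _ => Reg.start) done))))))

theorem runs_finishP (r : Reg V) (a t : List (Cell V)) :
    finishP.RunsIn r (mem [] [] a [] t [] [] []) Reg.start (mem [] [r.acc] [] [] [] [] [] [])
      (2 * (a.length + t.length) + 5) := by
  have hA := Prog.RunsIn.loopList (Γ := Alph V) (σ := Reg V) (b := fun v => v.cur.isSome)
    (p := .act (.pop .A (fun v o => { v with cur := o }) done))
    (fun (m : Unit) (_ : Cell V) => m)
    (fun _ l => { r with cur := l.head? })
    (fun _ l => mem [] [] l.tail [] t [] [] []) 1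
    (by simp) (by simp) (fun m c l => .of_act (by simp) (by simp)) () a
  have hT := Prog.RunsIn.loopList (Γ := Alph V) (σ := Reg V) (b := fun v => v.cur.isSome)
    (p := .act (.pop .T (fun v o => { v with cur := o }) done))
    (fun (m : Unit) (_ : Cell V) => m)
    (fun _ l => { r with cur := l.head? })
    (fun _ l => mem [] [] [] [] l.tail [] [] []) 1
    (by simp) (by simp) (fun m c l => .of_act (by simp) (by simp)) () t
  simp only [List.head?_nil, List.tail_nil] at hA hT
  refine (Prog.RunsIn.seq (.of_act ?_ ?_) (hA.seq (Prog.RunsIn.seq (.of_act ?_ ?_)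
    (hT.seq (.of_act ?_ ?_))))).mono (by omega) <;> simp

variable [DecidableEq V]

/-- The program that performs `saturate`. -/
noncomputable def saturateP (a : Fml V) (ini : V → Src V) : Pr V :=
  .seq a.prog (.ite Reg.res
    (.seq (chkP ini) (.seq (setReg fun r => { r with acc := r.acc || r.res }) recordP))
    (setReg id))

theorem performs_saturateP (a : Fml V) (ini : V → Src V) :
    ∃ C, Performs (saturateP a ini) (saturate a ini) C := by
  classical
  obtain ⟨C, hC⟩ := a.computes
  obtain ⟨D, hD⟩ := computes_chkP ini
  refine ⟨C + D + 8, fun L z G hz hG r => ?_⟩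
  obtain ⟨r₁, a₁, b₁, R₁⟩ := hC L z G hz hG r
  have hle : wordLength L + 1 ≤ (wordLength L + 1) * (G.length + 1) :=
    Nat.le_mul_of_pos_right _ (by omega)
  cases hb : r₁.res with
  | false =>
    have hn : ¬ a.Holds L z G := fun h => by simpa [hb] using b₁.2 h
    refine ⟨r₁, ?_, ?_, ?_, ?_⟩
    · simp [saturate, hn, a₁]
    · simp [saturate, hn]
    · simpa [saturate, hn] using hG
    · simp only [saturate, hn, if_false]
      refine (R₁.seq (.iteFalse hb (runs_setReg id _ _))).mono ?_
      nlinarith [Nat.zero_le (D * ((wordLength L + 1) * (G.length + 1)))]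
  | true =>
    have hn : a.Holds L z G := b₁.1 hb
    obtain ⟨r₂, a₂, b₂, R₂⟩ := hD L z G hz hG r₁
    obtain ⟨r₃, a₃, R₃⟩ := runs_recordP { r₂ with acc := r₂.acc || r₂.res } L z G
    refine ⟨r₃, ?_, ?_, ?_, ?_⟩
    · have : r₂.res = decide (Fits ini z z L.length) := by rw [Bool.eq_iff_iff, b₂]; simp
      simp [saturate, hn, a₁, a₂, a₃, this]
    · simp [saturate, hn]
    · simpa [saturate, hn] using ⟨hz, hG⟩
    · simp only [saturate, hn, if_true]
      refine (R₁.seq (.iteTrue hb (R₂.seq ((runs_setReg _ _ _).seq R₃)))).mono ?_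
      nlinarith

/-- The whole program. -/
noncomputable def mainP (a : Fml V) (ini : V → Src V) (vs : List V) : Pr V :=
  .seq loadP (.seq (nestP (saturateP a ini) vs) finishP)

/-- The machine that runs a program. -/
noncomputable def machine [Fintype V] (p : Pr V) : FinTM2 where
  K := Stack
  k₀ := .inp
  k₁ := .out
  Γ := Alph V
  Λ := Option p.Label
  main := some p.entry
  σ := Reg V
  initialState := Reg.start
  Γk₀Fin := inferInstanceAs (Fintype Γ')
  m l := l.elim .halt (p.code some none)

/-- The extra step is the halt at the label `none`. A halting configuration has initial registers
and all stacks empty except the output, which is why `finishP` cleans up. -/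
theorem machine_outputs [Fintype V] (p : Pr V) (s : List Γ') (b : Bool) (t : ℕ)
    (h : p.RunsIn Reg.start (mem s [] [] [] [] [] [] []) Reg.start
      (mem [] [b] [] [] [] [] [] []) t) :
    Nonempty (TM2OutputsInTime (machine p) s (some [b]) (t + 1)) := by
  obtain ⟨t', ht, hr⟩ := h
  have hs := hr.steps (machine p).m some none (fun l => rfl)
  refine ⟨⟨⟨t' + 1, ?_⟩, Nat.succ_le_succ ht⟩⟩
  have h₀ : initList (machine p) s = ⟨some (some p.entry), Reg.start,
      mem s [] [] [] [] [] [] []⟩ := by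
    unfold initList
    congr 1
    funext k
    cases k <;> rfl
  have h₁ : haltList (machine p) [b] = ⟨none, Reg.start, mem [] [b] [] [] [] [] [] []⟩ := by
    unfold haltList
    congr 1
    funext k
    cases k <;> rfl
  rw [h₀, Option.map_some, h₁]
  change (flip bind (TM2.step (machine p).m))^[t' + 1] _ = _
  exact (Function.iterate_succ_apply' _ t' _).trans
    ((congrArg (flip bind (TM2.step (machine p).m)) hs).trans rfl)

/-- Problems that are decided by saturating a table of assignments are in polynomial time. -/
theorem inPolyTime_of_saturate [Fintype V] (a : Fml V) (ini : V → Src V) (vs : List V)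
    (hvs : vs.Nodup) (hmem : ∀ v, v ∈ vs) {α : Type} (listing : α → List Event) (P : α → Prop)
    (hP : ∀ x, P x ↔ ((assignments (listing x).length vs fun _ => (listing x).length + 1).foldl
      (saturate a ini (listing x)) (false, [])).1 = true) :
    InPolyTime (fun x => encodeList (listing x)) P := by
  classical
  obtain ⟨C, hC⟩ := performs_saturateP a ini
  let N : Polynomial ℕ := (Polynomial.X + 1) ^ vs.length
  -- The summands pay for `loadP`, the nested loops, `finishP` and the halting step; `N` bounds both
  -- the number of assignments and the number of table entries.
  let T : Polynomial ℕ := 4 * (Polynomial.X + 1) + 4 +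
    (N * (Polynomial.C (C + 20 * vs.length) * ((Polynomial.X + 1 + 1) * (N + 1))) +
      (2 * ((Polynomial.X + 1) + N * (Polynomial.X + 1)) + 5)) + 1
  have key : ∀ x, Nonempty (TM2OutputsInTime (machine (mainP a ini vs))
      (encodeList (listing x)) (some [decide (P x)]) (T.eval (encodeList (listing x)).length)) := by
    intro x
    set L := listing x with hL
    have hlen : L.length ≤ (encodeList L).length := by
      clear_value L
      clear hL
      induction L with
      | nil => simp
      | cons e L ih =>
        have : (encodeEvent e).length = (eventTail e).length + 1 := rfl
        simp only [encodeList, List.flatMap_cons, List.length_append, List.length_cons] at ih ⊢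
        omega
    set B := (L.length + 1) ^ vs.length with hB
    obtain ⟨r, h₁, h₂, -, h₄⟩ := runs_nestP hC L B vs hvs (fun _ => L.length + 1)
      (fun _ _ => rfl) (fun v hv => absurd (hmem v) hv) [] (by simp) (by simp [hB]) Reg.start
    have h₅ := runs_finishP r (word (fun _ => L.length + 1) 0 L)
      (table ((assignments L.length vs fun _ => L.length + 1).foldl (saturate a ini L)
        (Reg.start.acc (V := V), [])).2 L)
    have hacc : r.acc = decide (P x) := by
      rw [h₁, Bool.eq_iff_iff, decide_eq_true_eq, hP x]
      rfl
    rw [hacc] at h₅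
    obtain ⟨h₆⟩ := machine_outputs (mainP a ini vs) (encodeList L) (decide (P x)) _
      ((runs_loadP L).seq (h₄.seq h₅))
    refine ⟨⟨h₆.toEvalsTo, h₆.steps_le_m.trans ?_⟩⟩
    rw [length_word, length_table]
    simp only [T, N, Polynomial.eval_add, Polynomial.eval_mul, Polynomial.eval_pow,
      Polynomial.eval_X, Polynomial.eval_one, Polynomial.eval_C, Polynomial.eval_ofNat]
    simp only [List.length_nil, zero_add] at h₂
    have hBle : B ≤ ((encodeList L).length + 1) ^ vs.length := by
      rw [hB]; gcongr
    have hw : wordLength L = (encodeList L).length + 1 := rfl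
    rw [hw]
    gcongr
    exact h₂.trans hBle
  have key' : ∀ x, Nonempty (TM2OutputsInTime (machine (mainP a ini vs))
      (List.map (Equiv.refl Γ').invFun (encodeList (listing x)))
      (some (List.map (Equiv.refl Bool).invFun (encodeBool (decide (P x)))))
      (T.eval (encodeList (listing x)).length)) := fun x =>
    (List.map_id (encodeList (listing x))).symm ▸ key x
  exact ⟨{
    tm := machine (mainP a ini vs)
    inputAlphabet := Equiv.refl _
    outputAlphabet := Equiv.refl _
    time := T
    outputsFun := fun x => Classical.choice (key' x) }⟩

end Saturation

/-! ### The search space -/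

/-- The components of a state of the search: the location under consideration is that of the
event at `x`, the `i`-th thread is that of the event at `tau i`, the writes of this thread before
`pw i` have been placed, its reads before `pr i` have been served, and the last write that was
placed is the event at `last`. -/
inductive Vr (k : ℕ) where
  | x
  | last
  | tau (i : Fin k)
  | pw (i : Fin k)
  | pr (i : Fin k)
  deriving DecidableEq

noncomputable instance (k : ℕ) : Fintype (Vr k) :=
  Fintype.ofInjective (β := Bool ⊕ Fin k × Fin 3)
    (fun v => match v with
      | .x => .inl true
      | .last => .inl false
      | .tau i => .inr (i, 0)
      | .pw i => .inr (i, 1)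
      | .pr i => .inr (i, 2))
    (by rintro (_ | _ | _ | _ | _) (_ | _ | _ | _ | _) h <;> simp_all)

section Search

variable {k : ℕ}

/-- The events at positions `i` and `j` agree in the field `f`. -/
def SameAt (L : List Event) (f : Fld) (i j : ℕ) : Prop :=
  ∃ a b, L[i]? = some a ∧ L[j]? = some b ∧ f.bits a = f.bits b

/-- The event at position `i` is a write. -/
def WriteAt (L : List Event) (i : ℕ) : Prop := ∃ e, L[i]? = some e ∧ e.op = Op.write

/-- The event at position `p` accesses the location at `x` in the `i`-th thread. -/
def Relevant (L : List Event) (y : Vr k → ℕ) (i : Fin k) (p : ℕ) : Prop :=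
  SameAt L .loc p (y .x) ∧ SameAt L .tid p (y (.tau i))

/-- Increase one component. -/
def adv (y : Vr k → ℕ) (p : Vr k) : Vr k → ℕ := fun v => if v = p then y v + 1 else y v

/-- Place the next write of the `i`-th thread. -/
def place (y : Vr k → ℕ) (i : Fin k) : Vr k → ℕ := fun v =>
  if v = .pw i then y v + 1 else if v = .last then y (.pw i) else y v

/-- Start with the next location. -/
def nextLoc (n : ℕ) (y : Vr k → ℕ) : Vr k → ℕ
  | .x => y .x + 1
  | .last => n
  | .tau i => y (.tau i)
  | .pw _ => 0
  | .pr _ => 0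

/-- A state from which the goal is reached in one step, if `R` holds for the states from which it
is reached otherwise. -/
def Step (L : List Event) (R : (Vr k → ℕ) → Prop) (y : Vr k → ℕ) : Prop :=
  y .x = L.length ∨
  ((∀ i, y (.pw i) = L.length ∧ y (.pr i) = L.length) ∧
    (∃ i, SameAt L .tid (y .x) (y (.tau i)) ∧
      ∀ j, j ≠ i → ¬ SameAt L .tid (y .x) (y (.tau j))) ∧ R (nextLoc L.length y)) ∨
  (∃ i, y (.pw i) ≠ L.length ∧
    ((¬ (Relevant L y i (y (.pw i)) ∧ WriteAt L (y (.pw i))) ∧ R (adv y (.pw i))) ∨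
      ((Relevant L y i (y (.pw i)) ∧ WriteAt L (y (.pw i))) ∧ R (place y i)))) ∨
  (∃ i, y (.pr i) ≠ L.length ∧
    ((¬ (Relevant L y i (y (.pr i)) ∧ ¬ WriteAt L (y (.pr i))) ∧ R (adv y (.pr i))) ∨
      ((Relevant L y i (y (.pr i)) ∧ ¬ WriteAt L (y (.pr i))) ∧ y (.pr i) ≤ y (.pw i) ∧
        SameAt L .val (y (.pr i)) (y .last) ∧ R (adv y (.pr i)))))

/-- The goal is reached in fewer than `r + 1` steps. -/
def Reach (L : List Event) : ℕ → (Vr k → ℕ) → Prop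
  | 0 => fun _ => False
  | r + 1 => Step L (Reach L r)

/-- The initial states. -/
def Initial (n : ℕ) (y : Vr k → ℕ) : Prop :=
  y .x = 0 ∧ y .last = n ∧ ∀ i, y (.pw i) = 0 ∧ y (.pr i) = 0

theorem adv_le {n : ℕ} {y : Vr k → ℕ} {p : Vr k} (hy : ∀ v, y v ≤ n) (hp : y p ≠ n) (v : Vr k) :
    adv y p v ≤ n := by
  have := hy v
  unfold adv
  split
  · rename_i h
    subst h
    omega
  · exact this

theorem place_le {n : ℕ} {y : Vr k → ℕ} {i : Fin k} (hy : ∀ v, y v ≤ n) (hp : y (.pw i) ≠ n)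
    (v : Vr k) : place y i v ≤ n := by
  have := hy v
  have := hy (.pw i)
  unfold place
  split
  · rename_i h
    subst h
    omega
  · split <;> omega

theorem nextLoc_le {n : ℕ} {y : Vr k → ℕ} (hy : ∀ v, y v ≤ n) (hp : y .x ≠ n)
    (v : Vr k) : nextLoc n y v ≤ n := by
  have := hy v
  cases v <;> simp [nextLoc] <;> omega

/-- Restricting `hR` to bounded states matters because only these are ever tabulated. -/
theorem Step.mono {L : List Event} {R R' : (Vr k → ℕ) → Prop} {y : Vr k → ℕ}
    (hy : ∀ v, y v ≤ L.length) (h : Step L R y)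
    (hR : ∀ y', (∀ v, y' v ≤ L.length) → R y' → R' y') : Step L R' y := by
  -- At `y .x = L.length` the state `nextLoc` would leave the bounds, but there the goal is already
  -- reached.
  by_cases hx : y .x = L.length
  · exact Or.inl hx
  rcases h with h | ⟨h₁, h₂, h₃⟩ | ⟨i, h₁, h₂⟩ | ⟨i, h₁, h₂⟩
  · exact Or.inl h
  · exact Or.inr (Or.inl ⟨h₁, h₂, hR _ (nextLoc_le hy hx) h₃⟩)
  · refine Or.inr (Or.inr (Or.inl ⟨i, h₁, ?_⟩))
    rcases h₂ with ⟨h₂, h₃⟩ | ⟨h₂, h₃⟩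
    · exact Or.inl ⟨h₂, hR _ (adv_le hy h₁) h₃⟩
    · exact Or.inr ⟨h₂, hR _ (place_le hy h₁) h₃⟩
  · refine Or.inr (Or.inr (Or.inr ⟨i, h₁, ?_⟩))
    rcases h₂ with ⟨h₂, h₃⟩ | ⟨h₂, h₃, h₄, h₅⟩
    · exact Or.inl ⟨h₂, hR _ (adv_le hy h₁) h₃⟩
    · exact Or.inr ⟨h₂, h₃, h₄, hR _ (adv_le hy h₁) h₅⟩

theorem Reach.succ {L : List Event} {r : ℕ} {y : Vr k → ℕ} (hy : ∀ v, y v ≤ L.length)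
    (h : Reach L r y) : Reach L (r + 1) y := by
  induction r generalizing y with
  | zero => exact h.elim
  | succ r ih => exact Step.mono hy h fun y' hy' h' => ih hy' h'

theorem Reach.le {L : List Event} {r r' : ℕ} {y : Vr k → ℕ} (hy : ∀ v, y v ≤ L.length)
    (h : Reach L r y) (hr : r ≤ r') : Reach L r' y := by
  induction hr with
  | refl => exact h
  | step _ ih => exact ih.succ hy

/-- The work left at the current location. -/
def workLeft (n : ℕ) (y : Vr k → ℕ) : ℕ := ∑ i, ((n - y (.pw i)) + (n - y (.pr i)))

theorem workLeft_le (n : ℕ) (y : Vr k → ℕ) : workLeft n y ≤ 2 * k * n := by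
  unfold workLeft
  refine (Finset.sum_le_card_nsmul _ _ (2 * n) fun i _ => by omega).trans ?_
  simp only [Finset.card_univ, Fintype.card_fin, smul_eq_mul]
  exact le_of_eq (by ring)

theorem workLeft_lt {n : ℕ} {y y' : Vr k → ℕ} (i : Fin k)
    (h : ∀ j, y (.pw j) ≤ y' (.pw j) ∧ y (.pr j) ≤ y' (.pr j))
    (hi : y (.pw i) < y' (.pw i) ∧ y (.pw i) < n ∨ y (.pr i) < y' (.pr i) ∧ y (.pr i) < n) :
    workLeft n y' < workLeft n y := by
  unfold workLeft
  refine Finset.sum_lt_sum (fun j _ => ?_) ⟨i, Finset.mem_univ i, ?_⟩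
  · have := h j
    omega
  · have := h i
    omega

/-- A bound for the number of steps to the goal. -/
def rank (n : ℕ) (y : Vr k → ℕ) : ℕ := (n - y .x) * (2 * k * n + 1) + workLeft n y

theorem rank_adv_pw {n : ℕ} {y : Vr k → ℕ} (hy : ∀ v, y v ≤ n) {i : Fin k} (hi : y (.pw i) ≠ n) :
    rank n (adv y (.pw i)) < rank n y := by
  have hx : adv y (.pw i) .x = y .x := by simp [adv]
  unfold rank
  rw [hx]
  refine Nat.add_lt_add_left (workLeft_lt i (fun j => ?_) (Or.inl ?_)) _
  · constructor <;> unfold adv <;> split <;> omega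
  · have := hy (.pw i)
    simp [adv]; omega

theorem rank_adv_pr {n : ℕ} {y : Vr k → ℕ} (hy : ∀ v, y v ≤ n) {i : Fin k} (hi : y (.pr i) ≠ n) :
    rank n (adv y (.pr i)) < rank n y := by
  have hx : adv y (.pr i) .x = y .x := by simp [adv]
  unfold rank
  rw [hx]
  refine Nat.add_lt_add_left (workLeft_lt i (fun j => ?_) (Or.inr ?_)) _
  · constructor <;> unfold adv <;> split <;> omega
  · have := hy (.pr i)
    simp [adv]; omega

theorem rank_place {n : ℕ} {y : Vr k → ℕ} (hy : ∀ v, y v ≤ n) {i : Fin k} (hi : y (.pw i) ≠ n) :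
    rank n (place y i) < rank n y := by
  have hx : place y i .x = y .x := by simp [place]
  unfold rank
  rw [hx]
  refine Nat.add_lt_add_left (workLeft_lt i (fun j => ?_) (Or.inl ?_)) _
  · constructor
    · simp only [place, reduceCtorEq, if_false]
      split <;> omega
    · simp [place]
  · have := hy (.pw i)
    simp [place]; omega

/-- Resetting the pointers creates at most `2 * k * n` new work, less than the weight `2 * k * n +
1` of one location. -/
theorem rank_nextLoc {n : ℕ} {y : Vr k → ℕ} (hy : ∀ v, y v ≤ n) (hx : y .x ≠ n) :
    rank n (nextLoc n y) < rank n y := by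
  have h₁ := workLeft_le n (nextLoc n y)
  have h₂ : nextLoc n y .x = y .x + 1 := rfl
  unfold rank
  rw [h₂]
  obtain ⟨m, hm⟩ : ∃ m, n - y .x = m + 1 := ⟨n - y .x - 1, by have := hy .x; omega⟩
  rw [hm, show n - (y .x + 1) = m by omega, add_mul m 1]
  omega

/-- Every step lowers the rank, so the length of a successful run is bounded by the rank of its
first state, whatever `r` was. -/
theorem Reach.rank {L : List Event} {r : ℕ} {y : Vr k → ℕ} (hy : ∀ v, y v ≤ L.length)
    (h : Reach L r y) : Reach L (rank L.length y + 1) y := by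
  induction r generalizing y with
  | zero => exact h.elim
  | succ r ih =>
    by_cases hx : y .x = L.length
    · exact Or.inl hx
    have lift : ∀ y' : Vr k → ℕ, (∀ v, y' v ≤ L.length) → Reach L r y' →
        WeakMemory.rank L.length y' < WeakMemory.rank L.length y →
        Reach L (WeakMemory.rank L.length y) y' := fun y' h₁ h₂ h₃ => (ih h₁ h₂).le h₁ h₃
    rcases h with h | ⟨h₁, h₂, h₃⟩ | ⟨i, h₁, h₂⟩ | ⟨i, h₁, h₂⟩
    · exact Or.inl h
    · exact Or.inr (Or.inl ⟨h₁, h₂, lift _ (nextLoc_le hy hx) h₃ (rank_nextLoc hy hx)⟩)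
    · refine Or.inr (Or.inr (Or.inl ⟨i, h₁, ?_⟩))
      rcases h₂ with ⟨h₂, h₃⟩ | ⟨h₂, h₃⟩
      · exact Or.inl ⟨h₂, lift _ (adv_le hy h₁) h₃ (rank_adv_pw hy h₁)⟩
      · exact Or.inr ⟨h₂, lift _ (place_le hy h₁) h₃ (rank_place hy h₁)⟩
    · refine Or.inr (Or.inr (Or.inr ⟨i, h₁, ?_⟩))
      rcases h₂ with ⟨h₂, h₃⟩ | ⟨h₂, h₃, h₄, h₅⟩
      · exact Or.inl ⟨h₂, lift _ (adv_le hy h₁) h₃ (rank_adv_pr hy h₁)⟩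
      · exact Or.inr ⟨h₂, h₃, h₄, lift _ (adv_le hy h₁) h₅ (rank_adv_pr hy h₁)⟩

/-- Bernoulli's inequality turns the bound into a power of `n + 1`, a number of rounds that `2 * k +
1` nested counters realise without any arithmetic. -/
theorem rank_lt (n : ℕ) (y : Vr k → ℕ) : rank n y < (n + 1) ^ (2 * k + 1) := by
  have h₁ := workLeft_le n y
  have h₂ : 1 + 2 * k * n ≤ (1 + n) ^ (2 * k) := by
    have := one_add_mul_le_pow (R := ℤ) (a := n) (by omega) (2 * k)
    zify
    push_cast at this
    linarith
  have h₃ : (n - y .x) * (2 * k * n + 1) ≤ n * (2 * k * n + 1) := by gcongr; omega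
  unfold rank
  calc _ < (n + 1) * (1 + 2 * k * n) := by nlinarith
    _ ≤ (n + 1) * (1 + n) ^ (2 * k) := by gcongr
    _ = _ := by ring

/-! ### The search as a formula -/

/-- The components of a state and counters. -/
abbrev Wr (k : ℕ) : Type := Vr k ⊕ Fin (2 * k + 1)

/-- Describe the components of a state, and leave the counters arbitrary. -/
def onState (g : Vr k → Src (Wr k)) : Wr k → Src (Wr k) := Sum.elim g fun _ => .any

/-- A true formula. -/
def Fml.tt {V : Type} : Fml V := .chk fun _ => .any

/-- Finite disjunctions. -/
def Fml.any {ι V : Type} (l : List ι) (a : ι → Fml V) : Fml V :=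
  l.foldr (fun i b => .or (a i) b) (.not .tt)

/-- Finite conjunctions. -/
def Fml.all {ι V : Type} (l : List ι) (a : ι → Fml V) : Fml V :=
  l.foldr (fun i b => .and (a i) b) .tt

theorem Fml.holds_tt {V : Type} (L : List Event) (z : V → ℕ) (G) : Fml.tt.Holds L z G :=
  fun _ h => absurd rfl h

theorem Fml.holds_any {ι V : Type} (l : List ι) (a : ι → Fml V) (L : List Event) (z : V → ℕ) (G) :
    (Fml.any l a).Holds L z G ↔ ∃ i ∈ l, (a i).Holds L z G := by
  induction l with
  | nil => simp [Fml.any, Fml.Holds, Fml.holds_tt]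
  | cons i l ih =>
    simp only [Fml.any, List.foldr_cons, Fml.Holds, List.exists_mem_cons_iff] at ih ⊢
    rw [ih]

theorem Fml.holds_all {ι V : Type} (l : List ι) (a : ι → Fml V) (L : List Event) (z : V → ℕ) (G) :
    (Fml.all l a).Holds L z G ↔ ∀ i ∈ l, (a i).Holds L z G := by
  induction l with
  | nil => simp [Fml.all, Fml.holds_tt]
  | cons i l ih =>
    simp only [Fml.all, List.foldr_cons, Fml.Holds, List.forall_mem_cons] at ih ⊢
    rw [ih]

/-- Increase one component and keep the others. -/
def advSrc (p : Vr k) : Wr k → Src (Wr k) := onState fun v => if v = p then .shift else .keep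

/-- Place a write. -/
def placeSrc (i : Fin k) : Wr k → Src (Wr k) := onState fun v =>
  if v = .pw i then .shift else if v = .last then .copy (.inl (.pw i)) else .keep

/-- Start with the next location. -/
def nextLocSrc : Wr k → Src (Wr k) := onState fun v => match v with
  | .x => .shift
  | .last => .top
  | .tau _ => .keep
  | .pw _ => .zero
  | .pr _ => .zero

/-- All events have been examined. -/
def endSrc : Wr k → Src (Wr k) := onState fun v => match v with
  | .x => .any
  | .last => .any
  | .tau _ => .any
  | .pw _ => .top
  | .pr _ => .top

/-- The state is initial. -/
def initialSrc : Wr k → Src (Wr k) := onState fun v => match v with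
  | .x => .zero
  | .last => .top
  | .tau _ => .any
  | .pw _ => .zero
  | .pr _ => .zero

/-- The formula for `Relevant`. -/
def relevantFml (i : Fin k) (p : Vr k) : Fml (Wr k) :=
  .and (.same .loc (.inl p) (.inl .x)) (.same .tid (.inl p) (.inl (.tau i)))

/-- The formula for `Step`. -/
def stepFml (k : ℕ) : Fml (Wr k) :=
  .or (.chk (only (.inl .x) .top)) <|
  .or (.and (.chk endSrc) (.and
    (.any (List.finRange k) fun i => .and (.same .tid (.inl .x) (.inl (.tau i)))
      (.all ((List.finRange k).filter (· ≠ i)) fun j =>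
        .not (.same .tid (.inl .x) (.inl (.tau j)))))
    (.look nextLocSrc))) <|
  .or (.any (List.finRange k) fun i => .and (.not (.chk (only (.inl (.pw i)) .top))) (.or
    (.and (.not (.and (relevantFml i (.pw i)) (.wr (.inl (.pw i))))) (.look (advSrc (.pw i))))
    (.and (.and (relevantFml i (.pw i)) (.wr (.inl (.pw i)))) (.look (placeSrc i)))))
  (.any (List.finRange k) fun i => .and (.not (.chk (only (.inl (.pr i)) .top))) (.or
    (.and (.not (.and (relevantFml i (.pr i)) (.not (.wr (.inl (.pr i))))))
      (.look (advSrc (.pr i))))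
    (.and (.and (relevantFml i (.pr i)) (.not (.wr (.inl (.pr i)))))
      (.and (.le (.inl (.pr i)) (.inl (.pw i)))
        (.and (.same .val (.inl (.pr i)) (.inl .last)) (.look (advSrc (.pr i))))))))

theorem fits_onState {g : Vr k → Src (Wr k)} {z u : Wr k → ℕ} {n : ℕ} :
    Fits (onState g) z u n ↔ ∀ v, g v ≠ .any → u (.inl v) = (g v).val z n (.inl v) := by
  constructor
  · exact fun h v hv => h (.inl v) hv
  · rintro h (v | j) hv
    · exact h v hv
    · exact absurd rfl hv

theorem fits_onState_eq {g : Vr k → Src (Wr k)} (hg : ∀ v, g v ≠ .any) {z u : Wr k → ℕ} {n : ℕ}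
    {y : Vr k → ℕ} (hy : ∀ v, y v = (g v).val z n (.inl v)) :
    Fits (onState g) z u n ↔ u ∘ Sum.inl = y := by
  rw [fits_onState, funext_iff]
  refine forall_congr' fun v => ?_
  simp [hg v, hy v]

/-- Every successor is determined componentwise by the current state, so asking whether it is in the
table is a single `look`. Counters are left arbitrary and do not distinguish states. -/
theorem holds_stepFml (L : List Event) (z : Wr k → ℕ) (G : List (Wr k → ℕ)) :
    (stepFml k).Holds L z G ↔ Step L (fun y => ∃ u ∈ G, u ∘ Sum.inl = y) (z ∘ Sum.inl) := by
  have hadv : ∀ p u, Fits (advSrc p) z u L.length ↔ u ∘ Sum.inl = adv (z ∘ Sum.inl) p := by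
    intro p u
    refine fits_onState_eq (fun v => ?_) (fun v => ?_)
    · split <;> simp
    · unfold adv; split <;> simp [Src.val]
  have hplace : ∀ i u, Fits (placeSrc i) z u L.length ↔
      u ∘ Sum.inl = place (z ∘ Sum.inl) i := by
    intro p u
    refine fits_onState_eq (fun v => ?_) (fun v => ?_)
    · split
      · simp
      · split <;> simp
    · unfold place
      split
      · simp [Src.val]
      · split <;> simp [Src.val]
  have hnext : ∀ u, Fits nextLocSrc z u L.length ↔
      u ∘ Sum.inl = nextLoc L.length (z ∘ Sum.inl) := by
    intro u
    refine fits_onState_eq (fun v => ?_) (fun v => ?_)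
    · cases v <;> simp
    · cases v <;> simp [Src.val, nextLoc]
  have hend : Fits endSrc z z L.length ↔
      ∀ i, z (.inl (.pw i)) = L.length ∧ z (.inl (.pr i)) = L.length := by
    unfold endSrc
    rw [fits_onState]
    constructor
    · exact fun h i => ⟨h (.pw i) (by simp), h (.pr i) (by simp)⟩
    · rintro h (_ | _ | _ | i | i) hv
      · exact absurd rfl hv
      · exact absurd rfl hv
      · exact absurd rfl hv
      · exact (h i).1
      · exact (h i).2
  simp only [stepFml, Fml.Holds, Fml.holds_any, Fml.holds_all, hadv, hplace, hnext, hend,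
    relevantFml, fits_only (show (Src.top : Src (Wr k)) ≠ .any by simp), Src.val, Step, Relevant,
    SameAt, WriteAt, Function.comp_apply, List.mem_finRange, true_and, List.mem_filter,
    decide_eq_true_eq, ne_eq]

theorem fits_initialSrc {z u : Wr k → ℕ} {n : ℕ} :
    Fits initialSrc z u n ↔ Initial n (u ∘ Sum.inl) := by
  unfold initialSrc
  rw [fits_onState]
  constructor
  · exact fun h => ⟨h .x (by simp), h .last (by simp),
      fun i => ⟨h (.pw i) (by simp), h (.pr i) (by simp)⟩⟩
  · rintro ⟨h₁, h₂, h₃⟩ (_ | _ | _ | i | i) hv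
    · exact h₁
    · exact h₂
    · exact absurd rfl hv
    · exact (h₃ i).1
    · exact (h₃ i).2

end Search

/-! ### Correctness of the saturation in sufficiently many rounds -/

section Rounds

variable {k : ℕ}

theorem assignments_append {V : Type} [DecidableEq V] (n : ℕ) (vs ws : List V) (z : V → ℕ) :
    assignments n (vs ++ ws) z = (assignments n vs z).flatMap (assignments n ws) := by
  induction vs generalizing z with
  | nil => simp [assignments]
  | cons x vs ih => simp [assignments, ih, List.flatMap_assoc]

theorem mem_assignments {V : Type} [DecidableEq V] {n : ℕ} {vs : List V} {z u : V → ℕ}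
    (h₁ : ∀ v ∈ vs, u v ≤ n) (h₂ : ∀ v, v ∉ vs → u v = z v) : u ∈ assignments n vs z := by
  induction vs generalizing z with
  | nil =>
    have : u = z := funext fun v => h₂ v (by simp)
    simp [assignments, this]
  | cons x vs ih =>
    rw [assignments, List.mem_flatMap]
    refine ⟨u x, ?_, ih (fun v hv => h₁ v (by simp [hv])) fun v hv => ?_⟩
    · have := h₁ x (by simp)
      rw [List.mem_range]
      omega
    · by_cases hx : v = x
      · subst hx; simp
      · rw [Function.update_of_ne hx]
        exact h₂ v (by simp [hx, hv])

/-- The order in which the machine runs through the assignments: the counters change most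
slowly. -/
noncomputable def loopOrder (k : ℕ) : List (Wr k) :=
  (List.finRange (2 * k + 1)).map Sum.inr ++ (Finset.univ : Finset (Vr k)).toList.map Sum.inl

theorem nodup_loopOrder (k : ℕ) : (loopOrder k).Nodup := by
  unfold loopOrder
  rw [List.nodup_append]
  refine ⟨(List.nodup_finRange _).map Sum.inr_injective,
    (Finset.nodup_toList _).map Sum.inl_injective, ?_⟩
  intro a ha b hb
  simp only [List.mem_map] at ha hb
  obtain ⟨i, -, rfl⟩ := ha
  obtain ⟨j, -, rfl⟩ := hb
  simp

theorem mem_loopOrder (v : Wr k) : v ∈ loopOrder k := by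
  cases v <;> simp [loopOrder]

/-- Each recorded state is justified by states recorded before it, so by induction the goal is
reachable from every entry. -/
theorem saturate_sound {L : List Event} {s : Bool × List (Wr k → ℕ)} (l : List (Wr k → ℕ))
    (hl : ∀ z ∈ l, ∀ v, z v ≤ L.length)
    (h₁ : ∀ u ∈ s.2, (∀ v, u v ≤ L.length) ∧ ∃ r, Reach L r (u ∘ Sum.inl))
    (h₂ : s.1 = true → ∃ y : Vr k → ℕ, Initial L.length y ∧ (∀ v, y v ≤ L.length) ∧
      ∃ r, Reach L r y) :
    (l.foldl (saturate (stepFml k) initialSrc L) s).1 = true →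
      ∃ y : Vr k → ℕ, Initial L.length y ∧ (∀ v, y v ≤ L.length) ∧ ∃ r, Reach L r y := by
  induction l generalizing s with
  | nil => exact h₂
  | cons z l ih =>
    rw [List.foldl_cons]
    by_cases h : (stepFml k).Holds L z s.2
    · have hz := hl z (by simp)
      have hreach : ∃ r, Reach L r (z ∘ Sum.inl) := by
        have hs := (holds_stepFml L z s.2).1 h
        -- The entries come with different numbers of steps; the table being finite, their maximum
        -- serves for all.
        have hfin : ∃ r, ∀ u ∈ s.2, Reach L r (u ∘ Sum.inl) := by
          have : ∀ G : List (Wr k → ℕ), (∀ u ∈ G, (∀ v, u v ≤ L.length) ∧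
              ∃ r, Reach L r (u ∘ Sum.inl)) → ∃ r, ∀ u ∈ G, Reach L r (u ∘ Sum.inl) := by
            intro G
            induction G with
            | nil => exact fun _ => ⟨0, by simp⟩
            | cons u G ihG =>
              intro hG
              obtain ⟨r, hr⟩ := ihG fun u hu => hG u (by simp [hu])
              obtain ⟨hu, r', hr'⟩ := hG u (by simp)
              refine ⟨max r r', fun w hw => ?_⟩
              rcases List.mem_cons.1 hw with rfl | hw
              · exact hr'.le (fun v => hu _) (le_max_right _ _)
              · exact (hr w hw).le (fun v => (hG w (by simp [hw])).1 _) (le_max_left _ _)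
          exact this _ h₁
        obtain ⟨r, hr⟩ := hfin
        refine ⟨r + 1, hs.mono (fun v => hz _) ?_⟩
        rintro y' _ ⟨u, hu, rfl⟩
        exact hr u hu
      refine ih (fun w hw => hl w (by simp [hw])) ?_ ?_
      · simp only [saturate, h, if_true, List.forall_mem_cons]
        exact ⟨⟨hz, hreach⟩, h₁⟩
      · simp only [saturate, h, if_true, Bool.or_eq_true, decide_eq_true_eq, fits_initialSrc]
        rintro (h' | h')
        · exact h₂ h'
        · exact ⟨_, h', fun v => hz _, hreach⟩
    · have : saturate (stepFml k) initialSrc L s z = s := by simp [saturate, h]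
      rw [this]
      exact ih (fun w hw => hl w (by simp [hw])) h₁ h₂

theorem foldl_saturate_mono {L : List Event} (l : List (Wr k → ℕ))
    (s : Bool × List (Wr k → ℕ)) :
    (s.1 = true → (l.foldl (saturate (stepFml k) initialSrc L) s).1 = true) ∧
      ∀ u ∈ s.2, u ∈ (l.foldl (saturate (stepFml k) initialSrc L) s).2 := by
  induction l generalizing s with
  | nil => exact ⟨id, fun _ => id⟩
  | cons z l ih =>
    rw [List.foldl_cons]
    refine ⟨fun h => (ih _).1 ?_, fun u hu => (ih _).2 u ?_⟩
    · unfold saturate; split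
      · simp [h]
      · exact h
    · unfold saturate; split
      · simp [hu]
      · exact hu

/-- All states from which the goal is reached within `r` steps have been found. -/
def Covers (L : List Event) (r : ℕ) (s : Bool × List (Wr k → ℕ)) : Prop :=
  ∀ y : Vr k → ℕ, (∀ v, y v ≤ L.length) → Reach L r y →
    (∃ u ∈ s.2, u ∘ Sum.inl = y) ∧ (Initial L.length y → s.1 = true)

/-- When a state comes up during the round, the table still contains everything found in earlier
rounds. Entries added meanwhile are harmless because `Step` is monotone. -/
theorem Covers.round {L : List Event} {r : ℕ} {s : Bool × List (Wr k → ℕ)} (hs : Covers L r s)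
    (l : List (Wr k → ℕ))
    (hl : ∀ y : Vr k → ℕ, (∀ v, y v ≤ L.length) → ∃ z ∈ l, z ∘ Sum.inl = y) :
    Covers L (r + 1) (l.foldl (saturate (stepFml k) initialSrc L) s) := by
  intro y hy hr
  obtain ⟨z, hz, rfl⟩ := hl y hy
  obtain ⟨l₁, l₂, rfl⟩ := List.append_of_mem hz
  rw [List.foldl_append, List.foldl_cons]
  set s₁ := l₁.foldl (saturate (stepFml k) initialSrc L) s
  have hh : (stepFml k).Holds L z s₁.2 := by
    rw [holds_stepFml]
    refine Step.mono hy hr fun y' hy' h' => ?_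
    obtain ⟨⟨u, hu, rfl⟩, -⟩ := hs y' hy' h'
    exact ⟨u, (foldl_saturate_mono l₁ s).2 u hu, rfl⟩
  have hm := foldl_saturate_mono (L := L) l₂ (saturate (stepFml k) initialSrc L s₁ z)
  refine ⟨⟨z, hm.2 z ?_, rfl⟩, fun hi => hm.1 ?_⟩
  · simp [saturate, hh]
  · simp [saturate, hh, fits_initialSrc, hi]

theorem Covers.rounds {L : List Event} (ls : List (Wr k → ℕ))
    (f : (Wr k → ℕ) → List (Wr k → ℕ))
    (hf : ∀ z, ∀ y : Vr k → ℕ, (∀ v, y v ≤ L.length) → ∃ u ∈ f z, u ∘ Sum.inl = y)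
    {r : ℕ} {s : Bool × List (Wr k → ℕ)} (hs : Covers L r s) :
    Covers L (r + ls.length) ((ls.flatMap f).foldl (saturate (stepFml k) initialSrc L) s) := by
  induction ls generalizing r s with
  | nil => exact hs
  | cons z ls ih =>
    rw [List.flatMap_cons, List.foldl_append, List.length_cons, show r + (ls.length + 1) =
      r + 1 + ls.length by omega]
    exact ih (hs.round (f z) (hf z))

theorem assignments_le {V : Type} [DecidableEq V] {n : ℕ} {vs : List V} {z u : V → ℕ}
    (h : u ∈ assignments n vs z) (v : V) (hv : v ∈ vs ∨ z v ≤ n) : u v ≤ n := by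
  induction vs generalizing z with
  | nil =>
    simp only [assignments, List.mem_singleton] at h
    subst h
    simpa using hv
  | cons x vs ih =>
    rw [assignments, List.mem_flatMap] at h
    obtain ⟨d, hd, h⟩ := h
    rw [List.mem_range] at hd
    refine ih h ?_
    by_cases hx : v = x
    · subst hx; right; simp; omega
    · rw [Function.update_of_ne hx]
      simpa [hx] using hv

/-- The counters are the outer loops, so each of their `(n + 1) ^ (2 * k + 1)` values triggers one
complete pass over the states, and the rank bound shows that this many passes suffice. -/
theorem saturate_iff (L : List Event) :
    ((assignments L.length (loopOrder k) fun _ => L.length + 1).foldl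
      (saturate (stepFml k) initialSrc L) (false, [])).1 = true ↔
      ∃ y : Vr k → ℕ, Initial L.length y ∧ (∀ v, y v ≤ L.length) ∧ ∃ r, Reach L r y := by
  constructor
  · refine saturate_sound _ (fun z hz v => ?_) (by simp) (by simp)
    exact assignments_le hz v (Or.inl (mem_loopOrder v))
  · rintro ⟨y, hi, hy, r, hr⟩
    have h0 : Covers (k := k) L 0 (false, []) := fun y _ h => h.elim
    rw [loopOrder, assignments_append]
    refine (Covers.rounds _ _ ?_ h0 y hy ?_).2 hi
    · intro z y hy
      refine ⟨Sum.elim y fun j => z (.inr j), mem_assignments ?_ ?_, by funext v; rfl⟩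
      · intro v hv
        simp only [List.mem_map] at hv
        obtain ⟨v, -, rfl⟩ := hv
        exact hy v
      · rintro (v | j) hv
        · simp at hv
        · rfl
    · refine hr.rank hy |>.le hy ?_
      rw [length_assignments]
      have := rank_lt L.length y
      simp only [List.length_map, List.length_finRange]
      omega

end Rounds

/-! ### Schedules -/

section Schedules

variable {k : ℕ} {L : List Event}

theorem SameAt.lt_left {f : Fld} {i j : ℕ} (h : SameAt L f i j) : i < L.length := by
  obtain ⟨a, b, ha, -, -⟩ := h
  exact (List.getElem?_eq_some_iff.1 ha).1

theorem SameAt.symm {f : Fld} {i j : ℕ} (h : SameAt L f i j) : SameAt L f j i := by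
  obtain ⟨a, b, ha, hb, h⟩ := h
  exact ⟨b, a, hb, ha, h.symm⟩

theorem SameAt.trans {f : Fld} {i j l : ℕ} (h : SameAt L f i j) (h' : SameAt L f j l) :
    SameAt L f i l := by
  obtain ⟨a, b, ha, hb, h⟩ := h
  obtain ⟨b', c, hb', hc, h'⟩ := h'
  rw [hb] at hb'
  cases hb'
  exact ⟨a, c, ha, hc, h.trans h'⟩

theorem SameAt.refl {f : Fld} {i : ℕ} (h : i < L.length) : SameAt L f i i :=
  ⟨L[i], L[i], by simp [h], by simp [h], rfl⟩

/-- Times for the events, given by their positions, at which the writes take effect in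
modification order, and the reads take place. -/
structure Timing (L : List Event) (T : ℕ → ℕ) : Prop where
  inj : ∀ a b, SameAt L .loc a b → T a = T b → a = b
  mono : ∀ a b, SameAt L .loc a b → SameAt L .tid a b → a < b →
    T a < T b ∨ (¬ WriteAt L a ∧ WriteAt L b)
  reads : ∀ r < L.length, ¬ WriteAt L r → ∃ w, WriteAt L w ∧ SameAt L .loc w r ∧
    SameAt L .val w r ∧ T w < T r ∧
      ∀ w', WriteAt L w' → SameAt L .loc w' r → T w' < T r → T w' ≤ T w

/-- Every event belongs to exactly one of the threads. -/
def Partitions (L : List Event) (y : Vr k → ℕ) : Prop :=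
  ∀ j < L.length, ∃ i, SameAt L .tid j (y (.tau i)) ∧
    ∀ i', i' ≠ i → ¬ SameAt L .tid j (y (.tau i'))

theorem Partitions.unique {y : Vr k → ℕ} (h : Partitions L y) {j : ℕ} {i i' : Fin k}
    (hi : SameAt L .tid j (y (.tau i))) (hi' : SameAt L .tid j (y (.tau i'))) : i = i' := by
  obtain ⟨i₀, -, hu⟩ := h j hi.lt_left
  have h₁ : i = i₀ := by
    by_contra hne
    exact hu i hne hi
  have h₂ : i' = i₀ := by
    by_contra hne
    exact hu i' hne hi'
  rw [h₁, h₂]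

theorem Partitions.congr {y y' : Vr k → ℕ} (h : Partitions L y)
    (hy : ∀ i, y' (.tau i) = y (.tau i)) : Partitions L y' := by
  intro j hj
  simpa only [hy] using h j hj

/-- The event at position `j` concerns the current location and has not been processed. -/
def Pending (L : List Event) (y : Vr k → ℕ) (j : ℕ) : Prop :=
  ∃ i, Relevant L y i j ∧ (WriteAt L j → y (.pw i) ≤ j) ∧ (¬ WriteAt L j → y (.pr i) ≤ j)

/-- The reads of a list of positions read the last write before them; the last write before the
list is at position `l`. -/
def ReadsLast (L : List Event) : ℕ → List ℕ → Prop
  | _, [] => True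
  | l, j :: S => (WriteAt L j ∧ ReadsLast L j S) ∨
      (¬ WriteAt L j ∧ SameAt L .val j l ∧ ReadsLast L l S)

/-- `S` is an order in which the pending events can be processed. -/
structure Schedule (L : List Event) (y : Vr k → ℕ) (S : List ℕ) : Prop where
  nodup : S.Nodup
  mem_iff : ∀ j, j ∈ S ↔ Pending L y j
  order : S.Pairwise fun a b => SameAt L .tid a b → b < a → ¬ WriteAt L b ∧ WriteAt L a
  reads : ReadsLast L (y .last) S

/-- The state in which the location of the event at `x` is to be examined. -/
def startAt (n : ℕ) (y : Vr k → ℕ) (x : ℕ) : Vr k → ℕ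
  | .x => x
  | .last => n
  | .tau i => y (.tau i)
  | .pw _ => 0
  | .pr _ => 0

theorem Schedule.of_pending_iff {y y' : Vr k → ℕ} {S : List ℕ} (h : Schedule L y' S)
    (hp : ∀ j, Pending L y' j ↔ Pending L y j) (hl : y' .last = y .last) : Schedule L y S :=
  ⟨h.nodup, fun j => (h.mem_iff j).trans (hp j), h.order, hl ▸ h.reads⟩

theorem pending_adv_pw {y : Vr k → ℕ} {i : Fin k}
    (h : ¬ (Relevant L y i (y (.pw i)) ∧ WriteAt L (y (.pw i)))) (j : ℕ) :
    Pending L (adv y (.pw i)) j ↔ Pending L y j := by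
  refine exists_congr fun i' => and_congr_right fun hr => ?_
  replace hr : Relevant L y i' j := hr
  refine and_congr (forall_congr' fun hw => ?_) Iff.rfl
  by_cases hi : i' = i
  · subst hi
    simp only [adv, if_true]
    constructor
    · omega
    · intro hle
      by_contra hlt
      have : y (.pw i') = j := by omega
      rw [this] at h
      exact h ⟨hr, hw⟩
  · simp [adv, hi]

theorem pending_adv_pr {y : Vr k → ℕ} {i : Fin k}
    (h : ¬ (Relevant L y i (y (.pr i)) ∧ ¬ WriteAt L (y (.pr i)))) (j : ℕ) :
    Pending L (adv y (.pr i)) j ↔ Pending L y j := by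
  refine exists_congr fun i' => and_congr_right fun hr => ?_
  replace hr : Relevant L y i' j := hr
  refine and_congr Iff.rfl (forall_congr' fun hw => ?_)
  by_cases hi : i' = i
  · subst hi
    simp only [adv, if_true]
    constructor
    · omega
    · intro hle
      by_contra hlt
      have : y (.pr i') = j := by omega
      rw [this] at h
      exact h ⟨hr, hw⟩
  · simp [adv, hi]

/-- Placing a write removes it from the pending events. -/
theorem pending_place {y : Vr k → ℕ} (hu : Partitions L y) {i : Fin k}
    (h : Relevant L y i (y (.pw i)) ∧ WriteAt L (y (.pw i))) (j : ℕ) :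
    Pending L (place y i) j ↔ Pending L y j ∧ j ≠ y (.pw i) := by
  constructor
  · rintro ⟨i', hr, h₁, h₂⟩
    replace hr : Relevant L y i' j := hr
    by_cases hi : i' = i
    · subst hi
      simp only [place, if_true, reduceCtorEq, if_false] at h₁ h₂
      refine ⟨⟨i', hr, fun hw => by have := h₁ hw; omega, h₂⟩, ?_⟩
      rintro rfl
      have := h₁ h.2
      omega
    · simp only [place, Vr.pw.injEq, hi, reduceCtorEq, if_false] at h₁ h₂
      refine ⟨⟨i', hr, h₁, h₂⟩, ?_⟩
      rintro rfl
      exact hi (hu.unique hr.2 h.1.2)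
  · rintro ⟨⟨i', hr, h₁, h₂⟩, hne⟩
    refine ⟨i', hr, fun hw => ?_, fun hw => by simpa [place] using h₂ hw⟩
    have := h₁ hw
    by_cases hi : i' = i
    · subst hi
      simp only [place, if_true]
      omega
    · simpa [place, hi] using this

/-- Serving a read removes it from the pending events. -/
theorem pending_serve {y : Vr k → ℕ} (hu : Partitions L y) {i : Fin k}
    (h : Relevant L y i (y (.pr i)) ∧ ¬ WriteAt L (y (.pr i))) (j : ℕ) :
    Pending L (adv y (.pr i)) j ↔ Pending L y j ∧ j ≠ y (.pr i) := by
  constructor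
  · rintro ⟨i', hr, h₁, h₂⟩
    replace hr : Relevant L y i' j := hr
    by_cases hi : i' = i
    · subst hi
      simp only [adv, if_true, reduceCtorEq, if_false] at h₁ h₂
      refine ⟨⟨i', hr, h₁, fun hw => by have := h₂ hw; omega⟩, ?_⟩
      rintro rfl
      have := h₂ h.2
      omega
    · simp only [adv, Vr.pr.injEq, hi, reduceCtorEq, if_false] at h₁ h₂
      refine ⟨⟨i', hr, h₁, h₂⟩, ?_⟩
      rintro rfl
      exact hi (hu.unique hr.2 h.1.2)
  · rintro ⟨⟨i', hr, h₁, h₂⟩, hne⟩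
    refine ⟨i', hr, fun hw => by simpa [adv] using h₁ hw, fun hw => ?_⟩
    have := h₂ hw
    by_cases hi : i' = i
    · subst hi
      simp only [adv, if_true]
      omega
    · simpa [adv, hi] using this

/-- Leaving a position `x` requires that exactly one representative has the thread of its event. A
run that reaches the end has checked this for all remaining positions. -/
theorem Reach.partitions {r : ℕ} {y : Vr k → ℕ} (h : Reach L r y) :
    ∀ j, y .x ≤ j → j < L.length → ∃ i, SameAt L .tid j (y (.tau i)) ∧
      ∀ i', i' ≠ i → ¬ SameAt L .tid j (y (.tau i')) := by
  induction r generalizing y with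
  | zero => exact h.elim
  | succ r ih =>
    intro j h₁ h₂
    rcases h with h | ⟨-, h, h'⟩ | ⟨i, -, ⟨-, h⟩ | ⟨-, h⟩⟩ | ⟨i, -, ⟨-, h⟩ | ⟨-, -, -, h⟩⟩
    · omega
    · rcases h₁.eq_or_lt with rfl | h₁
      · exact h
      · exact ih h' j h₁ h₂
    all_goals exact ih h j h₁ h₂

/-- A run is read backwards. Placing a write or serving a read puts that event in front of the
schedule of the next state, a skip does not change what is pending, and at a change of location
nothing is pending. The second conjunct carries the schedules of the positions still to be examined.
-/
theorem Reach.schedule {r : ℕ} {y : Vr k → ℕ} (hu : Partitions L y) (h : Reach L r y) :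
    (y .x < L.length → ∃ S, Schedule L y S) ∧
      ∀ x, y .x < x → x < L.length → ∃ S, Schedule L (startAt L.length y x) S := by
  induction r generalizing y with
  | zero => exact h.elim
  | succ r ih =>
    rcases h with h | ⟨hp, h, h'⟩ | ⟨i, hne, ⟨hr, h⟩ | ⟨hr, h⟩⟩ |
      ⟨i, hne, ⟨hr, h⟩ | ⟨hr, hle, hv, h⟩⟩
    · exact ⟨fun h' => by omega, fun x _ _ => by omega⟩
    · have ih' := ih (hu.congr (y' := nextLoc L.length y) fun _ => rfl) h'
      refine ⟨fun _ => ⟨[], List.nodup_nil, fun j => ?_, List.Pairwise.nil, trivial⟩,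
        fun x hx hx' => ?_⟩
      · simp only [List.not_mem_nil, false_iff]
        rintro ⟨i, hr, h₁, h₂⟩
        have hj := hr.1.lt_left
        have := hp i
        by_cases hw : WriteAt L j
        · have := h₁ hw; omega
        · have := h₂ hw; omega
      · rcases (Nat.succ_le_of_lt hx).eq_or_lt with hx | hx
        · obtain ⟨S, hS⟩ := ih'.1 (by simp only [nextLoc]; omega)
          refine ⟨S, ?_⟩
          have : startAt L.length y x = nextLoc L.length y := by
            funext v
            cases v <;> simp [startAt, nextLoc]
            omega
          rwa [this]
        · exact ih'.2 x hx hx'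
    · have ih' := ih (hu.congr (y' := adv y (.pw i)) fun _ => rfl) h
      refine ⟨fun hx => ?_, ih'.2⟩
      obtain ⟨S, hS⟩ := ih'.1 hx
      exact ⟨S, hS.of_pending_iff (pending_adv_pw hr) rfl⟩
    · have ih' := ih (hu.congr (y' := place y i) fun _ => rfl) h
      refine ⟨fun hx => ?_, ih'.2⟩
      obtain ⟨S, hS⟩ := ih'.1 hx
      have hmem : ∀ j, j ∈ S ↔ Pending L y j ∧ j ≠ y (.pw i) := fun j =>
        (hS.mem_iff j).trans (pending_place hu hr j)
      refine ⟨y (.pw i) :: S, ?_, fun j => ?_, ?_, Or.inl ⟨hr.2, ?_⟩⟩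
      · refine List.nodup_cons.2 ⟨fun hm => ?_, hS.nodup⟩
        exact ((hmem _).1 hm).2 rfl
      · rw [List.mem_cons, hmem]
        by_cases hj : j = y (.pw i)
        · subst hj
          simp only [true_or, true_iff]
          exact ⟨i, hr.1, fun _ => le_rfl, fun hw => absurd hr.2 hw⟩
        · simp [hj]
      · refine List.pairwise_cons.2 ⟨fun b hb ht hlt => ⟨fun hw => ?_, hr.2⟩, hS.order⟩
        obtain ⟨⟨i', hr', h₁, -⟩, -⟩ := (hmem b).1 hb
        have : i' = i := hu.unique (ht.trans hr'.2) hr.1.2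
        subst this
        have := h₁ hw
        omega
      · have := hS.reads
        simpa [place] using this
    · have ih' := ih (hu.congr (y' := adv y (.pr i)) fun _ => rfl) h
      refine ⟨fun hx => ?_, ih'.2⟩
      obtain ⟨S, hS⟩ := ih'.1 hx
      exact ⟨S, hS.of_pending_iff (pending_adv_pr hr) rfl⟩
    · have ih' := ih (hu.congr (y' := adv y (.pr i)) fun _ => rfl) h
      refine ⟨fun hx => ?_, ih'.2⟩
      obtain ⟨S, hS⟩ := ih'.1 hx
      have hmem : ∀ j, j ∈ S ↔ Pending L y j ∧ j ≠ y (.pr i) := fun j =>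
        (hS.mem_iff j).trans (pending_serve hu hr j)
      refine ⟨y (.pr i) :: S, ?_, fun j => ?_, ?_, Or.inr ⟨hr.2, hv, ?_⟩⟩
      · refine List.nodup_cons.2 ⟨fun hm => ?_, hS.nodup⟩
        exact ((hmem _).1 hm).2 rfl
      · rw [List.mem_cons, hmem]
        by_cases hj : j = y (.pr i)
        · subst hj
          simp only [true_or, true_iff]
          exact ⟨i, hr.1, fun hw => absurd hw hr.2, fun _ => le_rfl⟩
        · simp [hj]
      · refine List.pairwise_cons.2 ⟨fun b hb ht hlt => ?_, hS.order⟩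
        obtain ⟨⟨i', hr', h₁, h₂⟩, -⟩ := (hmem b).1 hb
        have : i' = i := hu.unique (ht.trans hr'.2) hr.1.2
        subst this
        exfalso
        -- The side condition `hle` excludes an earlier write that is still pending; the pointer
        -- `pr` excludes an earlier read.
        by_cases hw : WriteAt L b
        · have := h₁ hw
          omega
        · have := h₂ hw
          omega
      · have := hS.reads
        simpa [adv] using this

/-- In a list whose reads read the last write, this write is found before the read. -/
theorem ReadsLast.exists_write {l : ℕ} {S : List ℕ} (h : ReadsLast L l S) {q r : ℕ}
    (hq : S[q]? = some r) (hr : ¬ WriteAt L r) :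
    (∃ p < q, ∃ w, S[p]? = some w ∧ WriteAt L w ∧ SameAt L .val w r ∧
      ∀ p' w', p < p' → p' < q → S[p']? = some w' → ¬ WriteAt L w') ∨
    (SameAt L .val l r ∧ ∀ p' w', p' < q → S[p']? = some w' → ¬ WriteAt L w') := by
  induction S generalizing l q with
  | nil => simp at hq
  | cons j S ih =>
    cases q with
    | zero =>
      simp only [List.getElem?_cons_zero, Option.some.injEq] at hq
      subst hq
      rcases h with ⟨h, -⟩ | ⟨-, h, -⟩
      · exact absurd h hr
      · exact Or.inr ⟨h.symm, fun _ _ h => absurd h (by omega)⟩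
    | succ q =>
      rw [List.getElem?_cons_succ] at hq
      have shift : (∃ p < q, ∃ w, S[p]? = some w ∧ WriteAt L w ∧ SameAt L .val w r ∧
          ∀ p' w', p < p' → p' < q → S[p']? = some w' → ¬ WriteAt L w') →
          ∃ p < q + 1, ∃ w, (j :: S)[p]? = some w ∧ WriteAt L w ∧ SameAt L .val w r ∧
          ∀ p' w', p < p' → p' < q + 1 → (j :: S)[p']? = some w' → ¬ WriteAt L w' := by
        rintro ⟨p, hp, w, h₁, h₂, h₃, h₄⟩
        refine ⟨p + 1, by omega, w, by simpa using h₁, h₂, h₃, fun p' w' hp' hq' h' => ?_⟩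
        cases p' with
        | zero => omega
        | succ p' => exact h₄ p' w' (by omega) (by omega) (by simpa using h')
      rcases h with ⟨hw, h⟩ | ⟨hw, -, h⟩
      · refine Or.inl ?_
        rcases ih h hq with h' | ⟨h₁, h₂⟩
        · exact shift h'
        · refine ⟨0, by omega, j, by simp, hw, h₁, fun p' w' hp' hq' h' => ?_⟩
          cases p' with
          | zero => omega
          | succ p' => exact h₂ p' w' (by omega) (by simpa using h')
      · rcases ih h hq with h' | ⟨h₁, h₂⟩
        · exact Or.inl (shift h')
        · refine Or.inr ⟨h₁, fun p' w' hq' h' => ?_⟩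
          cases p' with
          | zero =>
            simp only [List.getElem?_cons_zero, Option.some.injEq] at h'
            exact h' ▸ hw
          | succ p' => exact h₂ p' w' (by omega) (by simpa using h')

theorem bits_injective {f : Fld} {a b : Event} (h : f.bits a = f.bits b) :
    match f with
    | .tid => a.tid = b.tid
    | .op => True
    | .loc => a.loc = b.loc
    | .val => a.val = b.val := by
  have hn : ∀ m n, encodeNum m = encodeNum n → m = n := by
    intro m n h
    unfold encodeNum at h
    have := List.map_injective_iff.2 (fun a b h => Γ'.bit.inj h) h
    simpa using congrArg decodeNat this
  cases f <;> first | trivial | exact hn _ _ h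

/-- In an initial state nothing has been processed, so the schedule for `x` lists all events at the
location of `x`. The order of this list supplies the times. -/
theorem Reach.exists_timing {r : ℕ} {y : Vr k → ℕ} (hi : Initial L.length y) (h : Reach L r y) :
    ∃ T, Timing L T := by
  have hu : Partitions L y := fun j hj => h.partitions j (by rw [hi.1]; omega) hj
  have hstart : startAt L.length y 0 = y := by
    funext v
    cases v with
    | x => exact hi.1.symm
    | last => exact hi.2.1.symm
    | tau i => rfl
    | pw i => exact (hi.2.2 i).1.symm
    | pr i => exact (hi.2.2 i).2.symm
  have hS : ∀ x < L.length, ∃ S, Schedule L (startAt L.length y x) S := by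
    intro x hx
    rcases Nat.eq_zero_or_pos x with rfl | h0
    · rw [hstart]
      exact (h.schedule hu).1 (by rw [hi.1]; exact hx)
    · exact (h.schedule hu).2 x (by rw [hi.1]; exact h0) hx
  have hpend : ∀ x j, Pending L (startAt L.length y x) j ↔ SameAt L .loc j x := by
    intro x j
    constructor
    · rintro ⟨i, hr, -⟩
      exact hr.1
    · intro h
      obtain ⟨i, hi, -⟩ := hu j h.lt_left
      exact ⟨i, ⟨h, hi⟩, fun _ => Nat.zero_le _, fun _ => Nat.zero_le _⟩
  -- Positions with a common location obtain their schedules from different parts of the run. Their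
  -- times must come from a common list, so one list is chosen per location.
  have hloc : ∀ c : ℕ, ∃ S : List ℕ, ∀ x e, L[x]? = some e → e.loc = c →
      Schedule L (startAt L.length y x) S := by
    intro c
    by_cases hc : ∃ (x : ℕ) (e : Event), L[x]? = some e ∧ e.loc = c
    · obtain ⟨x, e, hx, he⟩ := hc
      obtain ⟨S, hS⟩ := hS x (List.getElem?_eq_some_iff.1 hx).1
      refine ⟨S, fun x' e' hx' he' => hS.of_pending_iff (fun j => ?_) rfl⟩
      have hxx : SameAt L .loc x x' := ⟨e, e', hx, hx', by simp [Fld.bits, he, he']⟩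
      rw [hpend, hpend]
      exact ⟨fun h => h.trans hxx, fun h => h.trans hxx.symm⟩
    · exact ⟨[], fun x e hx he => absurd ⟨x, e, hx, he⟩ hc⟩
  choose S hS' using hloc
  let loc : ℕ → ℕ := fun j => L[j]?.elim 0 Event.loc
  have hsch : ∀ x < L.length, Schedule L (startAt L.length y x) (S (loc x)) := by
    intro x hx
    exact hS' _ x L[x] (by simp [hx]) (by simp [loc, hx])
  have hmem : ∀ x j, x < L.length → (j ∈ S (loc x) ↔ SameAt L .loc j x) := fun x j hx =>
    ((hsch x hx).mem_iff j).trans (hpend x j)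
  have hloc : ∀ a b, SameAt L .loc a b → loc a = loc b := by
    rintro a b ⟨e, e', ha, hb, h⟩
    simpa [loc, ha, hb] using bits_injective h
  -- The time is the index in the list of the location; `Timing` never compares times at different
  -- locations.
  refine ⟨fun j => (S (loc j)).idxOf j, ?_, ?_, ?_⟩
  · intro a b hab h
    have hb := hab.symm.lt_left
    rw [hloc a b hab] at h
    exact List.idxOf_inj ((hmem b a hb).2 hab) |>.1 h
  · intro a b hab ht hlt
    have hb := hab.symm.lt_left
    rw [hloc a b hab]
    have ha' := (hmem b a hb).2 hab
    have hb' := (hmem b b hb).2 (SameAt.refl hb)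
    by_contra hc
    rw [not_or, not_lt] at hc
    have hne : (S (loc b)).idxOf b ≠ (S (loc b)).idxOf a := by
      intro h
      have := (List.idxOf_inj hb').1 h
      omega
    have hlt' : (S (loc b)).idxOf b < (S (loc b)).idxOf a := lt_of_le_of_ne hc.1 hne
    have := List.pairwise_iff_getElem.1 (hsch b hb).order _ _ (List.idxOf_lt_length_iff.2 hb')
      (List.idxOf_lt_length_iff.2 ha') hlt'
    simp only [List.getElem_idxOf] at this
    exact hc.2 (this ht.symm hlt)
  · intro r hr hw
    have hr' := (hmem r r hr).2 (SameAt.refl hr)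
    have hnd := (hsch r hr).nodup
    have hget : (S (loc r))[(S (loc r)).idxOf r]? = some r := by
      rw [List.getElem?_eq_getElem (List.idxOf_lt_length_iff.2 hr'), List.getElem_idxOf]
    have hidx : ∀ p w, (S (loc r))[p]? = some w → (S (loc r)).idxOf w = p := by
      intro p w hp
      obtain ⟨hlt, rfl⟩ := List.getElem?_eq_some_iff.1 hp
      exact hnd.idxOf_getElem p hlt
    rcases (hsch r hr).reads.exists_write hget hw with ⟨p, hp, w, h₁, h₂, h₃, h₄⟩ | ⟨h₁, -⟩
    · have hwr : SameAt L .loc w r := (hmem r w hr).1 (List.mem_of_getElem? h₁)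
      refine ⟨w, h₂, hwr, h₃, ?_, fun w' hw' hl' hlt => ?_⟩
      · rw [hloc w r hwr, hidx p w h₁]; exact hp
      · rw [hloc w' r hl'] at hlt ⊢
        rw [hloc w r hwr, hidx p w h₁]
        by_contra hc
        have hm := (hmem r w' hr).2 hl'
        refine h₄ _ w' (not_le.1 hc) hlt ?_ hw'
        rw [List.getElem?_eq_getElem (List.idxOf_lt_length_iff.2 hm), List.getElem_idxOf]
    -- Initially `last` is `L.length`, not the position of an event, so no read can precede all
    -- writes.
    · have := h₁.lt_left
      simp [startAt] at this

end Schedules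

/-! ### From a timing to a successful run -/

section Completeness

variable {k : ℕ} {L : List Event}

/-- The event at position `j` concerns the current location and has been processed. -/
def Processed (L : List Event) (y : Vr k → ℕ) (j : ℕ) : Prop :=
  SameAt L .loc j (y .x) ∧ ¬ Pending L y j

/-- The state `y` arises from processing the events in the order given by `T`. -/
structure Follows (L : List Event) (T : ℕ → ℕ) (y : Vr k → ℕ) : Prop where
  le : ∀ v, y v ≤ L.length
  partitions : Partitions L y
  closed : ∀ a b, Processed L y a → Pending L y b → T a < T b
  last : ∀ w, Processed L y w → WriteAt L w → Processed L y (y .last) ∧ WriteAt L (y .last) ∧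
    T w ≤ T (y .last)

theorem Pending.sameAt {y : Vr k → ℕ} {j : ℕ} (h : Pending L y j) : SameAt L .loc j (y .x) :=
  let ⟨_, hr, _⟩ := h; hr.1

theorem Follows.of_pending_iff {T : ℕ → ℕ} {y y' : Vr k → ℕ} (h : Follows L T y)
    (hle : ∀ v, y' v ≤ L.length) (hp : ∀ j, Pending L y' j ↔ Pending L y j)
    (ht : ∀ i, y' (.tau i) = y (.tau i)) (hx : y' .x = y .x) (hl : y' .last = y .last) :
    Follows L T y' := by
  have hd : ∀ j, Processed L y' j ↔ Processed L y j := fun j => by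
    unfold Processed
    rw [hp, hx]
  refine ⟨hle, h.partitions.congr ht, fun a b ha hb => h.closed a b ((hd a).1 ha) ((hp b).1 hb),
    fun w hw hw' => ?_⟩
  rw [hl, hd]
  exact h.last w ((hd w).1 hw) hw'

/-- Nothing has been processed at the start of a location, so the conditions on processed events
hold vacuously. -/
theorem Follows.startAt {T : ℕ → ℕ} {y : Vr k → ℕ} {x : ℕ} (hle : ∀ v, y v ≤ L.length)
    (hu : Partitions L y) (hx : x ≤ L.length) : Follows L T (startAt L.length y x) := by
  have hnone : ∀ j, ¬ Processed L (WeakMemory.startAt L.length y x) j := by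
    rintro j ⟨h, hp⟩
    obtain ⟨i, hi, -⟩ := hu j h.lt_left
    exact hp ⟨i, ⟨h, hi⟩, fun _ => Nat.zero_le _, fun _ => Nat.zero_le _⟩
  refine ⟨fun v => ?_, hu.congr fun _ => rfl, fun a b ha => (hnone a ha).elim,
    fun w hw => (hnone w hw).elim⟩
  cases v with
  | x => exact hx
  | last => exact le_rfl
  | tau i => exact hle _
  | pw i => exact Nat.zero_le _
  | pr i => exact Nat.zero_le _

/-- The run follows `T`: pointers skip whatever does not concern the current location or their kind
of operation, and when no skip is possible the pending event of least time is processed. Induction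
on `rank`. -/
theorem Timing.reach {T : ℕ → ℕ} (hT : Timing L T) {y : Vr k → ℕ} (hy : Follows L T y) :
    ∃ r, Reach L r y := by
  induction hm : rank L.length y using Nat.strong_induction_on generalizing y with
  | _ m ih =>
  subst hm
  by_cases hx : y .x = L.length
  · exact ⟨1, Or.inl hx⟩
  have hxlt : y .x < L.length := lt_of_le_of_ne (hy.le _) hx
  by_cases hend : ∀ i, y (.pw i) = L.length ∧ y (.pr i) = L.length
  · have hn : nextLoc L.length y = startAt L.length y (y .x + 1) := by
      funext v; cases v <;> rfl
    obtain ⟨r, hr⟩ := ih _ (rank_nextLoc hy.le hx)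
      (hn ▸ Follows.startAt hy.le hy.partitions hxlt) rfl
    exact ⟨r + 1, Or.inr (Or.inl ⟨hend, hy.partitions _ hxlt, hr⟩)⟩
  by_cases hskw : ∃ i, y (.pw i) ≠ L.length ∧
      ¬ (Relevant L y i (y (.pw i)) ∧ WriteAt L (y (.pw i)))
  · obtain ⟨i, hi, hn⟩ := hskw
    obtain ⟨r, hr⟩ := ih _ (rank_adv_pw hy.le hi)
      (hy.of_pending_iff (adv_le hy.le hi) (pending_adv_pw hn) (fun _ => rfl) rfl rfl) rfl
    exact ⟨r + 1, Or.inr (Or.inr (Or.inl ⟨i, hi, Or.inl ⟨hn, hr⟩⟩))⟩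
  by_cases hskr : ∃ i, y (.pr i) ≠ L.length ∧
      ¬ (Relevant L y i (y (.pr i)) ∧ ¬ WriteAt L (y (.pr i)))
  · obtain ⟨i, hi, hn⟩ := hskr
    obtain ⟨r, hr⟩ := ih _ (rank_adv_pr hy.le hi)
      (hy.of_pending_iff (adv_le hy.le hi) (pending_adv_pr hn) (fun _ => rfl) rfl rfl) rfl
    exact ⟨r + 1, Or.inr (Or.inr (Or.inr ⟨i, hi, Or.inl ⟨hn, hr⟩⟩))⟩
  -- With all skips exhausted, each pointer not at the end rests on a pending event of its kind.
  have hW : ∀ i, y (.pw i) ≠ L.length → Relevant L y i (y (.pw i)) ∧ WriteAt L (y (.pw i)) := by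
    intro i hi
    by_contra hc
    exact hskw ⟨i, hi, hc⟩
  have hR : ∀ i, y (.pr i) ≠ L.length →
      Relevant L y i (y (.pr i)) ∧ ¬ WriteAt L (y (.pr i)) := by
    intro i hi
    by_contra hc
    exact hskr ⟨i, hi, hc⟩
  have hWp : ∀ i, y (.pw i) ≠ L.length → Pending L y (y (.pw i)) := fun i hi =>
    ⟨i, (hW i hi).1, fun _ => le_rfl, fun h => absurd (hW i hi).2 h⟩
  have hRp : ∀ i, y (.pr i) ≠ L.length → Pending L y (y (.pr i)) := fun i hi =>
    ⟨i, (hR i hi).1, fun h => absurd h (hR i hi).2, fun _ => le_rfl⟩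
  have hex : ∃ j, Pending L y j := by
    push Not at hend
    obtain ⟨i, hi⟩ := hend
    by_cases h : y (.pw i) = L.length
    · exact ⟨_, hRp i (hi h)⟩
    · exact ⟨_, hWp i h⟩
  obtain ⟨j, hj, hmin⟩ : ∃ j, Pending L y j ∧ ∀ b, Pending L y b → T j ≤ T b := by
    classical
    have hex' : ∃ t, ∃ j, Pending L y j ∧ T j = t := let ⟨j, hj⟩ := hex; ⟨_, j, hj, rfl⟩
    obtain ⟨j, hj, hjt⟩ := Nat.find_spec hex'
    exact ⟨j, hj, fun b hb => hjt ▸ Nat.find_min' hex' ⟨b, hb, rfl⟩⟩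
  have hlt : ∀ b, Pending L y b → b ≠ j → T j < T b := by
    intro b hb hne
    refine lt_of_le_of_ne (hmin b hb) fun h => hne ?_
    exact (hT.inj j b (hj.sameAt.trans hb.sameAt.symm) h).symm
  obtain ⟨i, hr, h₁, h₂⟩ := id hj
  have hjn := hr.1.lt_left
  have hbefore : ∀ a, Pending L y a → SameAt L .tid a (y (.tau i)) → a < j →
      ¬ WriteAt L a ∧ WriteAt L j := by
    intro a ha ht hlt'
    rcases hT.mono a j (ha.sameAt.trans hr.1.symm) (ht.trans hr.2.symm) hlt' with h | h
    · have := hmin a ha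
      omega
    · exact h
  by_cases hw : WriteAt L j
  · have hle := h₁ hw
    have hne : y (.pw i) ≠ L.length := by omega
    -- Otherwise the write at the pointer would be pending and earlier in the thread than `j`; only
    -- reads may be overtaken.
    have hij : y (.pw i) = j := by
      by_contra hc
      exact (hbefore _ (hWp i hne) (hW i hne).1.2 (lt_of_le_of_ne hle hc)).1 (hW i hne).2
    have hp := pending_place hy.partitions (hW i hne)
    have hd : ∀ a, Processed L (place y i) a → Processed L y a ∨ a = j := by
      rintro a ⟨ha, ha'⟩
      by_cases haj : a = j
      · exact Or.inr haj
      · refine Or.inl ⟨ha, fun h => ha' ((hp a).2 ⟨h, by rwa [hij]⟩)⟩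
    have hdj : Processed L (place y i) j := ⟨hr.1, fun h => ((hp j).1 h).2 hij.symm⟩
    have hl : place y i .last = j := by simp [place, hij]
    obtain ⟨r, hr'⟩ := ih _ (rank_place hy.le hne) (y := place y i)
      ⟨place_le hy.le hne, hy.partitions.congr fun _ => rfl, by
        intro a b ha hb
        obtain ⟨hb, hbj⟩ := (hp b).1 hb
        rcases hd a ha with ha | rfl
        · exact hy.closed a b ha hb
        · exact hlt b hb (by rwa [hij] at hbj), by
        intro w hw₁ hw₂
        rw [hl]
        refine ⟨hdj, hw, ?_⟩
        rcases hd w hw₁ with hw₁ | rfl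
        · exact (hy.closed w j hw₁ hj).le
        · exact le_rfl⟩ rfl
    exact ⟨r + 1, Or.inr (Or.inr (Or.inl ⟨i, hne, Or.inr ⟨hW i hne, hr'⟩⟩))⟩
  · have hle := h₂ hw
    have hne : y (.pr i) ≠ L.length := by omega
    -- A read overtakes nothing, so no pending event of its thread precedes it; the same reason
    -- gives `hpw`.
    have hij : y (.pr i) = j := by
      by_contra hc
      exact hw (hbefore _ (hRp i hne) (hR i hne).1.2 (lt_of_le_of_ne hle hc)).2
    have hpw : y (.pr i) ≤ y (.pw i) := by
      by_contra hc
      have hne' : y (.pw i) ≠ L.length := by omega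
      exact hw (hbefore _ (hWp i hne') (hW i hne').1.2 (by omega)).2
    obtain ⟨w, hw₁, hw₂, hw₃, hw₄, hw₅⟩ := hT.reads j hjn hw
    have hwd : Processed L y w := ⟨hw₂.trans hr.1, fun h => by have := hmin w h; omega⟩
    obtain ⟨hl₁, hl₂, hl₃⟩ := hy.last w hwd hw₁
    have hl₄ := hw₅ _ hl₂ (hl₁.1.trans hr.1.symm) (hy.closed _ j hl₁ hj)
    -- `y .last` is the latest processed write and `w` the latest write before `j`; each is at least
    -- as late as the other, and times at a location are distinct.
    have hlw : w = y .last := hT.inj w _ (hwd.1.trans hl₁.1.symm) (le_antisymm hl₃ hl₄)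
    have hp := pending_serve hy.partitions (hR i hne)
    have hd : ∀ a, Processed L (adv y (.pr i)) a ↔ Processed L y a ∨ a = j := by
      intro a
      constructor
      · rintro ⟨ha, ha'⟩
        by_cases haj : a = j
        · exact Or.inr haj
        · refine Or.inl ⟨ha, fun h => ha' ((hp a).2 ⟨h, by rwa [hij]⟩)⟩
      · rintro (ha | rfl)
        · exact ⟨ha.1, fun h => ha.2 ((hp a).1 h).1⟩
        · exact ⟨hr.1, fun h => ((hp a).1 h).2 hij.symm⟩
    obtain ⟨r, hr'⟩ := ih _ (rank_adv_pr hy.le hne) (y := adv y (.pr i))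
      ⟨adv_le hy.le hne, hy.partitions.congr fun _ => rfl, by
        intro a b ha hb
        obtain ⟨hb, hbj⟩ := (hp b).1 hb
        rcases (hd a).1 ha with ha | rfl
        · exact hy.closed a b ha hb
        · exact hlt b hb (by rwa [hij] at hbj), by
        intro v hv₁ hv₂
        rcases (hd v).1 hv₁ with hv₁ | rfl
        · obtain ⟨g₁, g₂, g₃⟩ := hy.last v hv₁ hv₂
          exact ⟨(hd _).2 (Or.inl g₁), g₂, g₃⟩
        · exact absurd hv₂ hw⟩ rfl
    refine ⟨r + 1, Or.inr (Or.inr (Or.inr ⟨i, hne, Or.inr ⟨hR i hne, hpw, ?_, hr'⟩⟩))⟩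
    rw [hij, ← hlw]
    exact hw₃.symm

end Completeness

/-! ### Consistency and timings -/

section Consistency

variable {A : AbstractExecution} {L : List Event}

theorem sameAt_loc {i j : ℕ} {a b : Event} (ha : L[i]? = some a) (hb : L[j]? = some b) :
    SameAt L .loc i j ↔ a.loc = b.loc := by
  constructor
  · rintro ⟨a', b', ha', hb', h⟩
    rw [ha] at ha'; rw [hb] at hb'
    cases ha'; cases hb'
    exact bits_injective h
  · exact fun h => ⟨a, b, ha, hb, by simp [Fld.bits, h]⟩

theorem sameAt_tid {i j : ℕ} {a b : Event} (ha : L[i]? = some a) (hb : L[j]? = some b) :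
    SameAt L .tid i j ↔ a.tid = b.tid := by
  constructor
  · rintro ⟨a', b', ha', hb', h⟩
    rw [ha] at ha'; rw [hb] at hb'
    cases ha'; cases hb'
    exact bits_injective h
  · exact fun h => ⟨a, b, ha, hb, by simp [Fld.bits, h]⟩

theorem sameAt_val {i j : ℕ} {a b : Event} (ha : L[i]? = some a) (hb : L[j]? = some b) :
    SameAt L .val i j ↔ a.val = b.val := by
  constructor
  · rintro ⟨a', b', ha', hb', h⟩
    rw [ha] at ha'; rw [hb] at hb'
    cases ha'; cases hb'
    exact bits_injective h
  · exact fun h => ⟨a, b, ha, hb, by simp [Fld.bits, h]⟩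

theorem writeAt_iff {i : ℕ} {a : Event} (ha : L[i]? = some a) :
    WriteAt L i ↔ a.op = Op.write := by
  simp [WriteAt, ha]

theorem IsListing.getElem?_idxOf (h : IsListing A L) {a : Event} (ha : a ∈ A.E) :
    L[L.idxOf a]? = some a := by
  have hm := (h.mem_iff a).2 ha
  rw [List.getElem?_eq_getElem (List.idxOf_lt_length_iff.2 hm), List.getElem_idxOf]

theorem IsListing.po_of_lt (h : IsListing A L) {i j : ℕ} {a b : Event} (ha : L[i]? = some a)
    (hb : L[j]? = some b) (ht : a.tid = b.tid) (hij : i < j) : A.po a b := by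
  refine (h.po_iff a b).2 ⟨ht, ?_⟩
  obtain ⟨hi, rfl⟩ := List.getElem?_eq_some_iff.1 ha
  obtain ⟨hj, rfl⟩ := List.getElem?_eq_some_iff.1 hb
  have hi' : L[i] ∈ L.take (i + 1) := List.mem_take_iff_getElem.2 ⟨i, by omega, rfl⟩
  have hj' : L[j] ∈ L.drop (i + 1) :=
    List.mem_drop_iff_getElem.2 ⟨j - (i + 1), by omega, by congr 1; omega⟩
  have hs := (List.singleton_sublist.2 hi').append (List.singleton_sublist.2 hj')
  rwa [List.take_append_drop] at hs

theorem IsListing.lt_of_po (h : IsListing A L) {a b : Event} (hab : A.po a b) :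
    L.idxOf a < L.idxOf b := by
  obtain ⟨ha, hb⟩ := A.po_mem a b hab
  by_contra hc
  have hne : L.idxOf b ≠ L.idxOf a := by
    intro he
    have := (List.idxOf_inj ((h.mem_iff b).2 hb)).1 he
    exact A.po_irrefl a (this ▸ hab)
  have := h.po_of_lt (h.getElem?_idxOf hb) (h.getElem?_idxOf ha) (A.po_tid a b hab).symm
    (lt_of_le_of_ne (not_lt.1 hc) hne)
  exact A.po_irrefl a (A.po_trans _ _ _ hab this)

end Consistency

/-! ### Passing between timings and consistent executions -/

section Consistency

variable {A : AbstractExecution} {L : List Event}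

/-- The execution in which modification order and reads-from are given by the times. -/
def Timing.execution (hA : IsListing A L) {T : ℕ → ℕ} (hT : Timing L T) : Execution where
  toAbstractExecution := A
  rf w r := (w ∈ A.E ∧ r ∈ A.E) ∧ (w.op = Op.write ∧ r.op = Op.read) ∧ w.loc = r.loc ∧
    w.val = r.val ∧ T (L.idxOf w) < T (L.idxOf r) ∧
    ∀ w' ∈ A.E, w'.op = Op.write → w'.loc = r.loc → T (L.idxOf w') < T (L.idxOf r) →
      T (L.idxOf w') ≤ T (L.idxOf w)
  mo a b := (a ∈ A.E ∧ b ∈ A.E) ∧ (a.op = Op.write ∧ b.op = Op.write) ∧ a.loc = b.loc ∧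
    T (L.idxOf a) < T (L.idxOf b)
  rf_mem _ _ h := h.1
  rf_op _ _ h := h.2.1
  rf_loc _ _ h := h.2.2.1
  rf_val _ _ h := h.2.2.2.1
  rf_existsUnique r hr ho := by
    have hr' := hA.getElem?_idxOf hr
    obtain ⟨j, h₁, h₂, h₃, h₄, h₅⟩ := hT.reads (L.idxOf r) (List.getElem?_eq_some_iff.1 hr').1
      (by rw [writeAt_iff hr']; simp [ho])
    obtain ⟨w, hw, hwo⟩ := h₁
    have hwL : w ∈ L := List.mem_of_getElem? hw
    have hwE := (hA.mem_iff w).1 hwL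
    obtain rfl : L.idxOf w = j := by
      obtain ⟨hj, rfl⟩ := List.getElem?_eq_some_iff.1 hw
      exact hA.nodup.idxOf_getElem j hj
    refine ⟨w, ⟨⟨hwE, hr⟩, ⟨hwo, ho⟩, (sameAt_loc hw hr').1 h₂, (sameAt_val hw hr').1 h₃, h₄,
      fun w' hw' ho' hl ht => ?_⟩, ?_⟩
    · have h' := hA.getElem?_idxOf hw'
      exact h₅ _ ((writeAt_iff h').2 ho') ((sameAt_loc h' hr').2 hl) ht
    · rintro v ⟨⟨hv, -⟩, ⟨hvo, -⟩, hvl, -, hvt, hvm⟩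
      have hv' := hA.getElem?_idxOf hv
      have hle := hvm w hwE hwo ((sameAt_loc hw hr').1 h₂) h₄
      have hge := h₅ _ ((writeAt_iff hv').2 hvo) ((sameAt_loc hv' hr').2 hvl) hvt
      have := hT.inj _ _ (((sameAt_loc hv' hr').2 hvl).trans h₂.symm) (le_antisymm hge hle)
      exact (List.idxOf_inj ((hA.mem_iff v).2 hv)).1 this
  mo_mem _ _ h := h.1
  mo_op _ _ h := h.2.1
  mo_loc _ _ h := h.2.2.1
  mo_irrefl _ h := lt_irrefl _ h.2.2.2
  mo_trans _ _ _ h h' := ⟨⟨h.1.1, h'.1.2⟩, ⟨h.2.1.1, h'.2.1.2⟩, h.2.2.1.trans h'.2.2.1,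
    h.2.2.2.trans h'.2.2.2⟩
  mo_total a ha b hb hao hbo hl hne := by
    rcases lt_trichotomy (T (L.idxOf a)) (T (L.idxOf b)) with h | h | h
    · exact Or.inl ⟨⟨ha, hb⟩, ⟨hao, hbo⟩, hl, h⟩
    · have := hT.inj _ _ ((sameAt_loc (hA.getElem?_idxOf ha) (hA.getElem?_idxOf hb)).2 hl) h
      exact absurd ((List.idxOf_inj ((hA.mem_iff a).2 ha)).1 this) hne
    · exact Or.inr ⟨⟨hb, ha⟩, ⟨hbo, hao⟩, hl.symm, h⟩

/-- `ho` rules out exactly the exception in `Timing.mono`, a read followed by a write. -/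
theorem Timing.lt_of_po (hA : IsListing A L) {T : ℕ → ℕ} (hT : Timing L T) {a b : Event}
    (hab : A.po a b) (hl : a.loc = b.loc) (ho : a.op = Op.write ∨ b.op = Op.read) :
    T (L.idxOf a) < T (L.idxOf b) := by
  obtain ⟨ha, hb⟩ := A.po_mem a b hab
  have ha' := hA.getElem?_idxOf ha
  have hb' := hA.getElem?_idxOf hb
  rcases hT.mono _ _ ((sameAt_loc ha' hb').2 hl) ((sameAt_tid ha' hb').2 (A.po_tid a b hab))
    (hA.lt_of_po hab) with h | ⟨h, h'⟩
  · exact h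
  · rw [writeAt_iff ha'] at h
    rw [writeAt_iff hb'] at h'
    rcases ho with ho | ho
    · exact absurd ho h
    · simp [h'] at ho

/-- A violation of write coherence would be a pair of writes ordered both ways in time. A violation
of read coherence would give a write `v` that is later than the source `w` of `r` and still before
`r`, although `w` is the latest such write. -/
theorem Timing.consistent (hA : IsListing A L) {T : ℕ → ℕ} (hT : Timing L T) :
    A.Consistent Relaxed := by
  refine ⟨hT.execution hA, rfl, ?_, ?_⟩
  · rintro x e ⟨f, ⟨⟨-, ⟨he, hf⟩, hl, hlt⟩, -, -⟩, hpo⟩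
    exact lt_asymm hlt (hT.lt_of_po hA hpo hl.symm (Or.inl hf))
  · rintro x r ⟨w, ⟨-, ⟨hwo, hro⟩, hwl, -, hwt, hwm⟩, v, ⟨⟨⟨-, hvE⟩, ⟨-, hvo⟩, hvl, hvt⟩, -, -⟩,
      e, hve, hpo⟩
    -- The event `e` is `v` itself or reads from it, hence is not earlier than `v`.
    have key : e.loc = v.loc ∧ T (L.idxOf v) ≤ T (L.idxOf e) := by
      cases hve with
      | refl => exact ⟨rfl, le_rfl⟩
      | single h => exact ⟨h.2.2.1.symm, h.2.2.2.2.1.le⟩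
    have hlt := hT.lt_of_po hA hpo (by rw [key.1, ← hvl, hwl]) (Or.inr hro)
    exact absurd (hwm v hvE hvo (by rw [← hvl, hwl]) (key.2.trans_lt hlt)) (not_le.2 hvt)

open Classical in
/-- The number of writes before `w` in modification order. -/
noncomputable def Execution.moRank (X : Execution) (w : Event) : ℕ :=
  (X.E.filter fun a => X.mo a w).card

theorem Execution.moRank_lt (X : Execution) {a b : Event} (h : X.mo a b) :
    X.moRank a < X.moRank b := by
  classical
  refine Finset.card_lt_card (Finset.ssubset_iff_subset_ne.2 ⟨fun c hc => ?_, fun he => ?_⟩)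
  · simp only [Finset.mem_filter] at hc ⊢
    exact ⟨hc.1, X.mo_trans _ _ _ hc.2 h⟩
  · have : a ∈ X.E.filter fun c => X.mo c b := Finset.mem_filter.2 ⟨(X.mo_mem _ _ h).1, h⟩
    rw [← he] at this
    exact X.mo_irrefl a (Finset.mem_filter.1 this).2

/-- The write that an event performs or reads from. -/
def Execution.Source (X : Execution) (e w : Event) : Prop :=
  (e.op = Op.write ∧ w = e) ∨ (e.op = Op.read ∧ X.rf w e)

theorem Execution.exists_source (X : Execution) {e : Event} (he : e ∈ X.E) :
    ∃ w, X.Source e w := by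
  cases ho : e.op with
  | read =>
    obtain ⟨w, hw, -⟩ := X.rf_existsUnique e he ho
    exact ⟨w, Or.inr ⟨ho, hw⟩⟩
  | write => exact ⟨e, Or.inl ⟨ho, rfl⟩⟩

theorem Execution.Source.props {X : Execution} {e w : Event} (h : X.Source e w) (he : e ∈ X.E) :
    w ∈ X.E ∧ w.op = Op.write ∧ w.loc = e.loc ∧ w.val = e.val := by
  rcases h with ⟨ho, rfl⟩ | ⟨-, h⟩
  · exact ⟨he, ho, rfl, rfl⟩
  · exact ⟨(X.rf_mem _ _ h).1, (X.rf_op _ _ h).1, X.rf_loc _ _ h, X.rf_val _ _ h⟩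

/-- In a consistent execution the sources of the events of a thread follow modification order,
except that a write may precede the write that an earlier read reads from. -/
theorem Relaxed.not_mo_source {X : Execution} (hX : Relaxed X) {a b v w : Event} (hab : X.po a b)
    (hv : X.Source a v) (hw : X.Source b w) (ho : a.op = Op.write ∨ b.op = Op.read) :
    ¬ X.mo w v := by
  intro hm
  have hl := X.mo_loc _ _ hm
  rcases hw with ⟨hbo, rfl⟩ | ⟨hbo, hw⟩
  · rcases hv with ⟨-, rfl⟩ | ⟨hao, -⟩
    · exact hX.1 v.loc w ⟨v, ⟨hm, hl, rfl⟩, hab⟩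
    · rcases ho with ho | ho <;> simp_all
  · refine hX.2 v.loc b ⟨w, hw, v, ⟨hm, hl, rfl⟩, a, ?_, hab⟩
    rcases hv with ⟨-, rfl⟩ | ⟨-, hv⟩
    · exact .refl
    · exact .single hv

/-- Times are lexicographic: first the rank of the source in modification order, then within one
block the write before its readers, and the readers in the order of the listing. Coherence keeps the
blocks compatible with program order. -/
theorem Relaxed.exists_timing {X : Execution} (hX : Relaxed X)
    (hL : IsListing X.toAbstractExecution L) : ∃ T, Timing L T := by
  classical
  have hmem : ∀ {j : ℕ} {e : Event}, L[j]? = some e → e ∈ X.E := fun h =>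
    (hL.mem_iff _).1 (List.mem_of_getElem? h)
  have hsrc : ∀ j : ℕ, ∃ w, ∀ e, L[j]? = some e → X.Source e w := by
    intro j
    cases hj : L[j]? with
    | none => exact ⟨⟨0, 0, .read, 0, 0⟩, by simp⟩
    | some e =>
      obtain ⟨w, hw⟩ := X.exists_source (hmem hj)
      refine ⟨w, fun e' he' => ?_⟩
      cases he'
      exact hw
  choose src hsrc using hsrc
  -- A write has offset 0 and a read a positive one. Offsets are at most `L.length`, so the factor
  -- `L.length + 1` in `T` keeps the blocks disjoint.
  let off : ℕ → ℕ := fun j => if WriteAt L j then 0 else j + 1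
  let T : ℕ → ℕ := fun j => X.moRank (src j) * (L.length + 1) + off j
  have hoff : ∀ j, j < L.length → off j < L.length + 1 := by
    intro j hj
    simp only [off]
    split <;> omega
  have hlt : ∀ a b, a < L.length → X.mo (src a) (src b) → T a < T b := by
    intro a b ha h
    have h₁ := X.moRank_lt h
    have h₂ := hoff a ha
    have h₃ : (X.moRank (src a) + 1) * (L.length + 1) ≤ X.moRank (src b) * (L.length + 1) :=
      Nat.mul_le_mul_right _ h₁
    simp only [T]
    rw [Nat.add_mul] at h₃
    omega
  have htri : ∀ a b, SameAt L .loc a b →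
      X.mo (src a) (src b) ∨ src a = src b ∨ X.mo (src b) (src a) := by
    rintro a b ⟨e, f, he, hf, h⟩
    obtain ⟨h₁, h₂, h₃, -⟩ := (hsrc a e he).props (hmem he)
    obtain ⟨g₁, g₂, g₃, -⟩ := (hsrc b f hf).props (hmem hf)
    by_cases heq : src a = src b
    · exact Or.inr (Or.inl heq)
    · have hl := (sameAt_loc he hf).1 ⟨e, f, he, hf, h⟩
      rcases X.mo_total _ h₁ _ g₁ h₂ g₂ (by rw [h₃, g₃, hl]) heq with h | h
      · exact Or.inl h
      · exact Or.inr (Or.inr h)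
  have hself : ∀ j, WriteAt L j → L[j]? = some (src j) := by
    rintro j ⟨e, he, ho⟩
    rcases hsrc j e he with ⟨-, h⟩ | ⟨h, -⟩
    · rw [he, h]
    · simp [h] at ho
  have hidx : ∀ {i j : ℕ} {e : Event}, L[i]? = some e → L[j]? = some e → i = j := by
    intro i j e hi hj
    obtain ⟨hi', h⟩ := List.getElem?_eq_some_iff.1 hi
    obtain ⟨hj', h'⟩ := List.getElem?_eq_some_iff.1 hj
    exact (hL.nodup.getElem_inj_iff).1 (h.trans h'.symm)
  refine ⟨T, ⟨fun a b hs hab => ?_, fun a b hs ht hab => ?_, fun r hr hro => ?_⟩⟩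
  · rcases htri a b hs with h | h | h
    · exact absurd hab (hlt a b hs.lt_left h).ne
    · simp only [T, h, Nat.add_left_cancel_iff, off] at hab
      by_cases ha : WriteAt L a <;> by_cases hb : WriteAt L b <;> simp [ha, hb] at hab
      · exact hidx (hself a ha) (h ▸ hself b hb)
      · exact hab
    · exact absurd hab (hlt b a hs.symm.lt_left h).ne'
  · by_cases hc : ¬ WriteAt L a ∧ WriteAt L b
    · exact Or.inr hc
    left
    obtain ⟨e, f, he, hf, -⟩ := id hs
    have hpo := hL.po_of_lt he hf ((sameAt_tid he hf).1 ht) hab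
    have ho : e.op = Op.write ∨ f.op = Op.read := by
      rw [writeAt_iff he, writeAt_iff hf] at hc
      cases hfo : f.op with
      | read => exact Or.inr rfl
      | write =>
        cases heo : e.op with
        | read => exact absurd ⟨by simp [heo], hfo⟩ hc
        | write => exact Or.inl rfl
    have hn := hX.not_mo_source hpo (hsrc a e he) (hsrc b f hf) ho
    rcases htri a b hs with h | h | h
    · exact hlt a b hs.lt_left h
    · simp only [T, h, Nat.add_lt_add_iff_left, off]
      -- Within one block there is only one write, and it precedes its readers; a read followed by
      -- the write is the case excluded by `hc`.
      by_cases ha : WriteAt L a <;> by_cases hb : WriteAt L b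
      · exact absurd (hidx (hself a ha) (h ▸ hself b hb)) hab.ne
      · simp [ha, hb]
      · exact absurd ⟨ha, hb⟩ hc
      · simp [ha, hb, hab]
    · exact absurd h hn
  · have hr' : L[r]? = some L[r] := List.getElem?_eq_getElem hr
    obtain ⟨h₁, h₂, h₃, h₄⟩ := (hsrc r _ hr').props (hmem hr')
    have hw := hL.getElem?_idxOf h₁
    have hwW := (writeAt_iff hw).2 h₂
    have hws : src (L.idxOf (src r)) = src r := by
      have := hself _ hwW
      rw [hw] at this
      exact (Option.some.inj this).symm
    refine ⟨L.idxOf (src r), hwW, (sameAt_loc hw hr').2 h₃, (sameAt_val hw hr').2 h₄, ?_,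
      fun w' hw' hl hlt' => ?_⟩
    · simp [T, hws, off, hwW, hro]
    · rcases htri w' r hl with h | h | h
      · rw [← hws] at h
        exact (hlt _ _ hl.lt_left h).le
      · simp only [T, hws, off, h, hw', if_true]
        omega
      · exact absurd hlt' (hlt r w' hr h).le.not_gt

theorem consistent_iff_exists_timing (hA : IsListing A L) :
    A.Consistent Relaxed ↔ ∃ T, Timing L T := by
  constructor
  · rintro ⟨X, rfl, hX⟩
    exact hX.exists_timing hA
  · rintro ⟨T, hT⟩
    exact hT.consistent hA

/-- Each thread identifier gets one slot, represented by some event of that thread. Surplus slots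
point to `L.length`, where `SameAt` fails, so they match no event. -/
theorem IsListing.exists_partitions {k : ℕ} (hA : IsListing A L) (hk : A.numThreads ≤ k) :
    ∃ τ : Fin k → ℕ, (∀ i, τ i ≤ L.length) ∧ ∀ j < L.length, ∃ i, SameAt L .tid j (τ i) ∧
      ∀ i', i' ≠ i → ¬ SameAt L .tid j (τ i') := by
  classical
  have hnd : (A.E.image Event.tid).toList.Nodup := Finset.nodup_toList _
  have hlen : (A.E.image Event.tid).toList.length ≤ k := by
    rw [Finset.length_toList]
    exact hk
  have hmem : ∀ t, t ∈ (A.E.image Event.tid).toList ↔ ∃ e ∈ L, e.tid = t := by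
    intro t
    simp [hA.mem_iff]
  generalize (A.E.image Event.tid).toList = l at hnd hlen hmem
  have hτ : ∀ i : Fin k, ∃ p, p ≤ L.length ∧ ∀ (j : ℕ) (e : Event), L[j]? = some e →
      (SameAt L .tid j p ↔ l[(i : ℕ)]? = some e.tid) := by
    intro i
    cases hi : l[(i : ℕ)]? with
    | none =>
      refine ⟨L.length, le_rfl, fun j e _ => ⟨fun h => ?_, fun h => by simp at h⟩⟩
      exact absurd h.symm.lt_left (lt_irrefl _)
    | some t =>
      obtain ⟨e, he, rfl⟩ := (hmem t).1 (List.mem_of_getElem? hi)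
      have he' := hA.getElem?_idxOf ((hA.mem_iff e).1 he)
      refine ⟨L.idxOf e, List.idxOf_le_length, fun j f hf => ?_⟩
      rw [sameAt_tid hf he', Option.some_inj, eq_comm]
  choose τ hle hτ using hτ
  refine ⟨τ, hle, fun j hj => ?_⟩
  have hj' : L[j]? = some L[j] := List.getElem?_eq_getElem hj
  obtain ⟨m, hm, hme⟩ := List.getElem_of_mem ((hmem L[j].tid).2 ⟨_, List.getElem_mem hj, rfl⟩)
  refine ⟨⟨m, hm.trans_le hlen⟩, (hτ _ j _ hj').2 (List.getElem?_eq_some_iff.2 ⟨hm, hme⟩),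
    fun i' hne h => hne ?_⟩
  obtain ⟨hm', hme'⟩ := List.getElem?_eq_some_iff.1 ((hτ i' j _ hj').1 h)
  exact Fin.ext (hnd.getElem_inj_iff.1 (hme'.trans hme.symm))

theorem consistent_iff_reach {k : ℕ} (hA : IsListing A L) (hk : A.numThreads ≤ k) :
    A.Consistent Relaxed ↔ ∃ y : Vr k → ℕ, Initial L.length y ∧ (∀ v, y v ≤ L.length) ∧
      ∃ r, Reach L r y := by
  rw [consistent_iff_exists_timing hA]
  constructor
  · rintro ⟨T, hT⟩
    obtain ⟨τ, hle, hp⟩ := hA.exists_partitions hk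
    have hf : Follows L T (startAt L.length (fun v : Vr k => match v with
        | .tau i => τ i
        | _ => 0) 0) := by
      refine Follows.startAt (fun v => ?_) hp (Nat.zero_le _)
      cases v with
      | tau i => exact hle i
      | _ => exact Nat.zero_le _
    exact ⟨_, ⟨rfl, rfl, fun i => ⟨rfl, rfl⟩⟩, hf.le, hT.reach hf⟩
  · rintro ⟨y, hi, -, r, hr⟩
    exact hr.exists_timing hi

end Consistency

end WeakMemory

theorem corollary5 (k : ℕ) :
    WeakMemory.InPolyTime (WeakMemory.Input.encode (k := k))
      (fun I => I.exec.Consistent WeakMemory.Relaxed) :=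
  WeakMemory.inPolyTime_of_saturate (WeakMemory.stepFml k) WeakMemory.initialSrc
    (WeakMemory.loopOrder k) (WeakMemory.nodup_loopOrder k) WeakMemory.mem_loopOrder
    WeakMemory.Input.listing _ fun I =>
      (WeakMemory.consistent_iff_reach I.isListing I.threads_le).trans
        (WeakMemory.saturate_iff I.listing).symm
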